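/- **Setting.** A *finite presentation* $\langle a_1,\dots,a_g\mid R_1,\dots,R_h\rangle$ has a finite family of relators (repetitions allowed). The *$Q^{**}$ transformations* are: replace a relator $R_i$ by $R_i^{-1}$, by $R_iR_j$ with $j\ne i$, or by $wR_iw^{-1}$ for a word $w$; substitute $a_i\mapsto a_i^{-1}$ or $a_i\mapsto a_ia_j$ ($j\neq i$) in all relators; add a new generator $b$ together with the relator $b$, or undo such a step; renumber generators and relators. Consider an oriented knot diagram of a knot $K\subset S^3$ with finite crossing set $C\ne\emptyset$: combinatorially, two strands (over and under) through each crossing, edges joining consecutive passages through crossings and forming a single closed curve, and a sign at each crossing, such that the resulting 4-valent graph lies on the sphere. One region is chosen as the outer region. Three presentations of $\pi_1(S^3\setminus K)$, with base point above the diagram, are read off: * *Wirtinger presentation* $W_Y$, for a crossing $Y$: one generator $x$ for each arc (right-handed meridian); for every crossing except $Y$ the relator $x^{-1}ux\,v^{-1}$ (positive crossing) or $xux^{-1}v^{-1}$ (negative crossing), where $x$ is the over arc, $u$ the arriving and $v$ the leaving under arc. * *Edge presentation* $E_X$, for a crossing $X$: one generator $\epsilon_e$ for each edge $e$ (left-handed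 meridian). For every crossing there is the type 1 relator $\epsilon_{e'}\epsilon_{e}^{-1}$, where $e$ and $e'$ are the arriving and leaving over edges. For every crossing except $X$ there is the type 2 relator $\epsilon_{NW}\,\epsilon_{NE}\,\epsilon_{SE}^{-1}\,\epsilon_{SW}^{-1}$, where the crossing is drawn with both strands pointing upwards. * *Region presentation* $P_o$, for the outer region $o$: one generator $\rho_r$ for each region $r\ne o$, and $\rho_o=1$ (down through $r$, back through $o$). For every crossing there is the relator $\rho_{L'}\,\rho_{R'}^{-1}\,\rho_{R}\,\rho_{L}^{-1}$, where $L,R$ are the regions left and right of the arriving over edge and $L',R'$ those of the leaving over edge. **Lemma.** For every such diagram, every outer region $o$ and all crossings $X,Y$, there are finite sequences of $Q^{**}$ transformations from $W_Y$ to $E_X$ and from $E_X$ to $P_o$, hence from $W_Y$ to $P_o$. Moreover the presentation 2-complexes of $W_Y$ and $P_o$ are simple-homotopy equivalent, in the following form. There is an isomorphism $\theta$ from the group of $W_Y$ to the group of $P_o$ that sends the generator of the arc containing an edge $e$ to $\rho_{R(e)}\rho_{L(e)}^{-1}$, where $R(e),L(e)$ are the regions right and left of $e$. Over $\theta$, after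 adding finitely many cancelling pairs of cells in degrees $2$ and $1$ on either side, there is an isomorphism of the based cellular $\mathbb Z[\pi]$-chain complexes of the universal covers which is the identity in degree $0$ and is given in degrees $1$ and $2$, after matching the bases, by products of elementary matrices and diagonal matrices with entries $\pm g$, $g\in\pi$. The equivalence can be chosen so that either complex may be used to compute the torsion. That is, for every representation $\rho$ of the group of $P_o$ in $\mathrm{SU}(2)$ and every basis of $\mathfrak{su}(2)$, the induced map carries bases of the cohomology $H^*(P_o;\mathfrak{su}(2)_\rho)$ (adjoint action) to bases of $H^*(W_Y;\mathfrak{su}(2)_{\rho\theta})$. With respect to such corresponding bases the Reidemeister torsions $\tau_0^{-1}\tau_1\tau_2^{-1}$ of the two complexes are equal. Here $\tau_k$ is the modulus of the determinant of the basis $(d\,b^{k-1},\tilde h^k,b^k)$ of the $k$-cochains relative to the basis given by the cells, where $\tilde h^k$ lifts the cohomology basis to cocycles and $d\,b^k$ is a basis of the image of $d_k$; the equality holds for all choices of $\tilde h^k$ and $b^k$. For the crossingless diagram of the unknot, with either region as outer region, the Wirtinger presentation $\langle x\mid\ \rangle$ and the region presentation $\langle \rho\mid\ \rangle$ are also related by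 $Q^{**}$ transformations, and the same statements on simple homotopy equivalence and torsion hold, with $\theta(x)=\rho_R\rho_L^{-1}$. -/

import Mathlib

/-! ## Finite presentations and Q** transformations -/

/-- A finite group presentation: finitely many generators and a finite indexed family of relators
(the same word may occur several times). -/
structure Presentation where
  gens : Type
  rels : Type
  finGens : Finite gens
  finRels : Finite rels
  rel : rels → FreeGroup gens

namespace Presentation

instance (P : Presentation) : Finite P.gens := P.finGens
instance (P : Presentation) : Finite P.rels := P.finRels
noncomputable instance (P : Presentation) : Fintype P.gens := Fintype.ofFinite _
noncomputable instance (P : Presentation) : Fintype P.rels := Fintype.ofFinite _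
noncomputable instance (P : Presentation) : DecidableEq P.gens := Classical.decEq _
noncomputable instance (P : Presentation) : DecidableEq P.rels := Classical.decEq _

/-- The group defined by the presentation. -/
abbrev Grp (P : Presentation) : Type := PresentedGroup (Set.range P.rel)

/-- The quotient map from the free group on the generators. -/
def proj (P : Presentation) : FreeGroup P.gens →* P.Grp := PresentedGroup.mk (Set.range P.rel)

/-- Replace the relators, keeping generators and index set. -/
def withRel (P : Presentation) (r : P.rels → FreeGroup P.gens) : Presentation :=
  { P with rel := r }

/-- The substitution that replaces the generator `x` by the word `w` in all relators. -/
noncomputable def substitute (P : Presentation) (x : P.gens) (w : FreeGroup P.gens) :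
    Presentation :=
  P.withRel fun k => FreeGroup.lift (Function.update FreeGroup.of x w) (P.rel k)

/-- Prolongation: add one new generator `b` and the relator `b`. -/
def prolong (P : Presentation) : Presentation where
  gens := Option P.gens
  rels := Option P.rels
  finGens := inferInstance
  finRels := inferInstance
  rel
    | none => FreeGroup.of none
    | some i => FreeGroup.map some (P.rel i)

end Presentation

/-- A single Q** transformation. -/
inductive QStep : Presentation → Presentation → Prop
  /-- Replace a relator by its inverse. -/
  | relInv (P : Presentation) (i : P.rels) :
      QStep P (P.withRel (Function.update P.rel i (P.rel i)⁻¹))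
  /-- Multiply a relator by a different relator. -/
  | relMul (P : Presentation) (i j : P.rels) (hij : i ≠ j) :
      QStep P (P.withRel (Function.update P.rel i (P.rel i * P.rel j)))
  /-- Conjugate a relator by a word. -/
  | relConj (P : Presentation) (i : P.rels) (w : FreeGroup P.gens) :
      QStep P (P.withRel (Function.update P.rel i (w * P.rel i * w⁻¹)))
  /-- Elementary change of generators: inversion. -/
  | genInv (P : Presentation) (x : P.gens) :
      QStep P (P.substitute x (FreeGroup.of x)⁻¹)
  /-- Elementary change of generators: multiplication by a different generator. -/
  | genMul (P : Presentation) (x y : P.gens) (hxy : x ≠ y) :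
      QStep P (P.substitute x (FreeGroup.of x * FreeGroup.of y))
  /-- Add a new generator together with the relator equal to it. -/
  | prolong (P : Presentation) : QStep P P.prolong
  /-- The inverse of a prolongation. -/
  | unprolong (P : Presentation) : QStep P.prolong P
  /-- Rename (or renumber) generators and relators. -/
  | relabel (P Q : Presentation) (e : P.gens ≃ Q.gens) (f : P.rels ≃ Q.rels)
      (h : ∀ i, Q.rel (f i) = FreeGroup.map e (P.rel i)) : QStep P Q

/-- `Q` is obtained from `P` by a finite sequence of Q** transformations. -/
def QEquiv (P Q : Presentation) : Prop := Relation.ReflTransGen QStep P Q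

/-! ## The 2-complex of a presentation and simple homotopy equivalence

The 2-complex of `P` has one 0-cell, a 1-cell for each generator and a 2-cell for each relator,
attached along the relator. Its universal cover has a cellular chain complex of based free left
modules over the integral group ring `ℤ[π]`. A map of based free modules is recorded as a matrix
whose row `i` expresses the image of the basis element `i`; hence `f` followed by `g` has the matrix
`F * G`. -/

/-- The Fox derivative with respect to `x` of the word spelled by a list of signed letters, pushed
forward along `q`: the coefficient of the cell `x` in the lift of the edge path. -/
noncomputable def foxWord {α Γ : Type} [DecidableEq α] [Group Γ] (q : FreeGroup α →* Γ) (x : α) :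
    List (α × Bool) → MonoidAlgebra ℤ Γ
  | [] => 0
  | (y, true) :: w =>
      (if y = x then 1 else 0) + MonoidAlgebra.single (q (FreeGroup.of y)) 1 * foxWord q x w
  | (y, false) :: w =>
      MonoidAlgebra.single (q (FreeGroup.of y))⁻¹ 1 * (foxWord q x w - if y = x then 1 else 0)

/-- Elementary matrices over `ℤ[Γ]`: transvections, and diagonal matrices with a trivial unit
`± g` in one place and `1` elsewhere. -/
def IsElementary {ι Γ : Type} [DecidableEq ι] [Group Γ]
    (M : Matrix ι ι (MonoidAlgebra ℤ Γ)) : Prop :=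
  (∃ (i j : ι) (c : MonoidAlgebra ℤ Γ), i ≠ j ∧ M = 1 + Matrix.single i j c) ∨
  (∃ (i : ι) (g : Γ) (u : ℤˣ),
    M = Matrix.diagonal (Function.update 1 i (MonoidAlgebra.single g (u : ℤ))))

/-- A simple isomorphism of based free modules: after some matching of the two bases, a product
of elementary matrices. -/
def IsSimpleIso {ι κ Γ : Type} [Fintype ι] [DecidableEq ι] [Group Γ]
    (M : Matrix ι κ (MonoidAlgebra ℤ Γ)) : Prop :=
  ∃ e : ι ≃ κ, M.submatrix id e ∈
    Submonoid.closure {N : Matrix ι ι (MonoidAlgebra ℤ Γ) | IsElementary N}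

namespace Presentation

/-- The boundary map in degree one, over `ℤ[Γ]`. -/
noncomputable def bdry₁ (P : Presentation) {Γ : Type} [Group Γ] (q : FreeGroup P.gens →* Γ) :
    Matrix P.gens Unit (MonoidAlgebra ℤ Γ) :=
  Matrix.of fun x _ => MonoidAlgebra.single (q (FreeGroup.of x)) 1 - 1

/-- The boundary map in degree two, over `ℤ[Γ]`. -/
noncomputable def bdry₂ (P : Presentation) {Γ : Type} [Group Γ] (q : FreeGroup P.gens →* Γ) :
    Matrix P.rels P.gens (MonoidAlgebra ℤ Γ) :=
  Matrix.of fun i x => foxWord q x (P.rel i).toWord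

/-- `bdry₁` after adding `a` cancelling pairs of cells in degrees two and one. -/
noncomputable def stabBdry₁ (P : Presentation) {Γ : Type} [Group Γ] (q : FreeGroup P.gens →* Γ)
    (a : ℕ) : Matrix (P.gens ⊕ Fin a) Unit (MonoidAlgebra ℤ Γ) :=
  Matrix.fromRows (P.bdry₁ q) 0

/-- `bdry₂` after adding `a` cancelling pairs of cells in degrees two and one. -/
noncomputable def stabBdry₂ (P : Presentation) {Γ : Type} [Group Γ] (q : FreeGroup P.gens →* Γ)
    (a : ℕ) : Matrix (P.rels ⊕ Fin a) (P.gens ⊕ Fin a) (MonoidAlgebra ℤ Γ) :=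
  Matrix.fromBlocks (P.bdry₂ q) 0 0 1

end Presentation

/-- A simple homotopy equivalence between the 2-complexes of `P` and `Q`: an isomorphism `θ` of
fundamental groups and, over `θ`, an isomorphism of the based cellular chain complexes of the
universal covers after adding finitely many cancelling pairs of cells on either side, which is the
identity in degree zero and a simple isomorphism in degrees one and two. -/
structure SimpleEquivalence (P Q : Presentation) where
  θ : P.Grp ≃* Q.Grp
  a : ℕ
  b : ℕ
  F₁ : Matrix (P.gens ⊕ Fin a) (Q.gens ⊕ Fin b) (MonoidAlgebra ℤ Q.Grp)
  F₂ : Matrix (P.rels ⊕ Fin a) (Q.rels ⊕ Fin b) (MonoidAlgebra ℤ Q.Grp)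
  simple₁ : IsSimpleIso F₁
  simple₂ : IsSimpleIso F₂
  comm₁ : P.stabBdry₁ (θ.toMonoidHom.comp P.proj) a = F₁ * Q.stabBdry₁ Q.proj b
  comm₂ : P.stabBdry₂ (θ.toMonoidHom.comp P.proj) a * F₁ = F₂ * Q.stabBdry₂ Q.proj b

namespace SimpleEquivalence

/-- The chain map between the unstabilized chain complexes, in degree one. -/
def f₁ {P Q : Presentation} (E : SimpleEquivalence P Q) :
    Matrix P.gens Q.gens (MonoidAlgebra ℤ Q.Grp) := E.F₁.toBlocks₁₁

/-- The chain map between the unstabilized chain complexes, in degree two. -/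
def f₂ {P Q : Presentation} (E : SimpleEquivalence P Q) :
    Matrix P.rels Q.rels (MonoidAlgebra ℤ Q.Grp) := E.F₂.toBlocks₁₁

end SimpleEquivalence

/-! ## Twisted cohomology and Reidemeister torsion -/

/-- The group `SU(2)`. -/
abbrev SU2 : Type := Matrix.specialUnitaryGroup (Fin 2) ℂ

/-- The Lie algebra `su(2)` of traceless skew-hermitian matrices, as a real vector space. -/
def su2 : Submodule ℝ (Matrix (Fin 2) (Fin 2) ℂ) where
  carrier := {A | A.conjTranspose = -A ∧ A.trace = 0}
  add_mem' := by
    rintro A B ⟨hA, hA'⟩ ⟨hB, hB'⟩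
    refine ⟨?_, ?_⟩
    · rw [Matrix.conjTranspose_add, hA, hB, neg_add]
    · rw [Matrix.trace_add, hA', hB', add_zero]
  zero_mem' := by simp
  smul_mem' := by
    rintro c A ⟨hA, hA'⟩
    refine ⟨?_, ?_⟩
    · rw [Matrix.conjTranspose_smul, hA, star_trivial, smul_neg]
    · rw [Matrix.trace_smul, hA', smul_zero]

/-- The adjoint action `A ↦ g A g⁻¹` of `SU(2)` on `su(2)`. -/
def adjointAction : SU2 →* Module.End ℝ su2 where
  toFun g :=
    { toFun := fun A => ⟨(g : Matrix (Fin 2) (Fin 2) ℂ) * A * (g⁻¹ : SU2), by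
        have hg : ((g⁻¹ : SU2) : Matrix (Fin 2) (Fin 2) ℂ) =
            (g : Matrix (Fin 2) (Fin 2) ℂ).conjTranspose := rfl
        have h1 : ((g⁻¹ : SU2) : Matrix (Fin 2) (Fin 2) ℂ) * (g : Matrix (Fin 2) (Fin 2) ℂ) = 1 :=
          congrArg Subtype.val (inv_mul_cancel g)
        refine ⟨?_, ?_⟩
        · rw [hg, Matrix.conjTranspose_mul, Matrix.conjTranspose_mul,
            Matrix.conjTranspose_conjTranspose, A.2.1]
          simp [Matrix.mul_assoc]
        · rw [Matrix.trace_mul_comm, ← Matrix.mul_assoc, h1, Matrix.one_mul, A.2.2]⟩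
      map_add' := fun A B => by
        ext1
        simp [Matrix.mul_add, Matrix.add_mul]
      map_smul' := fun c A => by
        ext1
        simp }
  map_one' := by
    ext1 A
    ext1
    simp
  map_mul' g h := by
    ext1 A
    ext1
    simp [Matrix.mul_assoc]

/-- The action of the group ring on `su(2)` determined by a flat connection `ρ`. -/
noncomputable def ringAction {Γ : Type} [Group Γ] (ρ : Γ →* SU2) :
    MonoidAlgebra ℤ Γ →ₐ[ℤ] Module.End ℝ su2 :=
  MonoidAlgebra.lift ℤ (Module.End ℝ su2) Γ (adjointAction.comp ρ)

/-- The map on `su(2)`-valued twisted cochains dual to a matrix over the group ring. -/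
noncomputable def pullback {Γ ι κ : Type} [Group Γ] [Fintype κ] (ρ : Γ →* SU2)
    (M : Matrix ι κ (MonoidAlgebra ℤ Γ)) : (κ → su2) →ₗ[ℝ] (ι → su2) :=
  LinearMap.pi fun i => ∑ k, ringAction ρ (M i k) ∘ₗ LinearMap.proj k

/-- The number `[a/b]`: the modulus of the determinant of the matrix expressing the basis `a`
through the basis `b`. -/
noncomputable def basisRatio {ι κ V : Type} [Fintype κ] [DecidableEq κ] [AddCommGroup V]
    [Module ℝ V] (a : Module.Basis ι ℝ V) (b : Module.Basis κ ℝ V) : ℝ :=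
  |b.det (a.reindex (a.indexEquiv b))|

namespace Presentation

/-- The twisted coboundary from 0-cochains to 1-cochains of the 2-complex of `P`. -/
noncomputable def cobdry₀ (P : Presentation) (ρ : P.Grp →* SU2) :
    (Unit → su2) →ₗ[ℝ] (P.gens → su2) := pullback ρ (P.bdry₁ P.proj)

/-- The twisted coboundary from 1-cochains to 2-cochains of the 2-complex of `P`. -/
noncomputable def cobdry₁ (P : Presentation) (ρ : P.Grp →* SU2) :
    (P.gens → su2) →ₗ[ℝ] (P.rels → su2) := pullback ρ (P.bdry₂ P.proj)

end Presentation

/-- The choices entering the Reidemeister torsion of the 2-complex of `P` with flat connection `ρ`,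
where the twisted cohomology has dimensions `n₀`, `n₁`, `n₂`: lifts `h₀`, `h₁`, `h₂` to cocycles of
bases of cohomology, and families `b₀`, `b₁` of cochains whose coboundaries are bases of the images
of the coboundary maps. `B₀`, `B₁`, `B₂` are the combined bases `(h₀, b₀)`, `(d b₀, h₁, b₁)`,
`(d b₁, h₂)` of the cochain spaces. -/
structure TorsionChoice (P : Presentation) (ρ : P.Grp →* SU2) (n₀ n₁ n₂ : ℕ) where
  m₀ : ℕ
  m₁ : ℕ
  B₀ : Module.Basis (Fin n₀ ⊕ Fin m₀) ℝ (Unit → su2)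
  B₁ : Module.Basis (Fin m₀ ⊕ (Fin n₁ ⊕ Fin m₁)) ℝ (P.gens → su2)
  B₂ : Module.Basis (Fin m₁ ⊕ Fin n₂) ℝ (P.rels → su2)
  closed₀ : ∀ i, P.cobdry₀ ρ (B₀ (Sum.inl i)) = 0
  closed₁ : ∀ i, P.cobdry₁ ρ (B₁ (Sum.inr (Sum.inl i))) = 0
  image₀ : ∀ j, B₁ (Sum.inl j) = P.cobdry₀ ρ (B₀ (Sum.inr j))
  image₁ : ∀ j, B₂ (Sum.inl j) = P.cobdry₁ ρ (B₁ (Sum.inr (Sum.inr j)))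

namespace TorsionChoice

variable {P : Presentation} {ρ : P.Grp →* SU2} {n₀ n₁ n₂ : ℕ}

noncomputable def h₀ (T : TorsionChoice P ρ n₀ n₁ n₂) (i : Fin n₀) : Unit → su2 := T.B₀ (Sum.inl i)
noncomputable def h₁ (T : TorsionChoice P ρ n₀ n₁ n₂) (i : Fin n₁) : P.gens → su2 := T.B₁ (Sum.inr (Sum.inl i))
noncomputable def h₂ (T : TorsionChoice P ρ n₀ n₁ n₂) (i : Fin n₂) : P.rels → su2 := T.B₂ (Sum.inr i)

/-- The Reidemeister torsion `τ₀⁻¹ τ₁ τ₂⁻¹`, relative to the bases of the cochain spaces obtained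
from the cells and the basis `l` of `su(2)`. -/
noncomputable def torsion (T : TorsionChoice P ρ n₀ n₁ n₂) (l : Module.Basis (Fin 3) ℝ su2) : ℝ :=
  (basisRatio T.B₀ (Pi.basis fun _ : Unit => l))⁻¹ *
    basisRatio T.B₁ (Pi.basis fun _ : P.gens => l) *
    (basisRatio T.B₂ (Pi.basis fun _ : P.rels => l))⁻¹

end TorsionChoice

namespace SimpleEquivalence

/-- The cohomology bases chosen for `P` are the pullbacks of those chosen for `Q`. -/
def Matches {P Q : Presentation} (E : SimpleEquivalence P Q) {ρ : Q.Grp →* SU2} {n₀ n₁ n₂ : ℕ}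
    (S : TorsionChoice Q ρ n₀ n₁ n₂)
    (T : TorsionChoice P (ρ.comp E.θ.toMonoidHom) n₀ n₁ n₂) : Prop :=
  (∀ i, T.h₀ i = S.h₀ i) ∧
  (∀ i, ∃ y, T.h₁ i = pullback ρ E.f₁ (S.h₁ i) + P.cobdry₀ (ρ.comp E.θ.toMonoidHom) y) ∧
  (∀ i, ∃ y, T.h₂ i = pullback ρ E.f₂ (S.h₂ i) + P.cobdry₁ (ρ.comp E.θ.toMonoidHom) y)

/-- Either complex may be used to compute the torsion: for every flat connection, every basis of
the twisted cohomology of `Q` pulls back to a basis of the twisted cohomology of `P`, and the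
torsions with respect to such bases agree, whatever the remaining choices. -/
def PreservesTorsion {P Q : Presentation} (E : SimpleEquivalence P Q) : Prop :=
  ∀ (l : Module.Basis (Fin 3) ℝ su2) (ρ : Q.Grp →* SU2) (n₀ n₁ n₂ : ℕ)
    (S : TorsionChoice Q ρ n₀ n₁ n₂),
    (∃ T : TorsionChoice P (ρ.comp E.θ.toMonoidHom) n₀ n₁ n₂, E.Matches S T) ∧
    ∀ T : TorsionChoice P (ρ.comp E.θ.toMonoidHom) n₀ n₁ n₂, E.Matches S T →
      T.torsion l = S.torsion l

end SimpleEquivalence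

/-! ## Knot diagrams -/

/-- The combinatorial data of an oriented diagram with crossing set `C`. At a crossing `c` there
are two strands, the over strand `(c, true)` and the under strand `(c, false)`. An edge of the
diagram (a segment between consecutive passages through crossings) is denoted by the pair `(c, s)`
at which it arrives; then `next (c, s)` is the edge that leaves `c` on the strand `s`. -/
structure CrossingData (C : Type) where
  next : Equiv.Perm (C × Bool)
  /-- `true` for a positive (right-handed) crossing, `false` for a negative one. -/
  positive : C → Bool

namespace CrossingData

variable {C : Type} (D : CrossingData C)

/-- Draw the crossing with both strands pointing upwards. This is the edge arriving from the lower
left; its strand leaves to the upper right. At a positive crossing it is the over strand. -/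
def fromSW (c : C) : C × Bool := (c, D.positive c)

/-- The edge arriving from the lower right; its strand leaves to the upper left. -/
def fromSE (c : C) : C × Bool := (c, !D.positive c)

/-- The edge leaving to the upper right. -/
def toNE (c : C) : C × Bool := D.next (D.fromSW c)

/-- The edge leaving to the upper left. -/
def toNW (c : C) : C × Bool := D.next (D.fromSE c)

/-- The sides of edges that meet in a corner of a crossing. The side `(e, true)` is the left side
of the edge `e`, and `(e, false)` its right side. -/
inductive Corner : (C × Bool) × Bool → (C × Bool) × Bool → Prop
  | north (c : C) : Corner (D.toNW c, false) (D.toNE c, true)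
  | east (c : C) : Corner (D.toNE c, false) (D.fromSE c, false)
  | south (c : C) : Corner (D.fromSE c, true) (D.fromSW c, false)
  | west (c : C) : Corner (D.fromSW c, true) (D.toNW c, true)

/-- The regions of the diagram: classes of sides of edges joined through corners. -/
def Region : Type := Quot D.Corner

instance [Finite C] : Finite D.Region := inferInstanceAs (Finite (Quot D.Corner))

/-- The region to the left of an edge. -/
def left (e : C × Bool) : D.Region := Quot.mk _ (e, true)

/-- The region to the right of an edge. -/
def right (e : C × Bool) : D.Region := Quot.mk _ (e, false)

/-- Two consecutive edges belong to the same arc if they meet in an over strand. -/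
inductive Continues : C × Bool → C × Bool → Prop
  | over (c : C) : Continues (c, true) (D.next (c, true))

/-- The arcs of the diagram. -/
def Arc : Type := Quot D.Continues

instance [Finite C] : Finite D.Arc := inferInstanceAs (Finite (Quot D.Continues))

/-- The arc that contains an edge. -/
def arc (e : C × Bool) : D.Arc := Quot.mk _ e

end CrossingData

/-- An oriented knot diagram with crossing set `C` on the sphere. -/
structure KnotDiagram (C : Type) extends CrossingData C where
  /-- There is a single component: every edge is reached from every other one. -/
  knot : ∀ e f : C × Bool, next.SameCycle e f
  /-- The 4-valent graph with `|C|` vertices and `2|C|` edges is drawn on the sphere: its Euler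
  characteristic `V - E + F` is two. -/
  planar : Nat.card toCrossingData.Region = Nat.card C + 2

open scoped Classical in
/-- The generator `ρ_r` of a region, equal to `1` for the outer region. -/
noncomputable def regionGen {R : Type} (outer r : R) : FreeGroup {s : R // s ≠ outer} :=
  if h : r = outer then 1 else FreeGroup.of ⟨r, h⟩

namespace KnotDiagram

variable {C : Type} [Finite C] (D : KnotDiagram C)

/-- The region presentation. The generator of a region is the loop that pierces that region from
above and returns through the outer region. The relator of a crossing is the loop, clockwise as
viewed from above, around a vertical segment joining the two strands: going round the crossing,
it runs below the over strand and above the under strand. -/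
noncomputable def regionPresentation (outer : D.Region) : Presentation where
  gens := {r : D.Region // r ≠ outer}
  rels := C
  finGens := inferInstance
  finRels := inferInstance
  rel c := regionGen outer (D.left (D.next (c, true))) *
    (regionGen outer (D.right (D.next (c, true))))⁻¹ *
    regionGen outer (D.right (c, true)) * (regionGen outer (D.left (c, true)))⁻¹

/-- The edge presentation, with the type 2 relator at `X` omitted. The generator of an edge is the
loop around it in the sense of a left-handed screw, which goes down on its left and comes up on its
right. The type 1 relators identify the two edges of each over strand; the type 2 relators are the
loops below the whole crossing. -/
def edgePresentation (X : C) : Presentation where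
  gens := C × Bool
  rels := C ⊕ {c : C // c ≠ X}
  finGens := inferInstance
  finRels := inferInstance
  rel
    | Sum.inl c => FreeGroup.of (D.next (c, true)) * (FreeGroup.of (c, true))⁻¹
    | Sum.inr c => FreeGroup.of (D.toNW c) * FreeGroup.of (D.toNE c) *
        (FreeGroup.of (D.fromSE c))⁻¹ * (FreeGroup.of (D.fromSW c))⁻¹

/-- The Wirtinger presentation, with the relator at `X` omitted. The generator of an arc is the loop
around it in the sense of a right-handed screw. If `x` is the over arc, `u` the arriving and `u'`
the leaving under arc, the relation is `u' = x⁻¹ u x` at a positive crossing and `u' = x u x⁻¹` at a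
negative crossing. -/
def wirtingerPresentation (X : C) : Presentation where
  gens := D.Arc
  rels := {c : C // c ≠ X}
  finGens := inferInstance
  finRels := inferInstance
  rel c :=
    let x : FreeGroup D.Arc := FreeGroup.of (D.arc (c, true))
    let u : FreeGroup D.Arc := FreeGroup.of (D.arc (c, false))
    let v : FreeGroup D.Arc := FreeGroup.of (D.arc (D.next (c, false)))
    if D.positive c then x⁻¹ * u * x * v⁻¹ else x * u * x⁻¹ * v⁻¹

end KnotDiagram

/-! ## The diagram of the unknot without crossings

It has one arc, and two regions, `true` on the left and `false` on the right of the curve. -/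

/-- The Wirtinger presentation of the crossingless diagram. -/
def circleWirtinger : Presentation where
  gens := Unit
  rels := Empty
  finGens := inferInstance
  finRels := inferInstance
  rel := Empty.elim

/-- The region presentation of the crossingless diagram. -/
def circleRegion (outer : Bool) : Presentation where
  gens := {r : Bool // r ≠ outer}
  rels := Empty
  finGens := inferInstance
  finRels := inferInstance
  rel := Empty.elim

/-! ## Fox calculus -/

section Fox

variable {α β Γ Δ : Type} [DecidableEq α] [Group Γ] [Group Δ]

/-! The proof follows a fixed group `Γ` through a chain of presentations. The relation `Related`
records three facts at once: two homomorphisms onto `Γ` present it simultaneously, the presentations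
differ by Q** moves, and their based complexes over `ℤ[Γ]` are simply isomorphic after
stabilisation. It is an equivalence relation, so only the elementary moves need a computation, and
that computation is Fox calculus. Relators become trivial in `Γ`, so changing a relator multiplies
the matrix in degree two by an elementary matrix. By the chain rule, a substitution of generators
acts in degree one by its Jacobian, again elementary. A prolongation adds one cancelling pair.

Two compound moves carry the geometry. `Related.adjoin` adds generators defined by words in the old
ones. `Related.withRel` replaces many relators together, provided that each new one is, modulo old
relators of lower rank, a conjugate of the old one or of its inverse.

For edges against regions, put `δ_e : ε_e = ρ_L ρ_R⁻¹`. The common refinement has all edges and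
regions as generators, and the type 1 relators and all `δ_e` as relators. Eliminating the edges from
it turns the type 1 relators into the region relators. To reach it from the edge presentation,
choose a spanning tree of the diagram rooted at `X`, and a spanning tree of the dual graph, rooted
at the outer region, that avoids the first. By Euler characteristic two, these trees together use
every edge exactly once (`tree_bijective`). The regions are adjoined as words along the dual tree,
and their definitions are exchanged for the `δ_e` of dual tree edges. A type 2 relator telescopes
once `ε = ρ_L ρ_R⁻¹` holds. Given `δ` for three edges at a crossing it is therefore equivalent to
`δ` for the fourth. Working inwards from the leaves, the type 2 relators are exchanged for the `δ_e`
of the tree edges.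

For arcs against edges, an edge is the inverse of its arc. Along each arc the type 1 relators
identify its edges one after another, and then the type 2 relators become Wirtinger relators up to
conjugation. The omitted crossing can be changed because every edge presentation is related to the
same region presentation.

For the torsion, a simple isomorphism acts on `su(2)`-valued cochains with determinant of modulus
one: the adjoint action preserves a definite form, and a transvection is conjugate to its inverse.
An acyclic summand does not change the torsion, and changes in the families `b₀`, `b₁` cancel
between adjacent degrees (`exists_ratio`). -/

theorem foxWord_append (q : FreeGroup α →* Γ) (x : α) (l m : List (α × Bool)) :
    foxWord q x (l ++ m) =
      foxWord q x l + MonoidAlgebra.single (q (FreeGroup.mk l)) 1 * foxWord q x m := by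
  induction l with
  | nil => simp [foxWord, ← FreeGroup.one_eq_mk, ← MonoidAlgebra.one_def]
  | cons a l ih =>
    obtain ⟨y, b⟩ := a
    have hc : FreeGroup.mk ((y, b) :: l) = FreeGroup.mk [(y, b)] * FreeGroup.mk l := by
      rw [FreeGroup.mul_mk]; rfl
    cases b
    · have hy : FreeGroup.mk [(y, false)] = (FreeGroup.of y)⁻¹ := by
        simp [FreeGroup.of, FreeGroup.inv_mk, FreeGroup.invRev]
      rw [hc, hy, map_mul, map_inv, List.cons_append, foxWord, foxWord, ih,
        ← one_mul (1 : ℤ), ← MonoidAlgebra.single_mul_single]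
      simp only [mul_sub, mul_add, mul_assoc, one_mul]
      abel
    · have hy : FreeGroup.mk [(y, true)] = FreeGroup.of y := rfl
      rw [hc, hy, map_mul, List.cons_append, foxWord, foxWord, ih,
        ← one_mul (1 : ℤ), ← MonoidAlgebra.single_mul_single]
      simp only [mul_add, mul_assoc, one_mul, add_assoc]

theorem foxWord_cancel (q : FreeGroup α →* Γ) (x y : α) (b : Bool) :
    foxWord q x [(y, b), (y, !b)] = 0 := by
  cases b <;>
    simp [foxWord, MonoidAlgebra.single_mul_single, ← MonoidAlgebra.one_def]

/-- A cancelling pair has derivative zero and trivial value, so the product rule lets it be cut out.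
This is what makes the derivative well defined on the free group. -/
theorem foxWord_step (q : FreeGroup α →* Γ) (x : α) {l m : List (α × Bool)}
    (h : FreeGroup.Red.Step l m) : foxWord q x l = foxWord q x m := by
  cases h with
  | @not L₁ L₂ y b =>
    have hs : L₁ ++ (y, b) :: (y, !b) :: L₂ = L₁ ++ ([(y, b), (y, !b)] ++ L₂) := rfl
    have h1 : FreeGroup.mk [(y, b), (y, !b)] = 1 := by
      rw [FreeGroup.one_eq_mk]
      exact Quot.sound (FreeGroup.Red.Step.not (L₁ := []) (L₂ := []))
    rw [hs, foxWord_append, foxWord_append, foxWord_cancel, h1, foxWord_append q x L₁ L₂]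
    simp [← MonoidAlgebra.one_def]

theorem foxWord_red (q : FreeGroup α →* Γ) (x : α) {l m : List (α × Bool)}
    (h : FreeGroup.Red l m) : foxWord q x l = foxWord q x m := by
  induction h with
  | refl => rfl
  | tail _ h ih => exact ih.trans (foxWord_step q x h)

/-- The Fox derivative of an element of the free group. -/
noncomputable def fox (q : FreeGroup α →* Γ) (x : α) (w : FreeGroup α) : MonoidAlgebra ℤ Γ :=
  foxWord q x w.toWord

theorem fox_mk (q : FreeGroup α →* Γ) (x : α) (l : List (α × Bool)) :
    fox q x (FreeGroup.mk l) = foxWord q x l :=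
  (foxWord_red q x FreeGroup.reduce.red).symm

theorem fox_mul (q : FreeGroup α →* Γ) (x : α) (v w : FreeGroup α) :
    fox q x (v * w) = fox q x v + MonoidAlgebra.single (q v) 1 * fox q x w := by
  rw [← FreeGroup.mk_toWord (x := v), ← FreeGroup.mk_toWord (x := w), FreeGroup.mul_mk, fox_mk,
    fox_mk, fox_mk, foxWord_append]

@[simp] theorem fox_one (q : FreeGroup α →* Γ) (x : α) : fox q x 1 = 0 := by
  simp [fox, foxWord]

theorem fox_of (q : FreeGroup α →* Γ) (x y : α) :
    fox q x (FreeGroup.of y) = if y = x then 1 else 0 := by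
  simp [fox, foxWord]

/-- Differentiate `w⁻¹ * w = 1`. -/
theorem fox_inv (q : FreeGroup α →* Γ) (x : α) (w : FreeGroup α) :
    fox q x w⁻¹ = -(MonoidAlgebra.single (q w)⁻¹ 1 * fox q x w) := by
  have h := fox_mul q x w⁻¹ w
  rw [inv_mul_cancel, fox_one, map_inv] at h
  exact eq_neg_of_add_eq_zero_left h.symm

/-- The fundamental formula of the Fox calculus. -/
theorem sum_fox_mul [Fintype α] (q : FreeGroup α →* Γ) (w : FreeGroup α) :
    ∑ x, fox q x w * (MonoidAlgebra.single (q (FreeGroup.of x)) 1 - 1) =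
      MonoidAlgebra.single (q w) 1 - 1 := by
  have hmul : ∀ v w : FreeGroup α,
      ∑ x, fox q x v * (MonoidAlgebra.single (q (FreeGroup.of x)) 1 - 1) =
        MonoidAlgebra.single (q v) 1 - 1 →
      ∑ x, fox q x w * (MonoidAlgebra.single (q (FreeGroup.of x)) 1 - 1) =
        MonoidAlgebra.single (q w) 1 - 1 →
      ∑ x, fox q x (v * w) * (MonoidAlgebra.single (q (FreeGroup.of x)) 1 - 1) =
        MonoidAlgebra.single (q (v * w)) (1 : ℤ) - 1 := by
    intro v w hv hw
    simp only [fox_mul, add_mul, Finset.sum_add_distrib, mul_assoc, ← Finset.mul_sum, hv, hw]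
    simp [mul_sub, MonoidAlgebra.single_mul_single]
  have hof : ∀ y : α, ∑ x, fox q x (FreeGroup.of y) *
      (MonoidAlgebra.single (q (FreeGroup.of x)) 1 - 1) =
        MonoidAlgebra.single (q (FreeGroup.of y)) (1 : ℤ) - 1 := by
    intro y
    simp [fox_of]
  induction w using FreeGroup.induction_on with
  | C1 => simp [MonoidAlgebra.one_def]
  | of y => exact hof y
  | inv_of y _ =>
    simp only [fox_inv, neg_mul, mul_assoc, Finset.sum_neg_distrib, ← Finset.mul_sum, hof]
    simp [mul_sub, MonoidAlgebra.single_mul_single, MonoidAlgebra.one_def]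
  | mul v w hv hw => exact hmul v w hv hw

/-- The chain rule of the Fox calculus. -/
theorem fox_chain [Fintype α] [DecidableEq β] (φ : FreeGroup α →* FreeGroup β)
    (q : FreeGroup β →* Γ) (y : β) (w : FreeGroup α) :
    fox q y (φ w) = ∑ x, fox (q.comp φ) x w * fox q y (φ (FreeGroup.of x)) := by
  induction w using FreeGroup.induction_on with
  | C1 => simp
  | of z => simp [fox_of]
  | inv_of z h =>
    simp only [map_inv, fox_inv, h, neg_mul, mul_assoc, Finset.sum_neg_distrib, ← Finset.mul_sum]
    rfl
  | mul v w hv hw =>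
    simp only [map_mul, fox_mul, hv, hw, add_mul, Finset.sum_add_distrib, mul_assoc,
      ← Finset.mul_sum]
    rfl

end Fox

/-! ### Boundary matrices and the fundamental formula -/

namespace Presentation

variable {Γ : Type} [Group Γ]

theorem bdry₂_apply (P : Presentation) (q : FreeGroup P.gens →* Γ) (i : P.rels) (x : P.gens) :
    P.bdry₂ q i x = fox q x (P.rel i) := rfl

theorem bdry₁_apply (P : Presentation) (q : FreeGroup P.gens →* Γ) (x : P.gens) (u : Unit) :
    P.bdry₁ q x u = MonoidAlgebra.single (q (FreeGroup.of x)) 1 - 1 := rfl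

theorem bdry₂_mul_bdry₁ (P : Presentation) (q : FreeGroup P.gens →* Γ)
    (h : ∀ i, q (P.rel i) = 1) : P.bdry₂ q * P.bdry₁ q = 0 := by
  ext1 i u
  simp only [Matrix.mul_apply, bdry₂_apply, bdry₁_apply, sum_fox_mul, h]
  simp [MonoidAlgebra.one_def]

end Presentation

/-! ## Simple isomorphisms -/

section Simple

variable {ι κ ν ι' κ' Γ : Type} [Group Γ]

/-- Products of elementary matrices. -/
noncomputable abbrev elementaryMonoid (ι Γ : Type) [Fintype ι] [DecidableEq ι] [Group Γ] :
    Submonoid (Matrix ι ι (MonoidAlgebra ℤ Γ)) :=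
  Submonoid.closure {N | IsElementary N}

theorem IsElementary.submatrix_equiv [DecidableEq ι] [DecidableEq κ]
    {M : Matrix κ κ (MonoidAlgebra ℤ Γ)} (h : IsElementary M) (e : ι ≃ κ) :
    IsElementary (M.submatrix e e) := by
  rcases h with ⟨i, j, c, hij, rfl⟩ | ⟨i, g, u, rfl⟩
  · refine Or.inl ⟨e.symm i, e.symm j, c, by simpa using hij, ?_⟩
    ext1 a b
    simp [Matrix.one_apply, Matrix.single_apply, Equiv.symm_apply_eq]
  · refine Or.inr ⟨e.symm i, g, u, ?_⟩
    ext1 a b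
    simp [Matrix.diagonal_apply, Function.update_apply, Equiv.eq_symm_apply]

theorem elementaryMonoid_submatrix [Fintype ι] [Fintype κ] [DecidableEq ι] [DecidableEq κ]
    {M : Matrix κ κ (MonoidAlgebra ℤ Γ)} (h : M ∈ elementaryMonoid κ Γ) (e : ι ≃ κ) :
    M.submatrix e e ∈ elementaryMonoid ι Γ := by
  induction h using Submonoid.closure_induction with
  | mem M h => exact Submonoid.subset_closure (h.submatrix_equiv e)
  | one => simp
  | mul M N _ _ hM hN =>
    rw [← Matrix.submatrix_mul_equiv M N e e e]
    exact mul_mem hM hN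

theorem IsElementary.exists_inv [Fintype ι] [DecidableEq ι]
    {M : Matrix ι ι (MonoidAlgebra ℤ Γ)} (h : IsElementary M) :
    ∃ N, IsElementary N ∧ M * N = 1 ∧ N * M = 1 := by
  rcases h with ⟨i, j, c, hij, rfl⟩ | ⟨i, g, u, rfl⟩
  · refine ⟨1 + Matrix.single i j (-c), Or.inl ⟨i, j, -c, hij, rfl⟩, ?_, ?_⟩ <;>
    · simp only [mul_add, add_mul, mul_one, one_mul, Matrix.single_mul_single_of_ne _ _ _ _ hij.symm,
        add_zero, add_assoc, ← Matrix.single_add]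
      simp
  · refine ⟨_, Or.inr ⟨i, g⁻¹, u⁻¹, rfl⟩, ?_, ?_⟩ <;>
    · rw [Matrix.diagonal_mul_diagonal, ← Matrix.diagonal_one]
      congr 1
      funext a
      by_cases ha : a = i
      · subst ha
        simp [MonoidAlgebra.single_mul_single, ← Units.val_mul, MonoidAlgebra.one_def]
      · simp [ha]

theorem elementaryMonoid_exists_inv [Fintype ι] [DecidableEq ι]
    {M : Matrix ι ι (MonoidAlgebra ℤ Γ)} (h : M ∈ elementaryMonoid ι Γ) :
    ∃ N ∈ elementaryMonoid ι Γ, M * N = 1 ∧ N * M = 1 := by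
  induction h using Submonoid.closure_induction with
  | mem M h =>
    obtain ⟨N, hN, h⟩ := h.exists_inv
    exact ⟨N, Submonoid.subset_closure hN, h⟩
  | one => exact ⟨1, one_mem _, by simp⟩
  | mul M M' _ _ hM hM' =>
    obtain ⟨N, hN, h1, h2⟩ := hM
    obtain ⟨N', hN', h1', h2'⟩ := hM'
    refine ⟨N' * N, mul_mem hN' hN, ?_, ?_⟩
    · rw [mul_assoc, ← mul_assoc M', h1', one_mul, h1]
    · rw [mul_assoc, ← mul_assoc N, h2, one_mul, h2']

theorem elementaryMonoid_fromBlocks [Fintype ι] [Fintype κ] [DecidableEq ι] [DecidableEq κ]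
    {M : Matrix ι ι (MonoidAlgebra ℤ Γ)} (h : M ∈ elementaryMonoid ι Γ) :
    Matrix.fromBlocks M 0 0 1 ∈ elementaryMonoid (ι ⊕ κ) Γ := by
  induction h using Submonoid.closure_induction with
  | mem M h =>
    refine Submonoid.subset_closure ?_
    rcases h with ⟨i, j, c, hij, rfl⟩ | ⟨i, g, u, rfl⟩
    · refine Or.inl ⟨Sum.inl i, Sum.inl j, c, by simpa using hij, ?_⟩
      ext1 a b
      rcases a with a | a <;> rcases b with b | b <;>
        simp [Matrix.one_apply, Matrix.single_apply]
    · refine Or.inr ⟨Sum.inl i, g, u, ?_⟩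
      ext1 a b
      rcases a with a | a <;> rcases b with b | b <;>
        simp [Matrix.diagonal_apply, Function.update_apply, Matrix.one_apply]
  | one => simp
  | mul M N _ _ hM hN =>
    simpa [Matrix.fromBlocks_multiply] using mul_mem hM hN

theorem IsSimpleIso.of_mem [Fintype ι] [DecidableEq ι] {M : Matrix ι ι (MonoidAlgebra ℤ Γ)}
    (h : M ∈ elementaryMonoid ι Γ) : IsSimpleIso M :=
  ⟨Equiv.refl ι, h⟩

theorem IsSimpleIso.of_equiv [Fintype ι] [DecidableEq ι] [DecidableEq κ] (e : ι ≃ κ) :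
    IsSimpleIso ((1 : Matrix κ κ (MonoidAlgebra ℤ Γ)).submatrix e id) := by
  refine ⟨e, ?_⟩
  rw [Matrix.submatrix_submatrix, Function.comp_id, Function.id_comp, Matrix.submatrix_one_equiv]
  exact one_mem _

/-- The matching of bases in the first factor is moved past the second; this only permutes the
indices of its elementary factors. -/
theorem IsSimpleIso.mul [Fintype ι] [Fintype κ] [DecidableEq ι] [DecidableEq κ]
    {M : Matrix ι κ (MonoidAlgebra ℤ Γ)} {N : Matrix κ ν (MonoidAlgebra ℤ Γ)}
    (hM : IsSimpleIso M) (hN : IsSimpleIso N) : IsSimpleIso (M * N) := by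
  obtain ⟨e, he⟩ := hM
  obtain ⟨f, hf⟩ := hN
  refine ⟨e.trans f, ?_⟩
  have h := mul_mem he (elementaryMonoid_submatrix hf e)
  rw [Matrix.submatrix_submatrix, Function.id_comp, Matrix.submatrix_mul_equiv] at h
  exact h

theorem IsSimpleIso.exists_inv [Fintype ι] [Fintype κ] [DecidableEq ι] [DecidableEq κ]
    {M : Matrix ι κ (MonoidAlgebra ℤ Γ)} (hM : IsSimpleIso M) :
    ∃ N : Matrix κ ι (MonoidAlgebra ℤ Γ), IsSimpleIso N ∧ M * N = 1 ∧ N * M = 1 := by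
  obtain ⟨e, he⟩ := hM
  obtain ⟨N, hN, h1, h2⟩ := elementaryMonoid_exists_inv he
  have hMe : M = (M.submatrix id e).submatrix id e.symm := by simp
  refine ⟨N.submatrix e.symm id, ⟨e.symm, ?_⟩, ?_, ?_⟩
  · rw [Matrix.submatrix_submatrix]
    exact elementaryMonoid_submatrix hN e.symm
  · rw [hMe, Matrix.submatrix_mul_equiv _ N id e.symm id, h1, Matrix.submatrix_id_id]
  · rw [hMe, ← Matrix.submatrix_mul N _ e.symm id e.symm Function.bijective_id, h2,
      Matrix.submatrix_one_equiv]

theorem IsSimpleIso.fromBlocks [Fintype ι] [Fintype ν] [DecidableEq ι] [DecidableEq ν]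
    {M : Matrix ι κ (MonoidAlgebra ℤ Γ)} (hM : IsSimpleIso M) :
    IsSimpleIso (Matrix.fromBlocks M 0 0 (1 : Matrix ν ν (MonoidAlgebra ℤ Γ))) := by
  obtain ⟨e, he⟩ := hM
  refine ⟨e.sumCongr (Equiv.refl ν), ?_⟩
  convert elementaryMonoid_fromBlocks (κ := ν) he using 1
  ext1 a b
  rcases a with a | a <;> rcases b with b | b <;> rfl

end Simple

/-! ## Based chain complexes in degrees two, one and zero -/

/-- A complex of based free modules over `ℤ[Γ]` with one basis element in degree zero. -/
structure BasedComplex (Γ : Type) [Group Γ] where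
  cells₂ : Type
  cells₁ : Type
  [fintype₂ : Fintype cells₂]
  [fintype₁ : Fintype cells₁]
  [decidableEq₂ : DecidableEq cells₂]
  [decidableEq₁ : DecidableEq cells₁]
  d₂ : Matrix cells₂ cells₁ (MonoidAlgebra ℤ Γ)
  d₁ : Matrix cells₁ Unit (MonoidAlgebra ℤ Γ)

namespace BasedComplex

attribute [instance] fintype₂ fintype₁ decidableEq₂ decidableEq₁

variable {Γ : Type} [Group Γ]

/-- Isomorphism by simple isomorphisms in degrees one and two and the identity in degree zero. -/
def SimpleIso (K L : BasedComplex Γ) : Prop :=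
  ∃ (F₁ : Matrix K.cells₁ L.cells₁ (MonoidAlgebra ℤ Γ))
    (F₂ : Matrix K.cells₂ L.cells₂ (MonoidAlgebra ℤ Γ)),
    IsSimpleIso F₁ ∧ IsSimpleIso F₂ ∧ K.d₁ = F₁ * L.d₁ ∧ K.d₂ * F₁ = F₂ * L.d₂

theorem SimpleIso.symm {K L : BasedComplex Γ} (h : K.SimpleIso L) : L.SimpleIso K := by
  obtain ⟨F₁, F₂, h₁, h₂, e₁, e₂⟩ := h
  obtain ⟨G₁, hG₁, a₁, b₁⟩ := h₁.exists_inv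
  obtain ⟨G₂, hG₂, a₂, b₂⟩ := h₂.exists_inv
  refine ⟨G₁, G₂, hG₁, hG₂, ?_, ?_⟩
  · rw [e₁, ← Matrix.mul_assoc, b₁, Matrix.one_mul]
  · calc L.d₂ * G₁ = G₂ * (F₂ * L.d₂) * G₁ := by rw [← Matrix.mul_assoc, b₂, Matrix.one_mul]
      _ = G₂ * K.d₂ := by rw [← e₂, Matrix.mul_assoc, Matrix.mul_assoc, a₁, Matrix.mul_one]

theorem SimpleIso.trans {K L N : BasedComplex Γ} (h : K.SimpleIso L) (h' : L.SimpleIso N) :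
    K.SimpleIso N := by
  obtain ⟨F₁, F₂, h₁, h₂, e₁, e₂⟩ := h
  obtain ⟨G₁, G₂, k₁, k₂, e₁', e₂'⟩ := h'
  refine ⟨F₁ * G₁, F₂ * G₂, h₁.mul k₁, h₂.mul k₂, ?_, ?_⟩
  · rw [e₁, e₁', Matrix.mul_assoc]
  · rw [← Matrix.mul_assoc, e₂, Matrix.mul_assoc, e₂', Matrix.mul_assoc]

theorem SimpleIso.of_equiv {K L : BasedComplex Γ} (e : K.cells₁ ≃ L.cells₁)
    (f : K.cells₂ ≃ L.cells₂) (h₁ : ∀ x u, K.d₁ x u = L.d₁ (e x) u)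
    (h₂ : ∀ i x, K.d₂ i x = L.d₂ (f i) (e x)) : K.SimpleIso L := by
  refine ⟨_, _, IsSimpleIso.of_equiv e, IsSimpleIso.of_equiv f, ?_, ?_⟩
  · ext1 x u
    simp [Matrix.mul_apply, Matrix.one_apply, h₁]
  · ext1 i y
    obtain ⟨x, rfl⟩ := e.surjective y
    simp [Matrix.mul_apply, Matrix.one_apply, h₂]

/-- Add cancelling pairs of cells in degrees two and one. -/
noncomputable abbrev stab (K : BasedComplex Γ) (A : Type) [Fintype A] [DecidableEq A] : BasedComplex Γ where
  cells₂ := K.cells₂ ⊕ A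
  cells₁ := K.cells₁ ⊕ A
  d₂ := Matrix.fromBlocks K.d₂ 0 0 1
  d₁ := Matrix.fromRows K.d₁ 0

section Stab

variable (K L : BasedComplex Γ) (A B : Type) [Fintype A] [DecidableEq A] [Fintype B] [DecidableEq B]

theorem SimpleIso.stab {K L : BasedComplex Γ} (h : K.SimpleIso L) :
    (K.stab A).SimpleIso (L.stab A) := by
  obtain ⟨F₁, F₂, h₁, h₂, e₁, e₂⟩ := h
  refine ⟨_, _, h₁.fromBlocks (ν := A), h₂.fromBlocks (ν := A), ?_, ?_⟩
  · change Matrix.fromRows K.d₁ 0 = Matrix.fromBlocks F₁ 0 0 1 * Matrix.fromRows L.d₁ 0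
    rw [Matrix.fromBlocks_mul_fromRows]
    simp [e₁]
  · change Matrix.fromBlocks K.d₂ 0 0 1 * Matrix.fromBlocks F₁ 0 0 1 =
      Matrix.fromBlocks F₂ 0 0 1 * Matrix.fromBlocks L.d₂ 0 0 1
    simp [Matrix.fromBlocks_multiply, e₂]

variable {A B} in
theorem stab_congr (e : A ≃ B) : (K.stab A).SimpleIso (K.stab B) := by
  refine SimpleIso.of_equiv (K := K.stab A) (L := K.stab B) ((Equiv.refl _).sumCongr e)
    ((Equiv.refl _).sumCongr e) ?_ ?_
  · rintro (x | x) u <;> rfl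
  · rintro (i | i) (x | x)
    · rfl
    · rfl
    · rfl
    · change (1 : Matrix A A (MonoidAlgebra ℤ Γ)) i x = (1 : Matrix B B (MonoidAlgebra ℤ Γ)) (e i) (e x)
      simp [Matrix.one_apply]

theorem stab_stab : ((K.stab A).stab B).SimpleIso (K.stab (A ⊕ B)) := by
  refine SimpleIso.of_equiv (K := (K.stab A).stab B) (L := K.stab (A ⊕ B)) (Equiv.sumAssoc _ _ _)
    (Equiv.sumAssoc _ _ _) ?_ ?_
  · rintro ((x | x) | x) u <;> rfl
  · rintro ((i | i) | i) ((x | x) | x) <;>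
      simp [Matrix.one_apply, Equiv.sumAssoc_apply_inl_inl]

theorem stab_comm : ((K.stab A).stab B).SimpleIso ((K.stab B).stab A) :=
  (K.stab_stab A B).trans
    ((K.stab_congr (Equiv.sumComm A B)).trans (K.stab_stab B A).symm)

theorem stab_empty : (K.stab Empty).SimpleIso K := by
  refine SimpleIso.of_equiv (K := K.stab Empty) (Equiv.sumEmpty _ _) (Equiv.sumEmpty _ _) ?_ ?_
  · rintro (x | x) u
    · rfl
    · exact x.elim
  · rintro (i | i) (x | x)
    · rfl
    · exact x.elim
    · exact i.elim
    · exact i.elim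

end Stab

/-- Simple isomorphism after adding cancelling pairs of cells on either side. -/
def SimpleEquiv (K L : BasedComplex Γ) : Prop :=
  ∃ a b : ℕ, (K.stab (Fin a)).SimpleIso (L.stab (Fin b))

/-- Allows arbitrary finite index types for the added cells, in place of `Fin a` and `Fin b`. -/
theorem SimpleEquiv.of_stab {K L : BasedComplex Γ} {A B : Type} [Fintype A] [DecidableEq A]
    [Fintype B] [DecidableEq B] (h : (K.stab A).SimpleIso (L.stab B)) : K.SimpleEquiv L :=
  ⟨_, _, ((K.stab_congr (Fintype.equivFin A)).symm.trans h).trans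
    (L.stab_congr (Fintype.equivFin B))⟩

theorem SimpleIso.simpleEquiv {K L : BasedComplex Γ} (h : K.SimpleIso L) : K.SimpleEquiv L :=
  .of_stab (h.stab Empty)

theorem SimpleEquiv.symm {K L : BasedComplex Γ} (h : K.SimpleEquiv L) : L.SimpleEquiv K := by
  obtain ⟨a, b, h⟩ := h
  exact ⟨b, a, h.symm⟩

theorem SimpleEquiv.trans {K L N : BasedComplex Γ} (h : K.SimpleEquiv L) (h' : L.SimpleEquiv N) :
    K.SimpleEquiv N := by
  obtain ⟨a, b, h⟩ := h
  obtain ⟨a', b', h'⟩ := h'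
  -- The two given stabilisations of `L` are enlarged by each other's cells, so that they agree up
  -- to order.
  exact .of_stab <| (K.stab_stab (Fin a) (Fin a')).symm.trans <| (h.stab (Fin a')).trans <|
    (L.stab_comm (Fin b) (Fin a')).trans <| (h'.stab (Fin b)).trans <|
      N.stab_stab (Fin b') (Fin b)

theorem simpleEquiv_stab (K : BasedComplex Γ) (A : Type) [Fintype A] [DecidableEq A] :
    K.SimpleEquiv (K.stab A) :=
  .of_stab (A := A) (K.stab A).stab_empty.symm

end BasedComplex

/-! ## Symmetry of Q** equivalence -/

namespace Presentation

/-- Apply an endomorphism of the free group to all relators. -/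
def applyHom (P : Presentation) (σ : FreeGroup P.gens →* FreeGroup P.gens) : Presentation :=
  P.withRel fun k => σ (P.rel k)

/-- The endomorphism that replaces the generator `x` by the word `w`. -/
noncomputable def substHom (P : Presentation) (x : P.gens) (w : FreeGroup P.gens) :
    FreeGroup P.gens →* FreeGroup P.gens :=
  FreeGroup.lift (Function.update FreeGroup.of x w)

theorem substHom_self (P : Presentation) (x : P.gens) (w : FreeGroup P.gens) :
    P.substHom x w (FreeGroup.of x) = w := by
  simp [substHom]

theorem substHom_of_ne (P : Presentation) {x z : P.gens} (h : z ≠ x) (w : FreeGroup P.gens) :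
    P.substHom x w (FreeGroup.of z) = FreeGroup.of z := by
  simp [substHom, h]

theorem substHom_inv_comp (P : Presentation) (x : P.gens) :
    (P.substHom x (FreeGroup.of x)⁻¹).comp (P.substHom x (FreeGroup.of x)⁻¹) =
      MonoidHom.id _ := by
  ext z
  by_cases h : z = x
  · subst h
    simp [substHom_self]
  · simp [substHom_of_ne P h]

/-- Conjugation by the inversion of `y` turns `x ↦ x y` into `x ↦ x y⁻¹`, which is the inverse
substitution. -/
theorem substHom_mul_comp (P : Presentation) {x y : P.gens} (h : x ≠ y) :
    (P.substHom y (FreeGroup.of y)⁻¹).comp ((P.substHom x (FreeGroup.of x * FreeGroup.of y)).comp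
      ((P.substHom y (FreeGroup.of y)⁻¹).comp (P.substHom x (FreeGroup.of x * FreeGroup.of y)))) =
      MonoidHom.id _ := by
  ext z
  by_cases hx : z = x
  · subst hx
    simp [substHom_self, substHom_of_ne P h, substHom_of_ne P h.symm]
  · by_cases hy : z = y
    · subst hy
      simp [substHom_self, substHom_of_ne P h.symm]
    · simp [substHom_of_ne P hx, substHom_of_ne P hy]

end Presentation

theorem QStep.qEquiv {P Q : Presentation} (h : QStep P Q) : QEquiv P Q :=
  Relation.ReflTransGen.single h

theorem QEquiv.refl (P : Presentation) : QEquiv P P := Relation.ReflTransGen.refl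

theorem QEquiv.trans {P Q R : Presentation} (h : QEquiv P Q) (h' : QEquiv Q R) : QEquiv P R :=
  Relation.ReflTransGen.trans h h'

/-- Division by a relator or by a generator is not among the moves. It is obtained by inverting the
factor, multiplying, and inverting back. -/
theorem QStep.qEquiv_symm {P Q : Presentation} (h : QStep P Q) : QEquiv Q P := by
  cases h with
  | relInv _ i =>
    have h := QStep.relInv (P.withRel (Function.update P.rel i (P.rel i)⁻¹)) i
    have e : (P.withRel (Function.update P.rel i (P.rel i)⁻¹)).withRel
        (Function.update (P.withRel (Function.update P.rel i (P.rel i)⁻¹)).rel i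
          ((P.withRel (Function.update P.rel i (P.rel i)⁻¹)).rel i)⁻¹) = P := by
      change P.withRel (Function.update (Function.update P.rel i (P.rel i)⁻¹) i
          (Function.update P.rel i (P.rel i)⁻¹ i)⁻¹) = P
      simp only [Function.update_self, inv_inv, Function.update_idem, Function.update_eq_self]
      rfl
    exact (e ▸ h).qEquiv
  | relMul _ i j hij =>
    let r₁ := Function.update P.rel i (P.rel i * P.rel j)
    let r₂ := Function.update r₁ j (r₁ j)⁻¹
    let r₃ := Function.update r₂ i (r₂ i * r₂ j)
    let r₄ := Function.update r₃ j (r₃ j)⁻¹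
    have h₁ : QStep (P.withRel r₁) (P.withRel r₂) := QStep.relInv (P.withRel r₁) j
    have h₂ : QStep (P.withRel r₂) (P.withRel r₃) := QStep.relMul (P.withRel r₂) i j hij
    have h₃ : QStep (P.withRel r₃) (P.withRel r₄) := QStep.relInv (P.withRel r₃) j
    have e : r₄ = P.rel := by
      funext k
      by_cases hk : k = i
      · subst hk
        simp [r₄, r₃, r₂, r₁, hij, hij.symm]
      · by_cases hj : k = j
        · subst hj
          simp [r₄, r₃, r₂, r₁, hk]
        · simp [r₄, r₃, r₂, r₁, hk, hj]
    have h := h₁.qEquiv.trans (h₂.qEquiv.trans h₃.qEquiv)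
    rw [e] at h
    exact h
  | relConj _ i w =>
    let r₁ := Function.update P.rel i (w * P.rel i * w⁻¹)
    let r₂ := Function.update r₁ i (w⁻¹ * r₁ i * w⁻¹⁻¹)
    have h : QStep (P.withRel r₁) (P.withRel r₂) := QStep.relConj (P.withRel r₁) i w⁻¹
    have e : r₂ = P.rel := by simp [r₂, r₁, mul_assoc]
    rw [e] at h
    exact h.qEquiv
  | genInv _ x =>
    have h : QStep (P.applyHom (P.substHom x (FreeGroup.of x)⁻¹))
      (P.applyHom ((P.substHom x (FreeGroup.of x)⁻¹).comp (P.substHom x (FreeGroup.of x)⁻¹))) :=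
      QStep.genInv (P.applyHom (P.substHom x (FreeGroup.of x)⁻¹)) x
    rw [P.substHom_inv_comp] at h
    exact h.qEquiv
  | genMul _ x y hxy =>
    let μ := P.substHom x (FreeGroup.of x * FreeGroup.of y)
    let ν := P.substHom y (FreeGroup.of y)⁻¹
    have h₁ : QStep (P.applyHom μ) (P.applyHom (ν.comp μ)) := QStep.genInv (P.applyHom μ) y
    have h₂ : QStep (P.applyHom (ν.comp μ)) (P.applyHom (μ.comp (ν.comp μ))) :=
      QStep.genMul (P.applyHom (ν.comp μ)) x y hxy
    have h₃ : QStep (P.applyHom (μ.comp (ν.comp μ))) (P.applyHom (ν.comp (μ.comp (ν.comp μ)))) :=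
      QStep.genInv (P.applyHom (μ.comp (ν.comp μ))) y
    have h := h₁.qEquiv.trans (h₂.qEquiv.trans h₃.qEquiv)
    rw [P.substHom_mul_comp hxy] at h
    exact h
  | prolong => exact (QStep.unprolong P).qEquiv
  | unprolong => exact (QStep.prolong Q).qEquiv
  | relabel _ _ e f h =>
    refine (QStep.relabel Q P e.symm f.symm fun i => ?_).qEquiv
    obtain ⟨i, rfl⟩ := f.surjective i
    rw [h, FreeGroup.map.comp]
    simp

theorem QEquiv.symm {P Q : Presentation} (h : QEquiv P Q) : QEquiv Q P := by
  induction h with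
  | refl => exact QEquiv.refl _
  | tail _ h ih => exact h.qEquiv_symm.trans ih

/-! ## Presentations of a fixed group -/

namespace Presentation

variable {Γ : Type} [Group Γ]

/-- The homomorphism `q` identifies the group of `P` with `Γ`. -/
def Presents (P : Presentation) (q : FreeGroup P.gens →* Γ) : Prop :=
  Function.Surjective q ∧ q.ker = Subgroup.normalClosure (Set.range P.rel)

theorem Presents.apply_rel {P : Presentation} {q : FreeGroup P.gens →* Γ} (h : P.Presents q)
    (i : P.rels) : q (P.rel i) = 1 := by
  rw [← MonoidHom.mem_ker, h.2]
  exact Subgroup.subset_normalClosure ⟨i, rfl⟩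

theorem presents_proj (P : Presentation) : P.Presents P.proj :=
  ⟨PresentedGroup.mk_surjective _, by
    ext w
    exact PresentedGroup.mk_eq_one_iff⟩

/-- The based complex of the 2-complex of `P`, with coefficients pushed forward along `q`. -/
noncomputable abbrev complex (P : Presentation) (q : FreeGroup P.gens →* Γ) : BasedComplex Γ where
  cells₂ := P.rels
  cells₁ := P.gens
  d₂ := P.bdry₂ q
  d₁ := P.bdry₁ q

/-- The chain map in degree one is the Fox Jacobian of `φ`. It commutes with `d₁` by the fundamental
formula and with `d₂` by the chain rule together with `h`. -/
theorem complex_simpleIso_of_hom {P Q : Presentation} (φ : FreeGroup P.gens →* FreeGroup Q.gens)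
    (q : FreeGroup Q.gens →* Γ)
    (h₁ : IsSimpleIso (Matrix.of fun x y => fox q y (φ (FreeGroup.of x))))
    (F₂ : Matrix P.rels Q.rels (MonoidAlgebra ℤ Γ)) (h₂ : IsSimpleIso F₂)
    (h : ∀ i y, fox q y (φ (P.rel i)) = ∑ j, F₂ i j * fox q y (Q.rel j)) :
    (P.complex (q.comp φ)).SimpleIso (Q.complex q) := by
  refine ⟨_, F₂, h₁, h₂, ?_, ?_⟩
  · ext1 x u
    simp only [Matrix.mul_apply, bdry₁_apply, Matrix.of_apply]
    exact (sum_fox_mul q (φ (FreeGroup.of x))).symm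
  · ext1 i y
    simp only [Matrix.mul_apply, bdry₂_apply, Matrix.of_apply]
    rw [← fox_chain, h]

theorem complex_withRel_simpleIso (P : Presentation) (q : FreeGroup P.gens →* Γ)
    (r : P.rels → FreeGroup P.gens) (F₂ : Matrix P.rels P.rels (MonoidAlgebra ℤ Γ))
    (h₂ : IsElementary F₂)
    (h : ∀ i y, fox q y (r i) = ∑ j, F₂ i j * fox q y (P.rel j)) :
    ((P.withRel r).complex q).SimpleIso (P.complex q) := by
  refine complex_simpleIso_of_hom (P := P.withRel r) (Q := P) (MonoidHom.id _) q ?_ F₂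
    (.of_mem (Submonoid.subset_closure h₂)) h
  have : (Matrix.of fun x y => fox q y ((MonoidHom.id _) (FreeGroup.of x))) =
      (1 : Matrix P.gens P.gens (MonoidAlgebra ℤ Γ)) := by
    ext1 x y
    simp [fox_of, Matrix.one_apply]
  exact .of_mem (this ▸ one_mem _)

end Presentation

/-- `(P, q)` and `(Q, q')` are presentations of the same group, related by Q** transformations that
induce simple homotopy equivalences. -/
structure Related {Γ : Type} [Group Γ] (P : Presentation) (q : FreeGroup P.gens →* Γ)
    (Q : Presentation) (q' : FreeGroup Q.gens →* Γ) : Prop where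
  presents_iff : P.Presents q ↔ Q.Presents q'
  qEquiv : QEquiv P Q
  simple : P.Presents q → (P.complex q).SimpleEquiv (Q.complex q')

namespace Related

variable {Γ : Type} [Group Γ]

theorem symm {P Q : Presentation} {q : FreeGroup P.gens →* Γ} {q' : FreeGroup Q.gens →* Γ}
    (h : Related P q Q q') : Related Q q' P q :=
  ⟨h.presents_iff.symm, h.qEquiv.symm, fun hQ => (h.simple (h.presents_iff.2 hQ)).symm⟩

theorem trans {P Q R : Presentation} {q : FreeGroup P.gens →* Γ} {q' : FreeGroup Q.gens →* Γ}
    {q'' : FreeGroup R.gens →* Γ} (h : Related P q Q q') (h' : Related Q q' R q'') :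
    Related P q R q'' :=
  ⟨h.presents_iff.trans h'.presents_iff, h.qEquiv.trans h'.qEquiv, fun hP =>
    (h.simple hP).trans (h'.simple (h.presents_iff.1 hP))⟩

theorem refl (P : Presentation) (q : FreeGroup P.gens →* Γ) : Related P q P q :=
  ⟨Iff.rfl, QEquiv.refl P, fun _ => .of_stab (A := Empty) (B := Empty)
    ((P.complex q).stab_congr (Equiv.refl _))⟩

/-! ### Changing relators -/

theorem normalClosure_update_le {α ι : Type} [DecidableEq ι] (r : ι → FreeGroup α) (i : ι)
    {s : FreeGroup α} (h : s ∈ Subgroup.normalClosure (Set.range r)) :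
    Subgroup.normalClosure (Set.range (Function.update r i s)) ≤
      Subgroup.normalClosure (Set.range r) := by
  refine Subgroup.normalClosure_le_normal ?_
  rintro _ ⟨k, rfl⟩
  by_cases hk : k = i
  · subst hk
    simpa using h
  · simpa [hk] using Subgroup.subset_normalClosure (Set.mem_range_self (f := r) k)

theorem presents_update (P : Presentation) (q : FreeGroup P.gens →* Γ) (i : P.rels)
    {s : FreeGroup P.gens} (h : s ∈ Subgroup.normalClosure (Set.range P.rel))
    (h' : P.rel i ∈ Subgroup.normalClosure (Set.range (Function.update P.rel i s))) :
    P.Presents q ↔ (P.withRel (Function.update P.rel i s)).Presents q := by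
  have e : Subgroup.normalClosure (Set.range (Function.update P.rel i s)) =
      Subgroup.normalClosure (Set.range P.rel) := by
    refine le_antisymm (normalClosure_update_le _ _ h) ?_
    have := normalClosure_update_le (Function.update P.rel i s) i h'
    rwa [Function.update_idem, Function.update_eq_self] at this
  change _ ↔ _ ∧ q.ker = Subgroup.normalClosure (Set.range (Function.update P.rel i s))
  rw [e]
  rfl

theorem rel_mem (P : Presentation) (i : P.rels) :
    P.rel i ∈ Subgroup.normalClosure (Set.range P.rel) :=
  Subgroup.subset_normalClosure (Set.mem_range_self i)

theorem update_mem (P : Presentation) (i : P.rels) (s : FreeGroup P.gens) :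
    s ∈ Subgroup.normalClosure (Set.range (Function.update P.rel i s)) :=
  Subgroup.subset_normalClosure ⟨i, by simp⟩

/-- Here and in the next two moves the relators are trivial under `q`. On them the Fox derivative is
therefore additive under products, changes sign under inversion, and is multiplied by `q w` under
conjugation, where the terms from `w` and `w⁻¹` cancel. Each move is thus an elementary matrix in
degree two. -/
theorem relInv (P : Presentation) (q : FreeGroup P.gens →* Γ) (i : P.rels) :
    Related P q (P.withRel (Function.update P.rel i (P.rel i)⁻¹)) q where
  presents_iff := presents_update P q i (inv_mem (rel_mem P i)) (by
    simpa using inv_mem (update_mem P i (P.rel i)⁻¹))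
  qEquiv := (QStep.relInv P i).qEquiv
  simple hP := by
    refine (P.complex_withRel_simpleIso q _ _ (Or.inr ⟨i, 1, -1, rfl⟩) ?_).symm.simpleEquiv
    intro k y
    by_cases hk : k = i
    · subst hk
      simp [Matrix.diagonal_apply, fox_inv, hP.apply_rel, ← MonoidAlgebra.one_def]
    · simp [Matrix.diagonal_apply, hk]

theorem relMul (P : Presentation) (q : FreeGroup P.gens →* Γ) (i j : P.rels) (hij : i ≠ j) :
    Related P q (P.withRel (Function.update P.rel i (P.rel i * P.rel j))) q where
  presents_iff := presents_update P q i (mul_mem (rel_mem P i) (rel_mem P j)) (by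
    have h := Subgroup.subset_normalClosure
      (Set.mem_range_self (f := Function.update P.rel i (P.rel i * P.rel j)) j)
    rw [Function.update_of_ne hij.symm] at h
    simpa using mul_mem (update_mem P i (P.rel i * P.rel j)) (inv_mem h))
  qEquiv := (QStep.relMul P i j hij).qEquiv
  simple hP := by
    refine (P.complex_withRel_simpleIso q _ _ (Or.inl ⟨i, j, 1, hij, rfl⟩) ?_).symm.simpleEquiv
    intro k y
    by_cases hk : k = i
    · subst hk
      simp [Matrix.one_apply, Matrix.single_apply, fox_mul, hP.apply_rel,
        ← MonoidAlgebra.one_def, add_mul, Finset.sum_add_distrib]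
    · simp [Matrix.one_apply, hk, Ne.symm hk]

theorem relConj (P : Presentation) (q : FreeGroup P.gens →* Γ) (i : P.rels)
    (w : FreeGroup P.gens) :
    Related P q (P.withRel (Function.update P.rel i (w * P.rel i * w⁻¹))) q where
  presents_iff := presents_update P q i
    (Subgroup.normalClosure_normal.conj_mem _ (rel_mem P i) w) (by
    have h := Subgroup.normalClosure_normal.conj_mem _ (update_mem P i (w * P.rel i * w⁻¹)) w⁻¹
    simpa [mul_assoc] using h)
  qEquiv := (QStep.relConj P i w).qEquiv
  simple hP := by
    refine (P.complex_withRel_simpleIso q _ _ (Or.inr ⟨i, q w, 1, rfl⟩) ?_).symm.simpleEquiv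
    intro k y
    by_cases hk : k = i
    · subst hk
      simp [Matrix.diagonal_apply, fox_mul, fox_inv, hP.apply_rel, ← mul_assoc,
        MonoidAlgebra.single_mul_single, ← MonoidAlgebra.one_def]
    · simp [Matrix.diagonal_apply, hk]

end Related

namespace Related

variable {Γ : Type} [Group Γ]

/-! ### Changing generators -/

/-- An isomorphism of free groups carries the kernel to the kernel and the normal closure of the
relators to the normal closure of their images. -/
theorem presents_iff_of_mulEquiv {P Q : Presentation}
    (φ : FreeGroup P.gens ≃* FreeGroup Q.gens) (f : P.rels ≃ Q.rels)
    (h : ∀ i, Q.rel (f i) = φ (P.rel i)) (q : FreeGroup Q.gens →* Γ) :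
    P.Presents (q.comp φ.toMonoidHom) ↔ Q.Presents q := by
  have hR : Set.range Q.rel = φ '' Set.range P.rel := by
    rw [← Set.range_comp, ← f.surjective.range_comp]
    congr 1
    funext i
    exact h i
  refine and_congr ?_ ?_
  · exact Function.Surjective.of_comp_iff q φ.surjective
  · have hn : Subgroup.normalClosure (Set.range Q.rel) =
        (Subgroup.normalClosure (Set.range P.rel)).map φ.toMonoidHom := by
      rw [hR]
      exact (Subgroup.map_normalClosure _ φ.toMonoidHom φ.surjective).symm
    have hk : q.ker = (q.comp φ.toMonoidHom).ker.map φ.toMonoidHom := by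
      rw [← MonoidHom.comap_ker, Subgroup.map_comap_eq_self_of_surjective φ.surjective]
    rw [hn, hk]
    exact (Subgroup.map_injective φ.injective).eq_iff.symm

theorem relabel {P Q : Presentation} (e : P.gens ≃ Q.gens) (f : P.rels ≃ Q.rels)
    (h : ∀ i, Q.rel (f i) = FreeGroup.map e (P.rel i)) (q : FreeGroup Q.gens →* Γ) :
    Related P (q.comp (FreeGroup.map e)) Q q where
  presents_iff := presents_iff_of_mulEquiv (FreeGroup.freeGroupCongr e) f h q
  qEquiv := (QStep.relabel P Q e f h).qEquiv
  simple _ := by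
    refine (P.complex_simpleIso_of_hom (FreeGroup.map e) q ?_ _ (IsSimpleIso.of_equiv f)
      ?_).simpleEquiv
    · convert IsSimpleIso.of_equiv e using 1
      ext1 x y
      simp [fox_of, Matrix.one_apply]
    · intro i y
      simp [Matrix.one_apply, h]

/-- The relators are carried along by `φ`, so the matrix in degree two is the identity and only the
Jacobian has to be elementary. -/
theorem applyHom_of_isElementary (P : Presentation)
    (φ : FreeGroup P.gens ≃* FreeGroup P.gens) (q : FreeGroup P.gens →* Γ)
    (hQ : QEquiv P (P.applyHom φ.toMonoidHom))
    (hJ : IsElementary (Matrix.of fun x y => fox q y (φ (FreeGroup.of x)))) :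
    Related P (q.comp φ.toMonoidHom) (P.applyHom φ.toMonoidHom) q where
  presents_iff := presents_iff_of_mulEquiv (Q := P.applyHom φ.toMonoidHom) φ (Equiv.refl _)
    (fun _ => rfl) q
  qEquiv := hQ
  simple _ := by
    refine (Presentation.complex_simpleIso_of_hom (P := P) (Q := P.applyHom φ.toMonoidHom)
      φ.toMonoidHom q (.of_mem (Submonoid.subset_closure hJ))
      (1 : Matrix P.rels P.rels (MonoidAlgebra ℤ Γ)) (.of_mem (one_mem _))
      ?_).simpleEquiv
    intro i y
    refine Eq.trans ?_ (Finset.sum_eq_single i (fun j _ hj => ?_) fun hi => ?_).symm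
    · rw [Matrix.one_apply_eq, one_mul]
      rfl
    · rw [Matrix.one_apply_ne hj.symm, zero_mul]
    · exact absurd (Finset.mem_univ i) hi

/-- The automorphism of the free group that inverts the generator `x`. -/
noncomputable def invAut (P : Presentation) (x : P.gens) : MulAut (FreeGroup P.gens) :=
  MonoidHom.toMulEquiv (P.substHom x (FreeGroup.of x)⁻¹) (P.substHom x (FreeGroup.of x)⁻¹)
    (P.substHom_inv_comp x) (P.substHom_inv_comp x)

/-- The automorphism of the free group that replaces the generator `x` by `x * y`. -/
noncomputable def mulAut (P : Presentation) (x y : P.gens) (h : x ≠ y) :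
    MulAut (FreeGroup P.gens) :=
  MonoidHom.toMulEquiv (P.substHom x (FreeGroup.of x * FreeGroup.of y))
    (P.substHom x (FreeGroup.of x * (FreeGroup.of y)⁻¹))
    (by
      ext z
      by_cases hz : z = x
      · subst hz
        simp [P.substHom_self, P.substHom_of_ne h.symm]
      · simp [P.substHom_of_ne hz])
    (by
      ext z
      by_cases hz : z = x
      · subst hz
        simp [P.substHom_self, P.substHom_of_ne h.symm]
      · simp [P.substHom_of_ne hz])

theorem invAut_of (P : Presentation) (x z : P.gens) :
    invAut P x (FreeGroup.of z) = P.substHom x (FreeGroup.of x)⁻¹ (FreeGroup.of z) := rfl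

theorem mulAut_of (P : Presentation) (x y : P.gens) (h : x ≠ y) (z : P.gens) :
    mulAut P x y h (FreeGroup.of z) =
      P.substHom x (FreeGroup.of x * FreeGroup.of y) (FreeGroup.of z) := rfl

theorem applyHom_invAut (P : Presentation) (x : P.gens) (q : FreeGroup P.gens →* Γ) :
    Related P (q.comp (invAut P x).toMonoidHom) (P.applyHom (invAut P x).toMonoidHom) q := by
  refine applyHom_of_isElementary P (invAut P x) q (QStep.genInv P x).qEquiv
    -- The derivative of `x⁻¹` with respect to `x` is the trivial unit `-x⁻¹`.
    (Or.inr ⟨x, (q (FreeGroup.of x))⁻¹, -1, ?_⟩)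
  ext1 z y
  rw [Matrix.of_apply, invAut_of, Matrix.diagonal_apply]
  by_cases hz : z = x
  · subst hz
    rw [P.substHom_self, fox_inv, fox_of]
    by_cases hy : z = y <;> simp [hy, ← MonoidAlgebra.single_neg]
  · rw [P.substHom_of_ne hz, fox_of, Function.update_of_ne hz, Pi.one_apply]

theorem applyHom_mulAut (P : Presentation) (x x' : P.gens) (h : x ≠ x')
    (q : FreeGroup P.gens →* Γ) :
    Related P (q.comp (mulAut P x x' h).toMonoidHom)
      (P.applyHom (mulAut P x x' h).toMonoidHom) q := by
  refine applyHom_of_isElementary P (mulAut P x x' h) q (QStep.genMul P x x' h).qEquiv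
    -- The derivative of `x * x'` is `1` with respect to `x` and `x` with respect to `x'`.
    (Or.inl ⟨x, x', MonoidAlgebra.single (q (FreeGroup.of x)) 1, h, ?_⟩)
  ext1 z y
  rw [Matrix.of_apply, mulAut_of, Matrix.add_apply, Matrix.one_apply, Matrix.single_apply]
  by_cases hz : z = x
  · subst hz
    rw [P.substHom_self, fox_mul, fox_of, fox_of]
    by_cases hy : x' = y <;> simp [hy]
  · rw [P.substHom_of_ne hz, fox_of]
    simp [Ne.symm hz]

/-- Products of elementary automorphisms of the free group. -/
def elementaryAut (P : Presentation) : Subgroup (MulAut (FreeGroup P.gens)) :=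
  Subgroup.closure ({σ | ∃ x, σ = invAut P x} ∪ {σ | ∃ x y h, σ = mulAut P x y h})

theorem applyHom {P : Presentation} {σ : MulAut (FreeGroup P.gens)} (hσ : σ ∈ elementaryAut P)
    (r : P.rels → FreeGroup P.gens) (q : FreeGroup P.gens →* Γ) :
    Related (P.withRel r) (q.comp σ.toMonoidHom) (P.withRel fun i => σ (r i)) q := by
  induction hσ using Subgroup.closure_induction generalizing r q with
  | mem σ h =>
    rcases h with ⟨x, rfl⟩ | ⟨x, y, h, rfl⟩
    · exact applyHom_invAut (P.withRel r) x q
    · exact applyHom_mulAut (P.withRel r) x y h q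
  | one => exact Related.refl _ _
  | mul σ τ _ _ hσ hτ =>
    exact (hτ r (q.comp σ.toMonoidHom)).trans (hσ (fun i => τ (r i)) q)
  | inv σ _ hσ =>
    have e₁ : (fun i => σ (σ⁻¹ (r i))) = r := funext fun i => σ.apply_symm_apply _
    have e₂ : (q.comp (σ⁻¹ : MulAut _).toMonoidHom).comp σ.toMonoidHom = q := by
      ext w
      exact congrArg q (σ.symm_apply_apply _)
    -- The statement depends on `r` and `q` through its types, so both equations are generalised and
    -- then substituted.
    have h : ∀ r' q', r' = r → q' = q →
        Related (P.withRel r') (q.comp (σ⁻¹ : MulAut _).toMonoidHom)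
          (P.withRel fun i => σ⁻¹ (r i)) q' → Related (P.withRel r)
          (q.comp (σ⁻¹ : MulAut _).toMonoidHom) (P.withRel fun i => σ⁻¹ (r i)) q := by
      rintro _ _ rfl rfl h
      exact h
    exact h _ _ e₁ e₂ (hσ (fun i => σ⁻¹ (r i)) (q.comp (σ⁻¹ : MulAut _).toMonoidHom)).symm

/-! ### Adding generators -/

/-- Killing the new generator retracts the larger free group onto the smaller. The retraction is
compatible with `q` by `hq`, and with passage to the quotient because the new generator is itself a
relator. -/
theorem presents_prolong (P : Presentation) (q : FreeGroup (Option P.gens) →* Γ)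
    (hq : q (FreeGroup.of none) = 1) :
    P.Presents (q.comp (FreeGroup.map some)) ↔ P.prolong.Presents q := by
  let ret : FreeGroup (Option P.gens) →* FreeGroup P.gens :=
    FreeGroup.lift fun x => x.elim 1 FreeGroup.of
  have hret : ∀ v, ret (FreeGroup.map some v) = v := by
    intro v
    have : ret.comp (FreeGroup.map some) = MonoidHom.id _ := by
      ext x
      simp [ret]
    exact DFunLike.congr_fun this v
  have hqret : ∀ w, q (FreeGroup.map some (ret w)) = q w := by
    intro w
    have : (q.comp (FreeGroup.map some)).comp ret = q := by
      ext x
      rcases x with - | x <;> simp [ret, hq]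
    exact DFunLike.congr_fun this w
  let R : Set (FreeGroup (Option P.gens)) := Set.range P.prolong.rel
  have hN : ∀ w, FreeGroup.map some (ret w) ∈ Subgroup.normalClosure R →
      w ∈ Subgroup.normalClosure R := by
    intro w hw
    have : ((QuotientGroup.mk' (Subgroup.normalClosure R)).comp (FreeGroup.map some)).comp ret =
        QuotientGroup.mk' (Subgroup.normalClosure R) := by
      ext x
      rcases x with - | x
      · have h : FreeGroup.of none ∈ Subgroup.normalClosure R :=
          Subgroup.subset_normalClosure ⟨none, rfl⟩
        simpa [ret] using ((QuotientGroup.eq_one_iff _).2 h).symm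
      · simp [ret]
    have hw' := DFunLike.congr_fun this w
    exact (QuotientGroup.eq_one_iff _).1 (hw'.symm.trans ((QuotientGroup.eq_one_iff _).2 hw))
  have hsome : Subgroup.normalClosure (Set.range P.rel) ≤
      (Subgroup.normalClosure R).comap (FreeGroup.map some) := by
    refine Subgroup.normalClosure_le_normal ?_
    rintro _ ⟨i, rfl⟩
    exact Subgroup.subset_normalClosure ⟨some i, rfl⟩
  have hretN : Subgroup.normalClosure R ≤
      (Subgroup.normalClosure (Set.range P.rel)).comap ret := by
    refine Subgroup.normalClosure_le_normal ?_
    rintro _ ⟨i | i, rfl⟩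
    · change ret (FreeGroup.of none) ∈ Subgroup.normalClosure (Set.range P.rel)
      simp [ret, one_mem]
    · change ret (FreeGroup.map some (P.rel i)) ∈ Subgroup.normalClosure (Set.range P.rel)
      rw [hret]
      exact rel_mem P i
  change _ ↔ _ ∧ q.ker = Subgroup.normalClosure R
  refine and_congr ⟨fun h γ => ?_, fun h γ => ?_⟩ ⟨fun h => ?_, fun h => ?_⟩
  · obtain ⟨v, hv⟩ := h γ
    exact ⟨_, hv⟩
  · obtain ⟨w, hw⟩ := h γ
    exact ⟨ret w, (hqret w).trans hw⟩
  · refine le_antisymm (fun w hw => hN w (hsome ?_)) ?_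
    · rw [← h]
      exact (hqret w).trans hw
    · refine Subgroup.normalClosure_le_normal ?_
      rintro _ ⟨i | i, rfl⟩
      · exact hq
      · have hi := rel_mem P i
        rw [← h] at hi
        exact hi
  · refine le_antisymm (fun v hv => ?_) ?_
    · have h' : FreeGroup.map some v ∈ Subgroup.normalClosure R := by
        rw [← h]
        exact hv
      have h'' := hretN h'
      rwa [Subgroup.mem_comap, hret] at h''
    · intro v hv
      have h' := hsome hv
      rw [← h] at h'
      exact h'

/-- The new 2-cell runs once along the new 1-cell, whose boundary vanishes because `q` kills it:
this is one cancelling pair. -/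
theorem prolong (P : Presentation) (q : FreeGroup (Option P.gens) →* Γ)
    (hq : q (FreeGroup.of none) = 1) :
    Related P (q.comp (FreeGroup.map some)) P.prolong q where
  presents_iff := presents_prolong P q hq
  qEquiv := (QStep.prolong P).qEquiv
  simple _ := by
    refine ((P.complex (q.comp (FreeGroup.map some))).simpleEquiv_stab Unit).trans
      (BasedComplex.SimpleIso.of_equiv (L := P.prolong.complex q)
        (Equiv.optionEquivSumPUnit _).symm (Equiv.optionEquivSumPUnit _).symm ?_ ?_).simpleEquiv
    · rintro (x | x) u
      · rfl
      · exact (show MonoidAlgebra.single (q (FreeGroup.of none)) (1 : ℤ) - 1 = 0 from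
        sub_eq_zero.2 (hq ▸ MonoidAlgebra.one_def.symm)).symm
    · have hsome : ∀ i y, P.prolong.bdry₂ q (some i) y = ∑ x, fox (q.comp (FreeGroup.map some)) x
          (P.rel i) * fox (α := P.prolong.gens) q y (FreeGroup.of (some x)) := by
        intro i y
        exact fox_chain (β := P.prolong.gens) (FreeGroup.map some) q y (P.rel i)
      have hself : ∀ y : Option P.gens,
          fox (α := P.prolong.gens) q y (FreeGroup.of y) = 1 := fun y =>
        (fox_of (α := P.prolong.gens) q y y).trans (if_pos rfl)
      have hne : ∀ x y : Option P.gens, x ≠ y →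
          fox (α := P.prolong.gens) q y (FreeGroup.of x) = 0 := fun x y h =>
        (fox_of (α := P.prolong.gens) q y x).trans (if_neg h)
      rintro (i | i) (x | x)
      · refine Eq.trans ?_ (hsome i (some x)).symm
        rw [Finset.sum_eq_single x, hself, mul_one]
        · rfl
        · intro x' _ hx'
          rw [hne _ _ (by simpa using hx'), mul_zero]
        · exact fun h => absurd (Finset.mem_univ x) h
      · refine Eq.trans ?_ (hsome i none).symm
        refine (Finset.sum_eq_zero fun x' _ => ?_).symm
        rw [hne _ _ (by simp), mul_zero]
      · exact (hne none (some x) (by simp)).symm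
      · exact (hself none).symm

end Related

/-! ### Compound moves -/

namespace Related

variable {Γ : Type} [Group Γ]

theorem withRel_congr (P : Presentation) (q : FreeGroup P.gens →* Γ)
    {r s : P.rels → FreeGroup P.gens} (h : r = s) :
    Related (P.withRel r) q (P.withRel s) q :=
  h ▸ refl _ _

theorem congr_hom {P Q : Presentation} {q q₁ : FreeGroup P.gens →* Γ}
    {q' q₁' : FreeGroup Q.gens →* Γ} (h : Related P q Q q') (e : q = q₁) (e' : q' = q₁') :
    Related P q₁ Q q₁' :=
  e ▸ e' ▸ h

/-- The normal closure is generated by conjugates `w * r j * w⁻¹`. To multiply by such a conjugate,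
conjugate relator `i` by `w⁻¹`, multiply by `r j`, and conjugate back. -/
theorem update_mul (P : Presentation) (q : FreeGroup P.gens →* Γ) (r : P.rels → FreeGroup P.gens)
    (i : P.rels) {n : FreeGroup P.gens} (hn : n ∈ Subgroup.normalClosure (r '' {j | j ≠ i}))
    (s : FreeGroup P.gens) :
    Related (P.withRel (Function.update r i s)) q (P.withRel (Function.update r i (s * n))) q := by
  have hconj : ∀ s w, Related (P.withRel (Function.update r i s)) q
      (P.withRel (Function.update r i (w * s * w⁻¹))) q := by
    intro s w
    have h := relConj (P.withRel (Function.update r i s)) q i w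
    change Related (P.withRel (Function.update r i s)) q (P.withRel (Function.update
      (Function.update r i s) i (w * (Function.update r i s i) * w⁻¹))) q at h
    rwa [Function.update_self, Function.update_idem] at h
  have hmul : ∀ s j, j ≠ i → Related (P.withRel (Function.update r i s)) q
      (P.withRel (Function.update r i (s * r j))) q := by
    intro s j hj
    have h := relMul (P.withRel (Function.update r i s)) q i j hj.symm
    change Related (P.withRel (Function.update r i s)) q (P.withRel (Function.update
      (Function.update r i s) i (Function.update r i s i * Function.update r i s j))) q at h
    rwa [Function.update_self, Function.update_of_ne hj, Function.update_idem] at h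
  induction hn using Subgroup.closure_induction generalizing s with
  | mem n hn =>
    obtain ⟨_, ⟨j, hj, rfl⟩, c⟩ := Group.mem_conjugatesOfSet_iff.1 hn
    obtain ⟨w, rfl⟩ := isConj_iff.1 c
    have h := ((hconj s w⁻¹).trans (hmul _ j hj)).trans (hconj _ w)
    have e : w * (w⁻¹ * s * w⁻¹⁻¹ * r j) * w⁻¹ = s * (w * r j * w⁻¹) := by group
    rwa [e] at h
  | one =>
    rw [mul_one]
    exact Related.refl _ _
  | mul m n _ _ hm hn =>
    rw [← mul_assoc]
    exact (hm s).trans (hn _)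
  | inv n _ hn =>
    have h := (hn (s * n⁻¹)).symm
    rwa [inv_mul_cancel_right] at h

/-- The conjugate of `(r i)^{±1}` is reached by elementary moves. It differs from `s` by a right
factor that follows from the other relators, and `update_mul` absorbs that factor. -/
theorem update_of_conj (P : Presentation) (q : FreeGroup P.gens →* Γ)
    (r : P.rels → FreeGroup P.gens) (i : P.rels) (s g : FreeGroup P.gens)
    (h : s⁻¹ * (g * r i * g⁻¹) ∈ Subgroup.normalClosure (r '' {j | j ≠ i}) ∨
      s⁻¹ * (g * (r i)⁻¹ * g⁻¹) ∈ Subgroup.normalClosure (r '' {j | j ≠ i})) :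
    Related (P.withRel r) q (P.withRel (Function.update r i s)) q := by
  have hconj : Related (P.withRel r) q (P.withRel (Function.update r i (g * r i * g⁻¹))) q :=
    relConj (P.withRel r) q i g
  have hinv : Related (P.withRel r) q (P.withRel (Function.update r i (g * (r i)⁻¹ * g⁻¹))) q := by
    have h := relInv (P.withRel (Function.update r i (g * r i * g⁻¹))) q i
    change Related (P.withRel (Function.update r i (g * r i * g⁻¹))) q (P.withRel (Function.update
      (Function.update r i (g * r i * g⁻¹)) i (Function.update r i (g * r i * g⁻¹) i)⁻¹)) q at h
    rw [Function.update_self, Function.update_idem] at h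
    have e : (g * r i * g⁻¹)⁻¹ = g * (r i)⁻¹ * g⁻¹ := by group
    rw [e] at h
    exact hconj.trans h
  rcases h with h | h
  · have h' := update_mul P q r i h s
    rw [mul_inv_cancel_left] at h'
    exact hconj.trans h'.symm
  · have h' := update_mul P q r i h s
    rw [mul_inv_cancel_left] at h'
    exact hinv.trans h'.symm

/-- Relators may be changed simultaneously if each new one is, modulo the old relators of lower
rank, a conjugate of the corresponding old one or of its inverse. -/
theorem withRel (P : Presentation) (q : FreeGroup P.gens →* Γ) (r s : P.rels → FreeGroup P.gens)
    (rk : P.rels → ℕ)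
    (h : ∀ i, ∃ g, ∀ (H : Type) [Group H] (π : FreeGroup P.gens →* H),
      (∀ j, rk j < rk i → π (r j) = 1) → π (s i) = π (g * r i * g⁻¹) ∨
        π (s i) = π (g * (r i)⁻¹ * g⁻¹)) :
    Related (P.withRel r) q (P.withRel s) q := by
  have key : ∀ t : Finset P.rels,
      Related (P.withRel r) q (P.withRel fun i => if i ∈ t then s i else r i) q := by
    intro t
    -- Relators are replaced in order of decreasing rank: when `a` is treated, all relators of lower
    -- rank are still the old ones.
    induction t using Finset.induction_on_min_value rk with
    | empty => simpa using Related.refl (P.withRel r) q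
    | insert a t ha hle ih =>
      refine ih.trans ?_
      have e : (fun i => if i ∈ insert a t then s i else r i) =
          Function.update (fun i => if i ∈ t then s i else r i) a (s a) := by
        funext i
        by_cases hi : i = a
        · subst hi
          simp
        · simp [hi]
      rw [e]
      obtain ⟨g, hg⟩ := h a
      refine update_of_conj P q _ a (s a) g ?_
      -- The hypothesis is applied to the quotient by the other current relators, where equality of
      -- images means membership in `N`.
      set N := Subgroup.normalClosure ((fun i => if i ∈ t then s i else r i) '' {j | j ≠ a})
      have hlow : ∀ j, rk j < rk a → QuotientGroup.mk' N (r j) = 1 := by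
        intro j hj
        refine (QuotientGroup.eq_one_iff _).2 (Subgroup.subset_normalClosure ⟨j, ?_, ?_⟩)
        · rintro rfl
          exact lt_irrefl _ hj
        · have : j ∉ t := fun hjt => absurd (hle j hjt) (not_le.2 hj)
          simp [this]
      simp only [ha, if_false]
      exact (hg _ (QuotientGroup.mk' N) hlow).imp QuotientGroup.eq.1 QuotientGroup.eq.1
  exact (key Finset.univ).trans (withRel_congr P q (funext fun i => if_pos (Finset.mem_univ i)))

end Related

/-! ### Adjoining generators defined by words -/

namespace Presentation

/-- Add one new generator together with a relator that expresses it through a word `w`. -/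
def adjoinOne (P : Presentation) (w : FreeGroup P.gens) : Presentation where
  gens := Option P.gens
  rels := Option P.rels
  finGens := inferInstance
  finRels := inferInstance
  rel
    | none => FreeGroup.of none * (FreeGroup.map some w)⁻¹
    | some i => FreeGroup.map some (P.rel i)

/-- Add new generators together with relators that express them through words `w`. -/
def adjoin (P : Presentation) {ι : Type} [Finite ι] (w : ι → FreeGroup P.gens) : Presentation where
  gens := P.gens ⊕ ι
  rels := P.rels ⊕ ι
  finGens := inferInstance
  finRels := inferInstance
  rel
    | Sum.inl i => FreeGroup.map Sum.inl (P.rel i)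
    | Sum.inr k => FreeGroup.of (Sum.inr k) * (FreeGroup.map Sum.inl (w k))⁻¹

end Presentation

namespace Related

variable {Γ : Type} [Group Γ]

/-- The endomorphism that multiplies the new generator by a word in the old ones. -/
def shearHom {α : Type} (w : FreeGroup α) : FreeGroup (Option α) →* FreeGroup (Option α) :=
  FreeGroup.lift fun x => x.elim (FreeGroup.of none * FreeGroup.map some w)
    fun y => FreeGroup.of (some y)

theorem shearHom_none {α : Type} (w : FreeGroup α) :
    shearHom w (FreeGroup.of none) = FreeGroup.of none * FreeGroup.map some w := by
  simp [shearHom]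

theorem shearHom_some {α : Type} (w : FreeGroup α) (x : α) :
    shearHom w (FreeGroup.of (some x)) = FreeGroup.of (some x) := by
  simp [shearHom]

theorem shearHom_map {α : Type} (w v : FreeGroup α) :
    shearHom w (FreeGroup.map some v) = FreeGroup.map some v := by
  have : (shearHom w).comp (FreeGroup.map some) = FreeGroup.map some := by
    ext x
    simp [shearHom]
  exact DFunLike.congr_fun this v

theorem shearHom_comp {α : Type} (v w : FreeGroup α) :
    (shearHom v).comp (shearHom w) = shearHom (v * w) := by
  ext x
  rcases x with - | x
  · simp only [MonoidHom.comp_apply, shearHom_none, map_mul, shearHom_map, mul_assoc]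
  · simp only [MonoidHom.comp_apply, shearHom_some]

theorem shearHom_one {α : Type} : shearHom (1 : FreeGroup α) = MonoidHom.id _ := by
  ext x
  rcases x with - | x
  · simp [shearHom_none]
  · simp [shearHom_some]

/-- The automorphism that multiplies the new generator by a word in the old ones. -/
def shear {α : Type} : FreeGroup α →* MulAut (FreeGroup (Option α)) where
  toFun w := MonoidHom.toMulEquiv (shearHom w) (shearHom w⁻¹)
    (by rw [shearHom_comp, inv_mul_cancel, shearHom_one])
    (by rw [shearHom_comp, mul_inv_cancel, shearHom_one])
  map_one' := by
    ext1 v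
    exact DFunLike.congr_fun shearHom_one v
  map_mul' v w := by
    ext1 u
    exact (DFunLike.congr_fun (shearHom_comp v w) u).symm

/-- As `shear` is a homomorphism in the word, it suffices to treat single generators, where it is
one elementary substitution. -/
theorem shear_mem (P : Presentation) (w : FreeGroup P.gens) :
    shear w ∈ elementaryAut P.prolong := by
  have hof : ∀ x, shear (FreeGroup.of x) ∈ elementaryAut P.prolong := by
    intro x
    refine Subgroup.subset_closure (Or.inr ⟨none, some x, nofun, ?_⟩)
    refine MulEquiv.toMonoidHom_injective ?_
    refine FreeGroup.ext_hom _ _ fun y => ?_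
    rcases y with - | y
    · refine (shearHom_none _).trans ?_
      exact (P.prolong.substHom_self none _).symm
    · refine (shearHom_some _ _).trans ?_
      exact (P.prolong.substHom_of_ne (x := none) (z := some y) nofun _).symm
  induction w using FreeGroup.induction_on with
  | C1 => exact (map_one shear).symm ▸ one_mem _
  | of x => exact hof x
  | inv_of x _ => exact (map_inv shear (FreeGroup.of x)).symm ▸ inv_mem (hof x)
  | mul v w hv hw => exact (map_mul shear v w).symm ▸ mul_mem hv hw

/-- Prolong by a generator `b` and then shear `b` to `b w⁻¹`, which leaves the old relators alone.
-/
theorem adjoinOne (P : Presentation) (w : FreeGroup P.gens) (q : FreeGroup (Option P.gens) →* Γ)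
    (hq : q (FreeGroup.of none) = q (FreeGroup.map some w)) :
    Related P (q.comp (FreeGroup.map some)) (P.adjoinOne w) q := by
  -- Before the shear the new generator must be trivial in `Γ`, as `prolong` requires.
  let q' : FreeGroup (Option P.gens) →* Γ := q.comp (shearHom w⁻¹)
  have hq' : q' (FreeGroup.of none) = 1 := by
    simp [q', shearHom_none, hq]
  have h₁ := prolong P q' hq'
  have e₁ : q'.comp (FreeGroup.map some) = q.comp (FreeGroup.map some) := by
    ext x
    simp [q', shearHom_some]
  have h₂ : Related P.prolong q' (P.prolong.withRel fun i => shear w⁻¹ (P.prolong.rel i)) q :=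
    applyHom (shear_mem P w⁻¹) P.prolong.rel q
  have h₃ : Related (P.prolong.withRel fun i => shear w⁻¹ (P.prolong.rel i)) q
      (P.prolong.withRel (P.adjoinOne w).rel) q := by
    refine withRel_congr P.prolong q (funext fun i => ?_)
    rcases i with - | i
    · exact (shearHom_none w⁻¹).trans (by rw [map_inv]; rfl)
    · exact shearHom_map _ _
  exact (h₁.congr_hom e₁ rfl).trans (h₂.trans h₃)

/-- Move the new element of an option type to the second summand. -/
def optionSumEquiv (α β : Type) : Option (α ⊕ β) ≃ α ⊕ Option β where
  toFun x := x.elim (Sum.inr none) (Sum.map id some)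
  invFun x := x.elim (fun a => some (Sum.inl a)) (Option.map Sum.inr)
  left_inv x := by rcases x with - | x | x <;> rfl
  right_inv x := by rcases x with x | - | x <;> rfl

/-- The words involve old generators only, so the new generators can be adjoined one at a time in
any order. -/
theorem adjoin (P : Presentation) {ι : Type} [Finite ι] (w : ι → FreeGroup P.gens)
    (q : FreeGroup (P.gens ⊕ ι) →* Γ)
    (hq : ∀ k, q (FreeGroup.of (Sum.inr k)) = q (FreeGroup.map Sum.inl (w k))) :
    Related P (q.comp (FreeGroup.map Sum.inl)) (P.adjoin w) q := by
  revert hq q w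
  refine Finite.induction_empty_option (P := fun κ => ∀ [Finite κ] (w : κ → FreeGroup P.gens)
      (q : FreeGroup (P.gens ⊕ κ) →* Γ),
      (∀ k, q (FreeGroup.of (Sum.inr k)) = q (FreeGroup.map Sum.inl (w k))) →
      Related P (q.comp (FreeGroup.map Sum.inl)) (P.adjoin w) q) ?_ ?_ ?_ ι
  · intro α β e ih _ w q hq
    have : Finite α := Finite.of_equiv β e.symm
    have hmap : ∀ v : FreeGroup P.gens, FreeGroup.map ((Equiv.refl P.gens).sumCongr e)
        (FreeGroup.map Sum.inl v) = FreeGroup.map Sum.inl v := fun v => FreeGroup.map.comp _ _ _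
    refine ((ih (w ∘ e) (q.comp (FreeGroup.map ((Equiv.refl P.gens).sumCongr e))) ?_).trans
      (relabel (P := P.adjoin (w ∘ e)) (Q := P.adjoin w) ((Equiv.refl P.gens).sumCongr e)
        ((Equiv.refl P.rels).sumCongr e) ?_ q)).congr_hom ?_ rfl
    · intro k
      rw [MonoidHom.comp_apply, MonoidHom.comp_apply, hmap, FreeGroup.map.of]
      exact hq (e k)
    · rintro (i | k)
      · exact (hmap _).symm
      · change _ = FreeGroup.map ((Equiv.refl P.gens).sumCongr e)
            (FreeGroup.of (Sum.inr k) * (FreeGroup.map Sum.inl (w (e k)))⁻¹)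
        rw [map_mul, map_inv, hmap]
        rfl
    · ext x
      rfl
  · intro _ w q _
    refine (relabel (P := P) (Q := P.adjoin w) (Equiv.sumEmpty P.gens PEmpty).symm
      (Equiv.sumEmpty P.rels PEmpty).symm (fun i => rfl) q).congr_hom ?_ rfl
    ext x
    rfl
  · intro α _ ih _ w q hq
    let q₂ := q.comp (FreeGroup.map (optionSumEquiv P.gens α))
    let q₁ := q₂.comp (FreeGroup.map some)
    have hinl : ∀ v : FreeGroup P.gens, FreeGroup.map (optionSumEquiv P.gens α)
        (FreeGroup.map some (FreeGroup.map Sum.inl v)) = FreeGroup.map Sum.inl v := by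
      intro v
      rw [FreeGroup.map.comp, FreeGroup.map.comp]
      rfl
    have hnone : ∀ v : FreeGroup P.gens, FreeGroup.map (optionSumEquiv P.gens α)
        (FreeGroup.of none * (FreeGroup.map some (FreeGroup.map Sum.inl v))⁻¹) =
        FreeGroup.of (Sum.inr none) * (FreeGroup.map Sum.inl v)⁻¹ := by
      intro v
      rw [map_mul, map_inv, hinl]
      rfl
    have h₁ := ih (w ∘ some) q₁ (by
      intro k
      simp only [q₁, q₂, MonoidHom.comp_apply, hinl, Function.comp_apply]
      exact hq (some k))
    have h₂ := adjoinOne (P.adjoin (w ∘ some)) (FreeGroup.map Sum.inl (w none)) q₂ (by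
      refine Eq.trans (hq none) ?_
      exact (congrArg q (hinl (w none))).symm)
    have h₃ := relabel (P := (P.adjoin (w ∘ some)).adjoinOne (FreeGroup.map Sum.inl (w none)))
      (Q := P.adjoin w) (optionSumEquiv P.gens α) (optionSumEquiv P.rels α) (by
        rintro (- | i | k)
        · exact (hnone (w none)).symm
        · exact (hinl _).symm
        · change _ = FreeGroup.map (optionSumEquiv P.gens α) (FreeGroup.map some
            (FreeGroup.of (Sum.inr k) * (FreeGroup.map Sum.inl (w (some k)))⁻¹))
          rw [map_mul, map_mul, map_inv, map_inv, hinl]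
          rfl) q
    refine ((h₁.trans h₂).trans h₃).congr_hom ?_ rfl
    ext x
    rfl

end Related

/-! ## Spanning trees -/

section Tree

variable {V E : Type} (s t : E → V) (root : V)

/-- A rooted spanning tree of a multigraph with edge ends `s` and `t`: the edge `p v` joins `v` to a
vertex of smaller depth. -/
structure SpanningTree where
  d : V → ℕ
  p : {v // v ≠ root} → E
  prop : ∀ v, (s (p v) = v ∧ d (t (p v)) < d v) ∨ (t (p v) = v ∧ d (s (p v)) < d v)

variable {s t root}

/-- If two distinct vertices chose the same edge, each would have smaller depth than the other. -/
theorem SpanningTree.p_injective (T : SpanningTree s t root) : Function.Injective T.p := by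
  intro v w h
  rcases T.prop v with ⟨h₁, h₂⟩ | ⟨h₁, h₂⟩ <;> rcases T.prop w with ⟨h₃, h₄⟩ | ⟨h₃, h₄⟩
  · exact Subtype.ext (h₁.symm.trans ((congrArg s h).trans h₃))
  · rw [h, h₃] at h₂
    rw [← h, h₁] at h₄
    exact absurd h₂ (not_lt.2 h₄.le)
  · rw [h, h₃] at h₂
    rw [← h, h₁] at h₄
    exact absurd h₂ (not_lt.2 h₄.le)
  · exact Subtype.ext (h₁.symm.trans ((congrArg t h).trans h₃))

theorem SpanningTree.not_loop (T : SpanningTree s t root) (v : {v // v ≠ root}) :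
    s (T.p v) ≠ t (T.p v) := by
  intro h
  rcases T.prop v with ⟨h₁, h₂⟩ | ⟨h₁, h₂⟩
  · rw [← h, h₁] at h₂
    exact lt_irrefl _ h₂
  · rw [h, h₁] at h₂
    exact lt_irrefl _ h₂

/-- The end of `T.p w` other than `w` is the parent of `w`, so a tree edge at `v` chosen by another
vertex comes from a child of `v`. -/
theorem SpanningTree.lt_of_incident (T : SpanningTree s t root) {v : V} (w : {v // v ≠ root})
    (h : s (T.p w) = v ∨ t (T.p w) = v) (hw : (w : V) ≠ v) : T.d v < T.d w := by
  rcases T.prop w with ⟨h₁, h₂⟩ | ⟨h₁, h₂⟩ <;> rcases h with h | h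
  · exact absurd (h₁.symm.trans h) hw
  · exact h ▸ h₂
  · exact h ▸ h₂
  · exact absurd (h₁.symm.trans h) hw

/-- The hypothesis is connectedness, in the form that a set containing the root and closed along
edges is everything. The tree is found by breadth-first search. -/
theorem exists_spanningTree
    (h : ∀ S : Set V, root ∈ S → (∀ e, s e ∈ S ↔ t e ∈ S) → ∀ v, v ∈ S) :
    Nonempty (SpanningTree s t root) := by
  classical
  -- `R n` consists of the ends of walks of length `n` from the root; the depth is the least such
  -- length.
  obtain ⟨R, hR₀, hR₁⟩ : ∃ R : ℕ → Set V, R 0 = {root} ∧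
      ∀ n, R (n + 1) = {v | ∃ e, (s e = v ∧ t e ∈ R n) ∨ (t e = v ∧ s e ∈ R n)} :=
    ⟨fun n => Nat.rec {root}
      (fun _ A => {v | ∃ e, (s e = v ∧ t e ∈ A) ∨ (t e = v ∧ s e ∈ A)}) n, rfl, fun _ => rfl⟩
  have hR : ∀ v, ∃ n, v ∈ R n := by
    refine h {v | ∃ n, v ∈ R n} ⟨0, by simp [hR₀]⟩ fun e => ⟨?_, ?_⟩
    · rintro ⟨n, hn⟩
      exact ⟨n + 1, by rw [hR₁]; exact ⟨e, Or.inr ⟨rfl, hn⟩⟩⟩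
    · rintro ⟨n, hn⟩
      exact ⟨n + 1, by rw [hR₁]; exact ⟨e, Or.inl ⟨rfl, hn⟩⟩⟩
  have hd : ∀ v : V, ∃ n, v ∈ R n ∧ ∀ m, v ∈ R m → n ≤ m := fun v =>
    ⟨Nat.find (hR v), Nat.find_spec (hR v), fun m hm => Nat.find_min' (hR v) hm⟩
  choose d hd hmin using hd
  have key : ∀ v : {v // v ≠ root}, ∃ e,
      (s e = v ∧ d (t e) < d v) ∨ (t e = v ∧ d (s e) < d v) := by
    rintro ⟨v, hv⟩
    have hm := hd v
    rcases hn : d v with - | n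
    · rw [hn, hR₀] at hm
      exact absurd hm hv
    · rw [hn, hR₁] at hm
      obtain ⟨e, ⟨h₁, h₂⟩ | ⟨h₁, h₂⟩⟩ := hm
      · exact ⟨e, Or.inl ⟨h₁, by have := hmin _ _ h₂; omega⟩⟩
      · exact ⟨e, Or.inr ⟨h₁, by have := hmin _ _ h₂; omega⟩⟩
  choose p hp using key
  exact ⟨⟨d, p, hp⟩⟩

/-- Vertices can be given values in a group with prescribed quotients along the tree. -/
theorem SpanningTree.exists_potential (T : SpanningTree s t root) {G : Type} [Group G] (g : E → G) :
    ∃ w : V → G, w root = 1 ∧ ∀ v, w (s (T.p v)) * (w (t (T.p v)))⁻¹ = g (T.p v) := by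
  classical
  let F : ∀ v, (∀ u, T.d u < T.d v → G) → G := fun v ih =>
    if h : v = root then 1
    else if h₁ : s (T.p ⟨v, h⟩) = v ∧ T.d (t (T.p ⟨v, h⟩)) < T.d v then
      g (T.p ⟨v, h⟩) * ih _ h₁.2
    else if h₂ : T.d (s (T.p ⟨v, h⟩)) < T.d v then (g (T.p ⟨v, h⟩))⁻¹ * ih _ h₂
    else 1
  let w : V → G := WellFounded.fix (InvImage.wf T.d Nat.lt_wfRel.wf) F
  have hw : ∀ v, w v = F v fun u _ => w u := fun v => WellFounded.fix_eq _ _ v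
  refine ⟨w, by rw [hw]; exact dif_pos rfl, ?_⟩
  rintro ⟨v, hv⟩
  by_cases h₁ : s (T.p ⟨v, hv⟩) = v ∧ T.d (t (T.p ⟨v, hv⟩)) < T.d v
  · have h : w v = g (T.p ⟨v, hv⟩) * w (t (T.p ⟨v, hv⟩)) := by
      rw [hw]
      simp only [F, dif_neg hv, dif_pos h₁]
    rw [h₁.1, h, mul_inv_cancel_right]
  · obtain ⟨h₂, h₃⟩ := (T.prop ⟨v, hv⟩).resolve_left h₁
    have h : w v = (g (T.p ⟨v, hv⟩))⁻¹ * w (s (T.p ⟨v, hv⟩)) := by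
      rw [hw]
      simp only [F, dif_neg hv, dif_neg h₁, dif_pos h₃]
    simp only at h₂
    rw [h₂, h]
    group

end Tree

/-! ## Combinatorics of knot diagrams -/

namespace CrossingData

variable {C : Type} (D : CrossingData C)

theorem right_toNW (c : C) : D.right (D.toNW c) = D.left (D.toNE c) := Quot.sound (Corner.north c)

theorem right_toNE (c : C) : D.right (D.toNE c) = D.right (D.fromSE c) := Quot.sound (Corner.east c)

theorem left_fromSE (c : C) : D.left (D.fromSE c) = D.right (D.fromSW c) :=
  Quot.sound (Corner.south c)

theorem left_fromSW (c : C) : D.left (D.fromSW c) = D.left (D.toNW c) := Quot.sound (Corner.west c)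

theorem arc_next_true (c : C) : D.arc (D.next (c, true)) = D.arc (c, true) :=
  (Quot.sound (Continues.over c)).symm

/-- The crossing that an edge leaves. -/
def source (e : C × Bool) : C := (D.next.symm e).1

theorem source_next (e : C × Bool) : D.source (D.next e) = e.1 := by simp [source]

theorem eq_of_target {e : C × Bool} {c : C} (h : e.1 = c) : e = D.fromSW c ∨ e = D.fromSE c := by
  obtain ⟨c', b⟩ := e
  subst h
  unfold fromSW fromSE
  rcases b <;> cases D.positive c' <;> simp

theorem eq_of_source {e : C × Bool} {c : C} (h : D.source e = c) :
    e = D.toNE c ∨ e = D.toNW c := by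
  rcases D.eq_of_target h with h | h
  · exact Or.inl ((D.next.symm_apply_eq).1 h)
  · exact Or.inr ((D.next.symm_apply_eq).1 h)

theorem fromSW_ne_fromSE (c : C) : D.fromSW c ≠ D.fromSE c := by
  simp [fromSW, fromSE]

theorem toNE_ne_toNW (c : C) : D.toNE c ≠ D.toNW c :=
  fun h => D.fromSW_ne_fromSE c (D.next.injective h)

/-- The four edges at a crossing, one of which is `e`. -/
theorem corner_cases {c : C} {e : C × Bool} (h : D.source e = c ∨ e.1 = c)
    (hl : D.source e ≠ e.1) :
    (e = D.toNW c ∧ D.toNE c ≠ e ∧ D.fromSE c ≠ e ∧ D.fromSW c ≠ e) ∨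
    (e = D.toNE c ∧ D.toNW c ≠ e ∧ D.fromSE c ≠ e ∧ D.fromSW c ≠ e) ∨
    (e = D.fromSE c ∧ D.toNW c ≠ e ∧ D.toNE c ≠ e ∧ D.fromSW c ≠ e) ∨
    (e = D.fromSW c ∧ D.toNW c ≠ e ∧ D.toNE c ≠ e ∧ D.fromSE c ≠ e) := by
  -- Since `e` is not a loop, it cannot both leave and enter `c`.
  have hto : ∀ e' : C × Bool, e'.1 = c → D.source e = c → e' ≠ e := by
    rintro e' h₁ h₂ rfl
    exact hl (h₂.trans h₁.symm)
  have hfrom : ∀ e' : C × Bool, e'.1 = c → e.1 = c → D.next e' ≠ e := by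
    rintro e' h₁ h₂ rfl
    exact hl (by rw [source_next, h₁, h₂])
  rcases h with h | h
  · rcases D.eq_of_source h with h' | h'
    · exact Or.inr (Or.inl ⟨h', by rw [h']; exact (D.toNE_ne_toNW c).symm, hto _ rfl h, hto _ rfl h⟩)
    · exact Or.inl ⟨h', by rw [h']; exact D.toNE_ne_toNW c, hto _ rfl h, hto _ rfl h⟩
  · rcases D.eq_of_target h with h' | h'
    · exact Or.inr (Or.inr (Or.inr ⟨h', hfrom _ rfl h, hfrom _ rfl h,
        by rw [h']; exact (D.fromSW_ne_fromSE c).symm⟩))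
    · exact Or.inr (Or.inr (Or.inl ⟨h', hfrom _ rfl h, hfrom _ rfl h,
        by rw [h']; exact D.fromSW_ne_fromSE c⟩))

end CrossingData

/-! ### Spanning trees of the diagram and its dual, and the arcs -/

namespace KnotDiagram

open CrossingData

variable {C : Type} [Finite C] (D : KnotDiagram C)

/-- This is how the single-component condition enters: membership propagates along the closed curve.
-/
theorem mem_of_next {A : Set (C × Bool)} (hA : ∀ e, e ∈ A ↔ D.next e ∈ A) {e : C × Bool}
    (he : e ∈ A) (f : C × Bool) : f ∈ A := by
  obtain ⟨n, -, -, rfl⟩ := (D.knot e f).exists_pow_eq''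
  induction n with
  | zero => exact he
  | succ n ih =>
    rw [pow_succ', Equiv.Perm.mul_apply]
    exact (hA _).1 ih

theorem exists_crossingTree (X : C) : Nonempty (SpanningTree D.source Prod.fst X) := by
  refine exists_spanningTree fun S hX hS v => ?_
  refine D.mem_of_next (A := {e | e.1 ∈ S}) (fun e => ?_) (e := (X, true)) hX (v, true)
  have h := hS (D.next e)
  rwa [source_next] at h

-- Let `S` be a set of regions that contains the outer one and is closed across edges outside the
-- tree. Working inwards from the leaves, three of the four edges at a crossing do not separate `S`
-- from its complement. Going round the crossing, neither does the fourth, which leads to the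
-- parent. So no edge separates, and following the knot shows that `S` contains every region.
variable {D} in
theorem exists_regionTree {X : C} (T : SpanningTree D.source Prod.fst X) (outer : D.Region) :
    Nonempty (SpanningTree (fun e : {e // e ∉ Set.range T.p} => D.left e) (fun e => D.right e)
      outer) := by
  refine exists_spanningTree fun S ho hS => ?_
  obtain ⟨B, hB⟩ := (Set.finite_range T.d).bddAbove
  -- Induction on how far the depth of `c` lies below the bound `B`; tree edges at `c` other than
  -- `T.p c` come from deeper crossings.
  have htree : ∀ k, ∀ c : {c // c ≠ X}, B < T.d c + k → (D.left (T.p c) ∈ S ↔ D.right (T.p c) ∈ S) := by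
    intro k
    induction k with
    | zero => exact fun c hc => absurd (hB ⟨c, rfl⟩) (not_le.2 hc)
    | succ k ih =>
      intro c hc
      have hother : ∀ e, (D.source e = (c : C) ∨ e.1 = (c : C)) → e ≠ T.p c →
          (D.left e ∈ S ↔ D.right e ∈ S) := by
        intro e he hne
        by_cases hr : e ∈ Set.range T.p
        · obtain ⟨c', rfl⟩ := hr
          have hlt := T.lt_of_incident c' he fun h => hne (congrArg T.p (Subtype.ext h))
          exact ih c' (by omega)
        · exact hS ⟨e, hr⟩
      have hNW := hother (D.toNW c) (Or.inl (D.source_next _))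
      have hNE := hother (D.toNE c) (Or.inl (D.source_next _))
      have hSE := hother (D.fromSE c) (Or.inr rfl)
      have hSW := hother (D.fromSW c) (Or.inr rfl)
      rw [right_toNW] at hNW
      rw [right_toNE] at hNE
      rw [left_fromSE] at hSE
      rw [left_fromSW] at hSW
      rcases D.corner_cases ((T.prop c).imp And.left And.left) (T.not_loop c) with
        ⟨h, h₁, h₂, h₃⟩ | ⟨h, h₁, h₂, h₃⟩ | ⟨h, h₁, h₂, h₃⟩ | ⟨h, h₁, h₂, h₃⟩
      · rw [h, right_toNW, hNE h₁, ← hSE h₂, ← hSW h₃]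
      · rw [h, right_toNE, ← hSE h₂, ← hSW h₃, hNW h₁]
      · rw [h, left_fromSE, ← hSW h₃, hNW h₁, hNE h₂]
      · rw [h, left_fromSW, hNW h₁, hNE h₂, hSE h₃]
  have hedge : ∀ e, D.left e ∈ S ↔ D.right e ∈ S := by
    intro e
    by_cases hr : e ∈ Set.range T.p
    · obtain ⟨c, rfl⟩ := hr
      exact htree (B + 1) c (by omega)
    · exact hS ⟨e, hr⟩
  -- Consecutive edges have their left regions at a common crossing, and neighbouring corners there
  -- share an edge.
  have hnext : ∀ e, D.left e ∈ S ↔ D.left (D.next e) ∈ S := by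
    intro e
    have hW := D.left_fromSW e.1
    have hN := hedge (D.toNW e.1)
    have hSW := hedge (D.fromSW e.1)
    rw [right_toNW] at hN
    rcases D.eq_of_target (e := e) rfl with h | h
    · rw [h] at *
      change _ ↔ D.left (D.toNE _) ∈ S
      rw [← hN, ← hW]
      rfl
    · have h' : D.left (D.next e) = D.left (D.toNW e.1) := by
        conv_lhs => rw [h]
        rfl
      rw [h', ← hW, hSW, ← left_fromSE, ← h]
  obtain ⟨⟨e, b⟩, rfl⟩ := Quot.exists_rep outer
  have he : D.left e ∈ S := by
    cases b
    · exact (hedge e).2 ho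
    · exact ho
  intro r
  obtain ⟨⟨f, b⟩, rfl⟩ := Quot.exists_rep r
  have hf : D.left f ∈ S := D.mem_of_next (A := {e | D.left e ∈ S}) hnext he f
  cases b
  · exact (hedge f).1 hf
  · exact hf

variable {D} in
/-- The edges are divided among a spanning tree of the diagram and one of the dual graph. -/
theorem tree_bijective {X : C} (T : SpanningTree D.source Prod.fst X) {outer : D.Region}
    (T' : SpanningTree (fun e : {e // e ∉ Set.range T.p} => D.left e) (fun e => D.right e) outer) :
    Function.Bijective (Sum.elim (fun r => (T'.p r : C × Bool)) T.p) := by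
  -- The dual tree avoids the first tree, so the map is injective. Surjectivity is a count: `(V - 1)
  -- + (F - 1) = 2V` because `F = V + 2`.
  refine Function.Injective.bijective_of_nat_card_le ?_ ?_
  · refine Function.Injective.sumElim (Subtype.val_injective.comp T'.p_injective) T.p_injective ?_
    intro r c h
    exact (T'.p r).2 ⟨c, h.symm⟩
  · classical
    have h₁ : Nat.card D.Region = Nat.card {r : D.Region // r ≠ outer} + 1 := by
      rw [← Finite.card_option]
      exact (Nat.card_congr (Equiv.optionSubtypeNe outer)).symm
    have h₂ : Nat.card C = Nat.card {c : C // c ≠ X} + 1 := by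
      rw [← Finite.card_option]
      exact (Nat.card_congr (Equiv.optionSubtypeNe X)).symm
    have h₃ := D.planar
    have h₄ : Nat.card (C × Bool) = Nat.card C * 2 := by simp [Nat.card_prod]
    rw [Nat.card_sum, h₄]
    omega

/-- The position of an edge in its arc, and the crossing at which an arc starts. -/
theorem exists_arcStart (Y : C) : ∃ (k : C × Bool → ℕ) (start : D.Arc → C),
    (∀ c, k (D.next (c, true)) = k (c, true) + 1) ∧ (∀ c, start (D.arc (D.next (c, false))) = c) ∧
    ∀ a, D.arc (D.next (start a, false)) = a := by
  -- Going backwards from any edge one meets an under passage, since the single closed curve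
  -- contains `(Y, false)`.
  have hex : ∀ e, ∃ j, ((D.next.symm^[j + 1]) e).2 = false := by
    intro e
    obtain ⟨n, hn, -, h⟩ := (D.knot (Y, false) e).exists_pow_eq''
    refine ⟨n - 1, ?_⟩
    rw [Nat.sub_add_cancel hn, ← h, ← Equiv.Perm.iterate_eq_pow]
    rw [(Function.LeftInverse.iterate D.next.symm_apply_apply n)]
  -- The number of over passages between the start of the arc and `e`.
  let k := fun e => Nat.find (hex e)
  let st := fun e => ((D.next.symm^[k e + 1]) e).1
  have hk : ∀ c, k (D.next (c, true)) = k (c, true) + 1 := by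
    intro c
    refine (Nat.find_eq_iff _).2 ⟨?_, ?_⟩
    · rw [Function.iterate_succ_apply, Equiv.symm_apply_apply]
      exact Nat.find_spec (hex (c, true))
    · rintro (- | j) hj
      · simp
      · rw [Function.iterate_succ_apply, Equiv.symm_apply_apply]
        exact Nat.find_min (hex (c, true)) (Nat.lt_of_succ_lt_succ hj)
  have hk0 : ∀ c, k (D.next (c, false)) = 0 := by
    intro c
    refine (Nat.find_eq_zero _).2 ?_
    simp
  have hst : ∀ c, st (D.next (c, true)) = st (c, true) := by
    intro c
    simp only [st, hk]
    rw [Function.iterate_succ_apply, Equiv.symm_apply_apply]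
  have hst0 : ∀ c, st (D.next (c, false)) = c := by
    intro c
    simp only [st, hk0]
    simp
  let start : D.Arc → C := Quot.lift st (by
    rintro _ _ ⟨c⟩
    exact (hst c).symm)
  have hsurj : ∀ n e, k e = n → ∃ c, D.arc (D.next (c, false)) = D.arc e := by
    intro n
    induction n with
    | zero =>
      intro e he
      obtain ⟨⟨c, b⟩, rfl⟩ := D.next.surjective e
      cases b
      · exact ⟨c, rfl⟩
      · rw [hk] at he
        exact absurd he (Nat.succ_ne_zero _)
    | succ n ih =>
      intro e he
      obtain ⟨⟨c, b⟩, rfl⟩ := D.next.surjective e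
      cases b
      · exact ⟨c, rfl⟩
      · rw [arc_next_true]
        exact ih _ (by rw [hk] at he; omega)
  refine ⟨k, start, hk, hst0, fun a => ?_⟩
  obtain ⟨e, rfl⟩ := Quot.exists_rep a
  obtain ⟨c, hc⟩ := hsurj _ e rfl
  change D.arc (D.next (start (D.arc e), false)) = D.arc e
  rw [← hc]
  exact congrArg (fun c => D.arc (D.next (c, false))) (hst0 c)

end KnotDiagram

/-! ## Relating the presentations of a knot diagram -/

/-- The presentation with a given family of relators. -/
abbrev Presentation.ofRel {G R : Type} [hG : Finite G] [hR : Finite R] (r : R → FreeGroup G) :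
    Presentation :=
  ⟨G, R, hG, hR, r⟩

namespace Related

variable {Γ G R G' R' ι : Type} [Group Γ] [Finite G] [Finite R] [Finite G'] [Finite R'] [Finite ι]

theorem ofRel_change (q : FreeGroup G →* Γ) (r s : R → FreeGroup G) (rk : R → ℕ)
    (h : ∀ i, ∃ g, ∀ (H : Type) [Group H] (π : FreeGroup G →* H),
      (∀ j, rk j < rk i → π (r j) = 1) → π (s i) = π (g * r i * g⁻¹) ∨
        π (s i) = π (g * (r i)⁻¹ * g⁻¹)) :
    Related (.ofRel r) q (.ofRel s) q :=
  withRel (.ofRel r) q r s rk h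

theorem ofRel_relabel (e : G ≃ G') (f : R ≃ R') {r : R → FreeGroup G} {r' : R' → FreeGroup G'}
    (h : ∀ i, r' (f i) = FreeGroup.map e (r i)) (q : FreeGroup G' →* Γ) :
    Related (.ofRel r) (q.comp (FreeGroup.map e)) (.ofRel r') q :=
  relabel (P := .ofRel r) (Q := .ofRel r') e f h q

theorem ofRel_adjoin {r : R → FreeGroup G} (w : ι → FreeGroup G) {s : R ⊕ ι → FreeGroup (G ⊕ ι)}
    (hs₁ : ∀ i, s (Sum.inl i) = FreeGroup.map Sum.inl (r i))
    (hs₂ : ∀ k, s (Sum.inr k) = FreeGroup.of (Sum.inr k) * (FreeGroup.map Sum.inl (w k))⁻¹)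
    (q : FreeGroup (G ⊕ ι) →* Γ)
    (hq : ∀ k, q (FreeGroup.of (Sum.inr k)) = q (FreeGroup.map Sum.inl (w k))) :
    Related (.ofRel r) (q.comp (FreeGroup.map Sum.inl)) (.ofRel s) q := by
  refine (adjoin (.ofRel r) w q hq).trans
    (withRel_congr ((Presentation.ofRel r).adjoin w) q (funext fun i => ?_))
  rcases i with i | k
  · exact (hs₁ i).symm
  · exact (hs₂ k).symm

end Related

/-- By induction on depth: the quotient along the edge to the parent determines the value. -/
theorem SpanningTree.potential_unique {V E : Type} {s t : E → V} {root : V}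
    (T : SpanningTree s t root) {G : Type} [Group G] {w w' : V → G} (h₀ : w root = w' root)
    (h : ∀ v, w (s (T.p v)) * (w (t (T.p v)))⁻¹ = w' (s (T.p v)) * (w' (t (T.p v)))⁻¹) (v : V) :
    w v = w' v := by
  have key : ∀ n v, T.d v < n → w v = w' v := by
    intro n
    induction n with
    | zero => exact fun v hv => absurd hv (Nat.not_lt_zero _)
    | succ n ih =>
      intro v hv
      by_cases hr : v = root
      · rw [hr, h₀]
      · have hp := h ⟨v, hr⟩
        rcases T.prop ⟨v, hr⟩ with ⟨h₁, h₂⟩ | ⟨h₁, h₂⟩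
        · rw [h₁, ih (t (T.p ⟨v, hr⟩)) (lt_of_lt_of_le h₂ (Nat.le_of_lt_succ hv))] at hp
          exact mul_right_cancel hp
        · rw [h₁, ih (s (T.p ⟨v, hr⟩)) (lt_of_lt_of_le h₂ (Nat.le_of_lt_succ hv))] at hp
          exact inv_injective (mul_left_cancel hp)
  exact key _ v (Nat.lt_succ_self _)

theorem regionGen_outer {R : Type} (outer : R) : regionGen outer outer = 1 := dif_pos rfl

theorem regionGen_of {R : Type} (outer : R) (r : {s : R // s ≠ outer}) :
    regionGen outer (r : R) = FreeGroup.of r := dif_neg r.2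

/-! ### The edge presentation against the region presentation -/

namespace KnotDiagram

open CrossingData Presentation

variable {C Γ : Type} [Group Γ] [Finite C] (D : KnotDiagram C)

/-- The homomorphism from the free group on the edges that is obtained from one on the regions. -/
noncomputable def edgeHom (outer : D.Region) (q : FreeGroup {r : D.Region // r ≠ outer} →* Γ) :
    FreeGroup (C × Bool) →* Γ :=
  FreeGroup.lift fun e => q (regionGen outer (D.left e) * (regionGen outer (D.right e))⁻¹)

/-- Both sides lead to the presentation with all edges and regions as generators, and with relators
`t₁` and `δ e` for every edge. From the edge side, `δ` on the dual tree comes from the definitions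
of the regions, and `δ` on the crossing tree from the type 2 relators. -/
theorem edge_related_region (X : C) (outer : D.Region)
    (q : FreeGroup {r : D.Region // r ≠ outer} →* Γ) :
    Related (D.edgePresentation X) (D.edgeHom outer q) (D.regionPresentation outer) q := by
  classical
  obtain ⟨T⟩ := D.exists_crossingTree X
  obtain ⟨T'⟩ := exists_regionTree T outer
  obtain ⟨B, hBd⟩ := (Set.finite_range T.d).bddAbove
  -- `W r` expresses a region through edges by multiplying along the dual tree from the outer
  -- region.
  obtain ⟨W, hW₀, hW⟩ := T'.exists_potential fun e => FreeGroup.of (e : C × Bool)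
  -- words in the generators of edges and regions
  let ρ : D.Region → FreeGroup ((C × Bool) ⊕ {r : D.Region // r ≠ outer}) := fun r =>
    FreeGroup.map Sum.inr (regionGen outer r)
  let ε : C × Bool → FreeGroup ((C × Bool) ⊕ {r : D.Region // r ≠ outer}) := fun e =>
    FreeGroup.of (Sum.inl e)
  let δ : C × Bool → FreeGroup ((C × Bool) ⊕ {r : D.Region // r ≠ outer}) := fun e =>
    ε e * (ρ (D.left e) * (ρ (D.right e))⁻¹)⁻¹
  let t₁ : C → FreeGroup ((C × Bool) ⊕ {r : D.Region // r ≠ outer}) := fun c =>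
    ε (D.next (c, true)) * (ε (c, true))⁻¹
  let t₂ : {c // c ≠ X} → FreeGroup ((C × Bool) ⊕ {r : D.Region // r ≠ outer}) := fun c =>
    ε (D.toNW c) * ε (D.toNE c) * (ε (D.fromSE c))⁻¹ * (ε (D.fromSW c))⁻¹
  let κ : {r : D.Region // r ≠ outer} → FreeGroup ((C × Bool) ⊕ {r : D.Region // r ≠ outer}) :=
    fun r => FreeGroup.of (Sum.inr r) * (FreeGroup.map Sum.inl (W r))⁻¹
  let relE : C ⊕ {c // c ≠ X} → FreeGroup (C × Bool) := (D.edgePresentation X).rel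
  let relP : C → FreeGroup {r : D.Region // r ≠ outer} := (D.regionPresentation outer).rel
  let ρ' : D.Region → FreeGroup ({r : D.Region // r ≠ outer} ⊕ (C × Bool)) := fun r =>
    FreeGroup.map Sum.inl (regionGen outer r)
  let ε' : C × Bool → FreeGroup ({r : D.Region // r ≠ outer} ⊕ (C × Bool)) := fun e =>
    FreeGroup.of (Sum.inr e)
  let δ' : C × Bool → FreeGroup ({r : D.Region // r ≠ outer} ⊕ (C × Bool)) := fun e =>
    ε' e * (ρ' (D.left e) * (ρ' (D.right e))⁻¹)⁻¹
  let t₁' : C → FreeGroup ({r : D.Region // r ≠ outer} ⊕ (C × Bool)) := fun c =>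
    ε' (D.next (c, true)) * (ε' (c, true))⁻¹
  have hρ₀ : ρ outer = 1 := by simp only [ρ, regionGen_outer, map_one]
  have hρ : ∀ r : {r : D.Region // r ≠ outer}, ρ r = FreeGroup.of (Sum.inr r) := by
    intro r
    simp only [ρ, regionGen_of, FreeGroup.map.of]
  let swap := Equiv.sumComm (C × Bool) {r : D.Region // r ≠ outer}
  have hswap : ∀ e, FreeGroup.map swap (δ e) = δ' e := by
    intro e
    simp only [δ, δ', ε, ε', ρ, ρ', map_mul, map_inv, FreeGroup.map.comp, FreeGroup.map.of]
    rfl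
  let q₁ : FreeGroup ({r : D.Region // r ≠ outer} ⊕ (C × Bool)) →* Γ :=
    FreeGroup.lift (Sum.elim (fun r => q (FreeGroup.of r))
      fun e => q (regionGen outer (D.left e) * (regionGen outer (D.right e))⁻¹))
  let q₂ : FreeGroup ((C × Bool) ⊕ {r : D.Region // r ≠ outer}) →* Γ :=
    q₁.comp (FreeGroup.map swap)
  have hq₁ : q₁.comp (FreeGroup.map Sum.inl) = q := by
    ext r
    simp [q₁]
  have hq₂ : q₂.comp (FreeGroup.map Sum.inl) = D.edgeHom outer q := by
    ext e
    simp [q₂, q₁, swap, edgeHom]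
  -- Both sides are potentials on the dual tree, with the same value at the root and the same
  -- quotients along tree edges.
  have hqW : ∀ u, q (regionGen outer u) = D.edgeHom outer q (W u) := by
    refine T'.potential_unique (by simp only [regionGen_outer, hW₀, map_one]) fun r => ?_
    rw [← map_inv, ← map_inv, ← map_mul, ← map_mul, hW]
    simp [edgeHom]
  -- add the regions to the edge presentation
  have hA : Related (.ofRel relE) (D.edgeHom outer q)
      (.ofRel (Sum.elim (Sum.elim t₁ t₂) κ)) q₂ := by
    refine (Related.ofRel_adjoin (r := relE)
      (fun r : {r : D.Region // r ≠ outer} => W r) ?_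
      (fun r => rfl) q₂ fun r => ?_).congr_hom hq₂ rfl
    · rintro (c | c)
      · simp [relE, edgePresentation, t₁, ε]
      · simp [relE, edgePresentation, t₂, ε]
    · have h := hqW r
      rw [regionGen_of, ← hq₂] at h
      refine Eq.trans ?_ h
      simp [q₂, q₁, swap]
  -- replace the definitions of the regions by those of edges in the dual tree
  have hB : Related (.ofRel (Sum.elim (Sum.elim t₁ t₂) κ)) q₂
      (.ofRel (Sum.elim (Sum.elim t₁ t₂) fun r => δ (T'.p r))) q₂ := by
    -- With depth as rank, the definition of the parent region is available at `r`.
    refine Related.ofRel_change q₂ _ _ (Sum.elim (fun _ => 0) fun r => T'.d r) ?_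
    rintro (i | r)
    · exact ⟨1, fun H _ π _ => Or.inl (by simp)⟩
    · have hlow : ∀ (H : Type) [Group H]
          (π : FreeGroup ((C × Bool) ⊕ {r : D.Region // r ≠ outer}) →* H),
          (∀ u : {r : D.Region // r ≠ outer}, T'.d u < T'.d r →
            π (FreeGroup.of (Sum.inr u) * (FreeGroup.map Sum.inl (W u))⁻¹) = 1) →
          ∀ u, T'.d u < T'.d r → π (ρ u) = π (FreeGroup.map Sum.inl (W u)) := by
        intro H _ π hπ u hu
        by_cases hr : u = outer
        · rw [hr, hρ₀, hW₀, map_one, map_one, map_one]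
        · have h := hπ ⟨u, hr⟩ hu
          rw [map_mul, map_inv, mul_inv_eq_one, ← hρ] at h
          exact h
      have hWr : ∀ (H : Type) [Group H]
          (π : FreeGroup ((C × Bool) ⊕ {r : D.Region // r ≠ outer}) →* H),
          π (ε (T'.p r)) = π (FreeGroup.map Sum.inl (W (D.left (T'.p r)))) *
            (π (FreeGroup.map Sum.inl (W (D.right (T'.p r)))))⁻¹ := by
        intro H _ π
        rw [← map_inv, ← map_inv, ← map_mul, ← map_mul, hW]
        simp [ε]
      rcases T'.prop r with ⟨h₁, h₂⟩ | ⟨h₁, h₂⟩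
      -- If `r` is to the left of its edge, `δ` reduces to the inverse of `κ r`; if it is to the
      -- right, to the conjugate of `κ r` by the edge.
      · refine ⟨1, fun H _ π hπ => Or.inr ?_⟩
        have hR := hlow H π (fun u hu => hπ (Sum.inr u) hu) _ h₂
        have hE := hWr H π
        rw [h₁] at hE
        simp only [Sum.elim_inr, δ, map_mul, map_inv, hE, hR, h₁, hρ, κ, map_one]
        group
      · refine ⟨ε (T'.p r), fun H _ π hπ => Or.inl ?_⟩
        have hR := hlow H π (fun u hu => hπ (Sum.inr u) hu) _ h₂
        have hE := hWr H π
        rw [h₁] at hE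
        simp only [Sum.elim_inr, δ, map_mul, map_inv, hE, hR, h₁, hρ, κ]
        group
  -- replace the relations at crossings by definitions of edges in the tree
  have hC : Related (.ofRel (Sum.elim (Sum.elim t₁ fun c => δ (T.p c)) fun r => δ (T'.p r))) q₂
      (.ofRel (Sum.elim (Sum.elim t₁ t₂) fun r => δ (T'.p r))) q₂ := by
    -- Deeper crossings get lower rank and dual tree edges rank zero, so at `c` the relators `δ` for
    -- all edges except the one to the parent are available.
    refine Related.ofRel_change q₂ _ _
      (Sum.elim (Sum.elim (fun _ => 0) fun c => 1 + (B - T.d c)) fun r => 0) ?_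
    rintro ((i | c) | r)
    · exact ⟨1, fun H _ π _ => Or.inl (by simp)⟩
    · have hδ : ∀ (H : Type) [Group H]
          (π : FreeGroup ((C × Bool) ⊕ {r : D.Region // r ≠ outer}) →* H),
          (∀ j, Sum.elim (Sum.elim (fun _ : C => 0) fun c : {c // c ≠ X} => 1 + (B - T.d c))
              (fun _ : {r // r ≠ outer} => 0) j < 1 + (B - T.d c) →
            π (Sum.elim (Sum.elim t₁ fun c => δ (T.p c)) (fun r => δ (T'.p r)) j) = 1) →
          ∀ e, (D.source e = (c : C) ∨ e.1 = (c : C)) → e ≠ T.p c →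
            π (ε e) = π (ρ (D.left e)) * (π (ρ (D.right e)))⁻¹ := by
        intro H _ π hπ e he hne
        have h : π (δ e) = 1 := by
          obtain ⟨r | c', rfl⟩ := (tree_bijective T T').2 e
          · exact hπ (Sum.inr r) (by simp)
          · have hlt := T.lt_of_incident c' he fun h => hne (congrArg T.p (Subtype.ext h))
            have hle := hBd ⟨(c' : C), rfl⟩
            refine hπ (Sum.inl (Sum.inr c')) ?_
            simp only [Sum.elim_inl, Sum.elim_inr]
            omega
        rwa [map_mul, map_inv, mul_inv_eq_one, map_mul, map_inv] at h
      have hNW : D.source (D.toNW c) = (c : C) := D.source_next _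
      have hNE : D.source (D.toNE c) = (c : C) := D.source_next _
      -- The relator `t₂` telescopes on the other three edges. The fourth occurs positively at NW
      -- and NE and inversely at SE and SW, which decides the sign; the prefix in front of it
      -- supplies the conjugating word.
      rcases D.corner_cases ((T.prop c).imp And.left And.left) (T.not_loop c) with
        ⟨h, h₁, h₂, h₃⟩ | ⟨h, h₁, h₂, h₃⟩ | ⟨h, h₁, h₂, h₃⟩ | ⟨h, h₁, h₂, h₃⟩
      · refine ⟨1, fun H _ π hπ => Or.inl ?_⟩
        have k₁ := hδ H π hπ _ (Or.inl hNE) h₁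
        have k₂ := hδ H π hπ _ (Or.inr rfl) h₂
        have k₃ := hδ H π hπ _ (Or.inr rfl) h₃
        simp only [Sum.elim_inl, Sum.elim_inr, t₂, δ, h, map_mul, map_inv, map_one, k₁, k₂, k₃,
          right_toNW, right_toNE, left_fromSE, left_fromSW]
        group
      · refine ⟨ρ (D.left (D.toNW c)) * (ρ (D.left (D.toNE c)))⁻¹, fun H _ π hπ => Or.inl ?_⟩
        have k₁ := hδ H π hπ _ (Or.inl hNW) h₁
        have k₂ := hδ H π hπ _ (Or.inr rfl) h₂
        have k₃ := hδ H π hπ _ (Or.inr rfl) h₃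
        simp only [Sum.elim_inl, Sum.elim_inr, t₂, δ, h, map_mul, map_inv, k₁, k₂, k₃,
          right_toNW, right_toNE, left_fromSE, left_fromSW]
        group
      · refine ⟨ρ (D.left (D.toNW c)) * (ρ (D.right (D.fromSW c)))⁻¹, fun H _ π hπ => Or.inr ?_⟩
        have k₁ := hδ H π hπ _ (Or.inl hNW) h₁
        have k₂ := hδ H π hπ _ (Or.inl hNE) h₂
        have k₃ := hδ H π hπ _ (Or.inr rfl) h₃
        simp only [Sum.elim_inl, Sum.elim_inr, t₂, δ, h, map_mul, map_inv, k₁, k₂, k₃,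
          right_toNW, right_toNE, left_fromSE, left_fromSW]
        group
      · refine ⟨1, fun H _ π hπ => Or.inr ?_⟩
        have k₁ := hδ H π hπ _ (Or.inl hNW) h₁
        have k₂ := hδ H π hπ _ (Or.inl hNE) h₂
        have k₃ := hδ H π hπ _ (Or.inr rfl) h₃
        simp only [Sum.elim_inl, Sum.elim_inr, t₂, δ, h, map_mul, map_inv, map_one, k₁, k₂, k₃,
          right_toNW, right_toNE, left_fromSE, left_fromSW]
        group
    · exact ⟨1, fun H _ π _ => Or.inl (by simp)⟩
  -- the definitions of all edges
  have hD : Related (.ofRel (Sum.elim (Sum.elim t₁ fun c => δ (T.p c)) fun r => δ (T'.p r))) q₂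
      (.ofRel (Sum.elim t₁' δ')) q₁ := by
    -- The edges of the two trees together enumerate all edges, so the two families of `δ` merge
    -- into one.
    refine Related.ofRel_relabel swap ((Equiv.sumAssoc _ _ _).trans
      ((Equiv.refl C).sumCongr ((Equiv.sumComm _ _).trans
        (Equiv.ofBijective _ (tree_bijective T T'))))) ?_ q₁
    rintro ((c | c) | r)
    · simp [t₁, t₁', ε, ε', swap]
    · exact (hswap _).symm
    · exact (hswap _).symm
  -- the region presentation with the edges added
  have hE : Related (.ofRel relP) q
      (.ofRel (Sum.elim (fun c => FreeGroup.map Sum.inl (relP c)) δ')) q₁ := by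
    refine (Related.ofRel_adjoin (r := relP)
      (fun e => regionGen outer (D.left e) * (regionGen outer (D.right e))⁻¹) (fun c => rfl)
      (fun e => ?_) q₁ fun e => ?_).congr_hom hq₁ rfl
    · simp only [Sum.elim_inr, δ', ε', ρ', map_mul, map_inv]
    · rw [← MonoidHom.comp_apply, hq₁]
      simp [q₁]
  -- Substituting `ε = ρ_L ρ_R⁻¹` in the type 1 relator gives the region relator itself.
  have hF : Related (.ofRel (Sum.elim (fun c => FreeGroup.map Sum.inl (relP c)) δ')) q₁ (.ofRel (Sum.elim t₁' δ')) q₁ := by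
    refine Related.ofRel_change q₁ _ _ (Sum.elim (fun _ => 1) fun _ => 0) ?_
    rintro (c | e)
    · refine ⟨1, fun H _ π hπ => Or.inl ?_⟩
      have hδ : ∀ e, π (ε' e) = π (ρ' (D.left e)) * (π (ρ' (D.right e)))⁻¹ := by
        intro e
        have h := hπ (Sum.inr e) Nat.zero_lt_one
        rwa [Sum.elim_inr, map_mul, map_inv, mul_inv_eq_one, map_mul, map_inv] at h
      have hr : FreeGroup.map Sum.inl (relP c) =
          ρ' (D.left (D.next (c, true))) * (ρ' (D.right (D.next (c, true))))⁻¹ *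
            ρ' (D.right (c, true)) * (ρ' (D.left (c, true)))⁻¹ := by
        simp only [ρ', ← map_inv, ← map_mul]
        rfl
      simp only [Sum.elim_inl, t₁', hr, map_mul, map_inv, map_one, hδ]
      group
    · exact ⟨1, fun H _ π _ => Or.inl (by simp)⟩
  exact hA.trans (hB.trans (hC.symm.trans (hD.trans (hF.symm.trans hE.symm))))

end KnotDiagram

/-! ### The Wirtinger presentation against the edge presentation -/

namespace KnotDiagram

open CrossingData Presentation

variable {C Γ : Type} [Group Γ] [Finite C] (D : KnotDiagram C)

/-- Left-handed edge loops are inverse to right-handed arc loops. With arcs and edges both present,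
the relators `γ e : ε e = (x (arc e))⁻¹` replace the type 1 relators and the definitions of the
arcs. -/
theorem wirtinger_related_edge (Y : C) (q : FreeGroup D.Arc →* Γ) (qE : FreeGroup (C × Bool) →* Γ)
    (hq : ∀ e, qE (FreeGroup.of e) = (q (FreeGroup.of (D.arc e)))⁻¹) :
    Related (D.wirtingerPresentation Y) q (D.edgePresentation Y) qE := by
  obtain ⟨k, start, hk, hstart, harc⟩ := D.exists_arcStart Y
  obtain ⟨B, hBd⟩ := (Set.finite_range k).bddAbove
  let first : D.Arc → C × Bool := fun a => D.next (start a, false)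
  -- An edge either follows an over passage or is the first edge of its arc.
  have hbij : Function.Bijective (Sum.elim (fun c => D.next (c, true)) first) := by
    constructor
    · rintro (c | a) (c' | a') h
      · simpa using h
      · simp [first] at h
      · simp [first] at h
      · have h' : start a = start a' := by simpa [first] using h
        have h'' : a = a' := by rw [← harc a, ← harc a', h']
        rw [h'']
    · intro e
      obtain ⟨⟨c, b⟩, rfl⟩ := D.next.surjective e
      cases b
      · exact ⟨Sum.inr (D.arc (D.next (c, false))), by simp [first, hstart]⟩
      · exact ⟨Sum.inl c, rfl⟩
  -- words in the generators of edges and arcs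
  let ε : C × Bool → FreeGroup ((C × Bool) ⊕ D.Arc) := fun e => FreeGroup.of (Sum.inl e)
  let x : D.Arc → FreeGroup ((C × Bool) ⊕ D.Arc) := fun a => FreeGroup.of (Sum.inr a)
  let γ : C × Bool → FreeGroup ((C × Bool) ⊕ D.Arc) := fun e => ε e * ((x (D.arc e))⁻¹)⁻¹
  let κ : D.Arc → FreeGroup ((C × Bool) ⊕ D.Arc) := fun a => x a * ((ε (first a))⁻¹)⁻¹
  let t₁ : C → FreeGroup ((C × Bool) ⊕ D.Arc) := fun c => ε (D.next (c, true)) * (ε (c, true))⁻¹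
  let t₂ : {c // c ≠ Y} → FreeGroup ((C × Bool) ⊕ D.Arc) := fun c =>
    ε (D.toNW c) * ε (D.toNE c) * (ε (D.fromSE c))⁻¹ * (ε (D.fromSW c))⁻¹
  let relE : C ⊕ {c // c ≠ Y} → FreeGroup (C × Bool) := (D.edgePresentation Y).rel
  let relW : {c // c ≠ Y} → FreeGroup D.Arc := (D.wirtingerPresentation Y).rel
  let w : {c // c ≠ Y} → FreeGroup ((C × Bool) ⊕ D.Arc) := fun c => FreeGroup.map Sum.inr (relW c)
  have hw : ∀ c : {c // c ≠ Y}, w c = if D.positive c then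
      (x (D.arc (c, true)))⁻¹ * x (D.arc (c, false)) * x (D.arc (c, true)) *
        (x (D.arc (D.next (c, false))))⁻¹
      else x (D.arc (c, true)) * x (D.arc (c, false)) * (x (D.arc (c, true)))⁻¹ *
        (x (D.arc (D.next (c, false))))⁻¹ := by
    intro c
    have h : relW c = if D.positive c then
      (FreeGroup.of (D.arc (c, true)))⁻¹ * FreeGroup.of (D.arc (c, false)) *
        FreeGroup.of (D.arc (c, true)) * (FreeGroup.of (D.arc (D.next (c, false))))⁻¹
      else FreeGroup.of (D.arc (c, true)) * FreeGroup.of (D.arc (c, false)) *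
        (FreeGroup.of (D.arc (c, true)))⁻¹ * (FreeGroup.of (D.arc (D.next (c, false))))⁻¹ := rfl
    simp only [w, h]
    split_ifs <;> simp only [map_mul, map_inv, FreeGroup.map.of, x]
  let swap := Equiv.sumComm (C × Bool) D.Arc
  let q₁ : FreeGroup ((C × Bool) ⊕ D.Arc) →* Γ :=
    FreeGroup.lift (Sum.elim (fun e => qE (FreeGroup.of e)) fun a => q (FreeGroup.of a))
  let q₂ : FreeGroup (D.Arc ⊕ (C × Bool)) →* Γ := q₁.comp (FreeGroup.map swap.symm)
  have hq₁ : q₁.comp (FreeGroup.map Sum.inl) = qE := by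
    ext e
    simp [q₁]
  have hq₂ : q₂.comp (FreeGroup.map Sum.inl) = q := by
    ext a
    simp [q₂, q₁, swap]
  have hq₂' : q₂.comp (FreeGroup.map swap) = q₁ := by
    ext i
    simp [q₂]
  -- add the arcs to the edge presentation
  have hA : Related (.ofRel relE) qE (.ofRel (Sum.elim (Sum.elim t₁ t₂) κ)) q₁ := by
    refine (Related.ofRel_adjoin (r := relE) (fun a => (FreeGroup.of (first a))⁻¹) ?_
      (fun a => ?_) q₁ fun a => ?_).congr_hom hq₁ rfl
    · rintro (c | c)
      · simp [relE, edgePresentation, t₁, ε]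
      · simp [relE, edgePresentation, t₂, ε]
    · simp [κ, x, ε]
    · simp [q₁, hq, first, harc]
  -- identify the edges with their arcs
  have hγ : ∀ e, ∃ i, Sum.elim (Sum.elim (fun c => γ (D.next (c, true))) w)
      (fun a => γ (first a)) i = γ e ∧
      Sum.elim (Sum.elim (fun c => k (D.next (c, true))) fun _ => B + 1) (fun _ => 0) i ≤ k e := by
    intro e
    obtain ⟨c | a, rfl⟩ := hbij.2 e
    · exact ⟨Sum.inl (Sum.inl c), rfl, le_rfl⟩
    · exact ⟨Sum.inr a, rfl, Nat.zero_le _⟩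
  have hB : Related (.ofRel (Sum.elim (Sum.elim (fun c => γ (D.next (c, true))) w)
      fun a => γ (first a))) q₁ (.ofRel (Sum.elim (Sum.elim t₁ t₂) κ)) q₁ := by
    -- The rank is the position in the arc, so the preceding edge is already identified with its
    -- arc. Rank `B + 1` places the Wirtinger relators above all these identifications.
    refine Related.ofRel_change q₁ _ _
      (Sum.elim (Sum.elim (fun c => k (D.next (c, true))) fun _ => B + 1) fun _ => 0) ?_
    have hπγ : ∀ (H : Type) [Group H] (π : FreeGroup ((C × Bool) ⊕ D.Arc) →* H) (n : ℕ),
        (∀ j, Sum.elim (Sum.elim (fun c => k (D.next (c, true))) fun _ => B + 1) (fun _ => 0) j <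
          n → π (Sum.elim (Sum.elim (fun c => γ (D.next (c, true))) w) (fun a => γ (first a)) j) =
            1) → ∀ e, k e < n → π (ε e) = (π (x (D.arc e)))⁻¹ := by
      intro H _ π n hπ e he
      obtain ⟨i, hi, hle⟩ := hγ e
      have h := hπ i (lt_of_le_of_lt hle he)
      rwa [hi, map_mul, inv_inv, mul_eq_one_iff_eq_inv] at h
    rintro ((c | c) | a)
    · refine ⟨1, fun H _ π hπ => Or.inl ?_⟩
      have h := hπγ H π _ hπ (c, true) (by simp only [Sum.elim_inl, hk]; omega)
      simp only [Sum.elim_inl, t₁, γ, map_mul, map_inv, map_one, h, arc_next_true]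
      group
    · have hlow : ∀ (H : Type) [Group H] (π : FreeGroup ((C × Bool) ⊕ D.Arc) →* H),
          (∀ j, Sum.elim (Sum.elim (fun c => k (D.next (c, true))) fun _ => B + 1) (fun _ => 0) j <
          B + 1 → π (Sum.elim (Sum.elim (fun c => γ (D.next (c, true))) w)
            (fun a => γ (first a)) j) = 1) → ∀ e, π (ε e) = (π (x (D.arc e)))⁻¹ :=
        fun H _ π hπ e => hπγ H π _ hπ e (Nat.lt_succ_of_le (hBd ⟨e, rfl⟩))
      -- After `ε = x⁻¹`, the type 2 relator reads `v⁻¹ x⁻¹ u x` at a positive and `x⁻¹ v⁻¹ x u` at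
      -- a negative crossing: a cyclic rotation of the Wirtinger relator.
      cases hp : D.positive c
      · refine ⟨(x (D.arc (c, true)) * x (D.arc (c, false)))⁻¹, fun H _ π hπ => Or.inl ?_⟩
        have h := hlow H π hπ
        simp only [Sum.elim_inl, Sum.elim_inr, t₂, hw, hp, toNW, toNE, fromSE, fromSW, Bool.not_false,
          map_mul, map_inv, h, arc_next_true, Bool.false_eq_true, if_false]
        group
      · refine ⟨(x (D.arc (D.next (c, false))))⁻¹, fun H _ π hπ => Or.inl ?_⟩
        have h := hlow H π hπ
        simp only [Sum.elim_inl, Sum.elim_inr, t₂, hw, hp, toNW, toNE, fromSE, fromSW, Bool.not_true,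
          map_mul, map_inv, h, arc_next_true, if_true]
        group
    · refine ⟨(ε (first a))⁻¹, fun H _ π _ => Or.inl (congrArg π ?_)⟩
      simp only [Sum.elim_inr, κ, γ, first, harc]
      group
  -- the Wirtinger presentation with the edges added
  have hC : Related (.ofRel (Sum.elim (Sum.elim (fun c => γ (D.next (c, true))) w)
      fun a => γ (first a))) q₁ (.ofRel (Sum.elim (fun c => FreeGroup.map Sum.inl (relW c))
        fun e => FreeGroup.of (Sum.inr e) *
          (FreeGroup.map Sum.inl (FreeGroup.of (D.arc e))⁻¹)⁻¹)) q₂ := by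
    refine (Related.ofRel_relabel swap (((Equiv.sumComm _ _).sumCongr (Equiv.refl _)).trans
      ((Equiv.sumAssoc _ _ _).trans ((Equiv.refl _).sumCongr (Equiv.ofBijective _ hbij)))) ?_
        q₂).congr_hom hq₂' rfl
    have hswap : ∀ e, FreeGroup.map swap (γ e) = FreeGroup.of (Sum.inr e) *
          (FreeGroup.map Sum.inl (FreeGroup.of (D.arc e))⁻¹)⁻¹ := by
      intro e
      simp [γ, ε, x, swap]
    rintro ((c | c) | a)
    · exact (hswap _).symm
    · refine Eq.trans ?_ (FreeGroup.map.comp _ _ _).symm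
      rfl
    · exact (hswap _).symm
  have hD : Related (.ofRel relW) q (.ofRel (Sum.elim (fun c => FreeGroup.map Sum.inl (relW c))
        fun e => FreeGroup.of (Sum.inr e) *
          (FreeGroup.map Sum.inl (FreeGroup.of (D.arc e))⁻¹)⁻¹)) q₂ := by
    refine (Related.ofRel_adjoin (r := relW) (fun e => (FreeGroup.of (D.arc e))⁻¹) (fun c => rfl)
      (fun e => rfl) q₂ fun e => ?_).congr_hom hq₂ rfl
    simp [q₂, q₁, swap, hq]
  exact hD.trans (hC.symm.trans (hB.trans hA.symm))

/-- The homomorphism from the free group on the arcs with the prescribed values on edges. -/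
theorem exists_arcHom (outer : D.Region) (q : FreeGroup {r : D.Region // r ≠ outer} →* Γ)
    (hq : ∀ c, q ((D.regionPresentation outer).rel c) = 1) :
    ∃ qW : FreeGroup D.Arc →* Γ,
      ∀ e, D.edgeHom outer q (FreeGroup.of e) = (qW (FreeGroup.of (D.arc e)))⁻¹ := by
  refine ⟨FreeGroup.lift (Quot.lift (fun e => (D.edgeHom outer q (FreeGroup.of e))⁻¹) ?_),
    fun e => ?_⟩
  · rintro _ _ ⟨c⟩
    -- The region relator at `c` says that the two over edges at `c` have the same value.
    have h : q (regionGen outer (D.left (D.next (c, true))) *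
      (regionGen outer (D.right (D.next (c, true))))⁻¹ *
      regionGen outer (D.right (c, true)) * (regionGen outer (D.left (c, true)))⁻¹) = 1 := hq c
    rw [map_mul, map_mul, map_inv, mul_inv_eq_one] at h
    simp only [edgeHom, FreeGroup.lift_apply_of, inv_inj]
    rw [map_mul, map_inv, ← h, mul_inv_cancel_right]
  · refine (inv_inv _).symm.trans (congrArg _ ?_)
    exact (FreeGroup.lift_apply_of (f := (Quot.lift (fun e => (D.edgeHom outer q
      (FreeGroup.of e))⁻¹) _ : D.Arc → Γ)) (x := D.arc e)).symm

theorem wirtinger_related_region (X : C) (outer : D.Region)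
    (q : FreeGroup {r : D.Region // r ≠ outer} →* Γ)
    (hq : ∀ c, q ((D.regionPresentation outer).rel c) = 1) :
    ∃ qW : FreeGroup D.Arc →* Γ,
      Related (D.wirtingerPresentation X) qW (D.regionPresentation outer) q ∧
      ∀ e, qW (FreeGroup.of (D.arc e)) =
        q (regionGen outer (D.right e) * (regionGen outer (D.left e))⁻¹) := by
  obtain ⟨qW, h⟩ := D.exists_arcHom outer q hq
  refine ⟨qW, (D.wirtinger_related_edge X qW _ h).trans (D.edge_related_region X outer q),
    fun e => ?_⟩
  rw [← inv_inv (qW _), ← h e]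
  simp [edgeHom]

end KnotDiagram

/-! ## Simple equivalences from Q** transformations -/

/-- As `q` presents the group of `Q`, it factors through an isomorphism `θ` from the group of `P`.
The complex of `P` over `q` is then the one over `θ ∘ P.proj` by definition. -/
theorem Related.exists_simpleEquivalence {P Q : Presentation} {q : FreeGroup P.gens →* Q.Grp}
    (h : Related P q Q Q.proj) :
    ∃ E : SimpleEquivalence P Q, ∀ w, E.θ (P.proj w) = q w := by
  have hP : P.Presents q := h.presents_iff.2 Q.presents_proj
  let f : P.Grp →* Q.Grp := QuotientGroup.lift (Subgroup.normalClosure (Set.range P.rel)) q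
    fun w hw => by rwa [← hP.2] at hw
  have hf : ∀ w, f (P.proj w) = q w := fun w => rfl
  have hbij : Function.Bijective f := by
    constructor
    · rw [injective_iff_map_eq_one]
      intro a ha
      obtain ⟨w, rfl⟩ := QuotientGroup.mk_surjective a
      have hw : w ∈ q.ker := ha
      rw [hP.2] at hw
      exact (QuotientGroup.eq_one_iff w).2 hw
    · intro b
      obtain ⟨w, rfl⟩ := hP.1 b
      exact ⟨P.proj w, rfl⟩
  obtain ⟨a, b, F₁, F₂, h₁, h₂, e₁, e₂⟩ := h.simple hP
  exact ⟨⟨MulEquiv.ofBijective f hbij, a, b, F₁, F₂, h₁, h₂, e₁, e₂⟩, fun w => rfl⟩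

/-! ## The diagram without crossings -/

/-- If the right region is outer, `x` must go to `ρ_L⁻¹`, so the only generator is inverted; there
are no relators to follow. -/
theorem circle_related (outer : Bool) :
    ∃ q : FreeGroup Unit →* (circleRegion outer).Grp,
      Related circleWirtinger q (circleRegion outer) (circleRegion outer).proj ∧
      q (FreeGroup.of ()) =
        (circleRegion outer).proj (regionGen outer false * (regionGen outer true)⁻¹) := by
  have hu : ∀ b : {r : Bool // r ≠ outer}, (⟨!outer, by simp⟩ : {r : Bool // r ≠ outer}) = b := by
    rintro ⟨b, hb⟩
    refine Subtype.ext ?_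
    cases b <;> cases outer <;> simp_all
  let e : Unit ≃ {r : Bool // r ≠ outer} :=
    ⟨fun _ => ⟨!outer, by simp⟩, fun _ => (), fun _ => rfl, fun b => hu b⟩
  have h := fun q : FreeGroup {r : Bool // r ≠ outer} →* (circleRegion outer).Grp =>
    Related.relabel (P := circleWirtinger) (Q := circleRegion outer) e (Equiv.refl Empty)
      (fun i => i.elim) q
  cases outer
  · have h' := Related.applyHom_invAut (circleRegion false) ⟨true, by simp⟩
      (circleRegion false).proj
    have hr : Related ((circleRegion false).applyHom
        (Related.invAut (circleRegion false) ⟨true, by simp⟩).toMonoidHom) (circleRegion false).proj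
        (circleRegion false) (circleRegion false).proj :=
      Related.withRel_congr (circleRegion false) _ (funext fun i => i.elim)
    refine ⟨_, (h _).trans (h'.trans hr), ?_⟩
    have e₁ : regionGen false false = 1 := regionGen_outer _
    have e₂ : regionGen false true = FreeGroup.of ⟨true, by simp⟩ :=
      regionGen_of false ⟨true, by simp⟩
    rw [e₁, e₂, one_mul]
    refine congrArg (circleRegion false).proj ?_
    exact (congrArg (Related.invAut (circleRegion false) ⟨true, by simp⟩) FreeGroup.map.of).trans
      ((circleRegion false).substHom_self (e ()) (FreeGroup.of (e ()))⁻¹)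
  · refine ⟨_, h _, ?_⟩
    have e₁ : regionGen true true = 1 := regionGen_outer _
    have e₂ : regionGen true false = FreeGroup.of ⟨false, by simp⟩ :=
      regionGen_of true ⟨false, by simp⟩
    rw [e₁, e₂, inv_one, mul_one]
    exact congrArg (circleRegion true).proj FreeGroup.map.of
/-! ## Change of basis -/

section BasisRatio

open Module

variable {ι κ μ V W : Type} [Fintype κ] [DecidableEq κ] [Fintype μ] [DecidableEq μ]
  [AddCommGroup V] [Module ℝ V] [AddCommGroup W] [Module ℝ W]

/-- Another matching of indices changes the determinant by the sign of a permutation, which the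
modulus removes. -/
theorem basisRatio_eq (a : Basis ι ℝ V) (b : Basis κ ℝ V) (e : ι ≃ κ) :
    basisRatio a b = |b.det (a.reindex e)| := by
  have h : (a.reindex e : κ → V) =
      (a.reindex (a.indexEquiv b) : κ → V) ∘ (e.symm.trans (a.indexEquiv b)) := by
    ext k
    simp
  rw [basisRatio, h, AlternatingMap.map_perm]
  rcases Int.units_eq_one_or (Equiv.Perm.sign (e.symm.trans (a.indexEquiv b))) with h | h <;>
    simp [h]

theorem basisRatio_self_index (a b : Basis κ ℝ V) : basisRatio a b = |(b.toMatrix a).det| := by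
  rw [basisRatio_eq a b (Equiv.refl κ), Basis.det_apply, Basis.reindex_refl]

theorem basisRatio_reindex_left {ι' : Type} (a : Basis ι ℝ V) (b : Basis κ ℝ V) (e : ι ≃ ι') :
    basisRatio (a.reindex e) b = basisRatio a b := by
  rw [basisRatio_eq (a.reindex e) b (e.symm.trans (a.indexEquiv b)), basisRatio]
  congr 2
  ext k
  simp

theorem basisRatio_reindex_right (a : Basis ι ℝ V) (b : Basis κ ℝ V) (e : κ ≃ μ) :
    basisRatio a (b.reindex e) = basisRatio a b := by
  rw [basisRatio_eq a (b.reindex e) ((a.indexEquiv b).trans e), basisRatio, Basis.det_reindex]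
  congr 2
  ext k
  simp

theorem basisRatio_mul (a : Basis ι ℝ V) (b : Basis κ ℝ V) (c : Basis μ ℝ V) :
    basisRatio a b * basisRatio b c = basisRatio a c := by
  rw [← basisRatio_reindex_left b c (b.indexEquiv c),
    ← basisRatio_reindex_right a b (b.indexEquiv c),
    ← basisRatio_reindex_left a c (a.indexEquiv c),
    ← basisRatio_reindex_left a (b.reindex _) (a.indexEquiv c), basisRatio_self_index,
    basisRatio_self_index, basisRatio_self_index, ← abs_mul, mul_comm, ← Matrix.det_mul,
    Basis.toMatrix_mul_toMatrix]

theorem basisRatio_pos (a : Basis ι ℝ V) (b : Basis κ ℝ V) : 0 < basisRatio a b :=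
  abs_pos.2 (b.isUnit_det _).ne_zero

theorem basisRatio_of_apply (a : Basis ι ℝ V) (b : Basis κ ℝ V) (e : ι ≃ κ)
    (h : ∀ i, a i = b (e i)) : basisRatio a b = 1 := by
  have hab : (a.reindex e : κ → V) = b := by
    ext k
    simp [h]
  rw [basisRatio_eq a b e, hab, Basis.det_self, abs_one]

theorem basisRatio_map (a : Basis ι ℝ V) (b : Basis κ ℝ V) (f : V ≃ₗ[ℝ] W) :
    basisRatio (a.map f) (b.map f) = basisRatio a b := by
  rw [basisRatio_eq (a.map f) (b.map f) (a.indexEquiv b), basisRatio, Basis.det_map]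
  congr 2
  ext k
  simp

theorem basisRatio_prod (a : Basis ι ℝ V) (b : Basis κ ℝ V) (w : Basis μ ℝ W) :
    basisRatio (a.prod w) (b.prod w) = basisRatio a b := by
  rw [basisRatio_eq (a.prod w) (b.prod w) ((a.indexEquiv b).sumCongr (Equiv.refl μ)), basisRatio,
    Basis.det_apply, Basis.det_apply]
  have h : (b.prod w).toMatrix ((a.prod w).reindex ((a.indexEquiv b).sumCongr (Equiv.refl μ))) =
      Matrix.fromBlocks (b.toMatrix (a.reindex (a.indexEquiv b))) 0 0 1 := by
    ext (i | i) (j | j) <;>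
      simp [Basis.toMatrix_apply, Matrix.one_apply, Finsupp.single_apply, eq_comm]
  rw [h, Matrix.det_fromBlocks_zero₂₁, Matrix.det_one, mul_one]

theorem basisRatio_map_self (b : Basis κ ℝ V) (f : V ≃ₗ[ℝ] V) :
    basisRatio (b.map f) b = |LinearMap.det (f : V →ₗ[ℝ] V)| := by
  rw [basisRatio_eq (b.map f) b (Equiv.refl κ), Basis.reindex_refl]
  have h : (b.map f : κ → V) = (f : V →ₗ[ℝ] V) ∘ b := by
    ext k
    simp
  rw [h, Basis.det_comp, Basis.det_self, mul_one]


end BasisRatio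
/-! ## Bases adapted to a cochain complex in degrees zero, one and two -/

section CochainBasis

open Module

variable {C₀ C₁ C₂ : Type} [AddCommGroup C₀] [Module ℝ C₀] [AddCommGroup C₁] [Module ℝ C₁]
  [AddCommGroup C₂] [Module ℝ C₂]

/-- Bases `(h₀, b₀)`, `(d b₀, h₁, b₁)`, `(d b₁, h₂)` of the terms of a cochain complex, with `h₀` and
`h₁` consisting of cocycles. -/
structure CochainBasis (d₀ : C₀ →ₗ[ℝ] C₁) (d₁ : C₁ →ₗ[ℝ] C₂) (N₀ N₁ N₂ M₀ M₁ : Type) where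
  B₀ : Basis (N₀ ⊕ M₀) ℝ C₀
  B₁ : Basis (M₀ ⊕ (N₁ ⊕ M₁)) ℝ C₁
  B₂ : Basis (M₁ ⊕ N₂) ℝ C₂
  closed₀ : ∀ i, d₀ (B₀ (Sum.inl i)) = 0
  closed₁ : ∀ i, d₁ (B₁ (Sum.inr (Sum.inl i))) = 0
  image₀ : ∀ j, B₁ (Sum.inl j) = d₀ (B₀ (Sum.inr j))
  image₁ : ∀ j, B₂ (Sum.inl j) = d₁ (B₁ (Sum.inr (Sum.inr j)))

namespace CochainBasis

variable {d₀ : C₀ →ₗ[ℝ] C₁} {d₁ : C₁ →ₗ[ℝ] C₂} {N₀ N₁ N₂ M₀ M₁ M₀' M₁' : Type}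

/-- The torsion relative to fixed bases of the cochain spaces. -/
noncomputable def torsion {κ₀ κ₁ κ₂ : Type} [Fintype κ₀] [DecidableEq κ₀] [Fintype κ₁]
    [DecidableEq κ₁] [Fintype κ₂] [DecidableEq κ₂] (S : CochainBasis d₀ d₁ N₀ N₁ N₂ M₀ M₁)
    (L₀ : Basis κ₀ ℝ C₀) (L₁ : Basis κ₁ ℝ C₁) (L₂ : Basis κ₂ ℝ C₂) : ℝ :=
  (basisRatio S.B₀ L₀)⁻¹ * basisRatio S.B₁ L₁ * (basisRatio S.B₂ L₂)⁻¹

/-- Rename the elements of `b₀` and `b₁`. -/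
noncomputable def reindex (S : CochainBasis d₀ d₁ N₀ N₁ N₂ M₀ M₁) (e₀ : M₀ ≃ M₀') (e₁ : M₁ ≃ M₁') :
    CochainBasis d₀ d₁ N₀ N₁ N₂ M₀' M₁' where
  B₀ := S.B₀.reindex ((Equiv.refl _).sumCongr e₀)
  B₁ := S.B₁.reindex (e₀.sumCongr ((Equiv.refl _).sumCongr e₁))
  B₂ := S.B₂.reindex (e₁.sumCongr (Equiv.refl _))
  closed₀ i := by simpa using S.closed₀ i
  closed₁ i := by simpa using S.closed₁ i
  image₀ j := by simpa using S.image₀ (e₀.symm j)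
  image₁ j := by simpa using S.image₁ (e₁.symm j)

section Repr

variable (S : CochainBasis d₀ d₁ N₀ N₁ N₂ M₀ M₁)

theorem repr_d₀_inl (x : C₀) (j : M₀) :
    S.B₁.repr (d₀ x) (Sum.inl j) = S.B₀.repr x (Sum.inr j) := by
  have h : (S.B₁.coord (Sum.inl j)) ∘ₗ d₀ = S.B₀.coord (Sum.inr j) := by
    classical
    refine S.B₀.ext fun i => ?_
    rcases i with i | i
    · simp [S.closed₀]
    · simp [← S.image₀, Finsupp.single_apply]
  exact LinearMap.congr_fun h x

theorem repr_d₀_inr (x : C₀) (j : N₁ ⊕ M₁) : S.B₁.repr (d₀ x) (Sum.inr j) = 0 := by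
  have h : (S.B₁.coord (Sum.inr j)) ∘ₗ d₀ = 0 := by
    refine S.B₀.ext fun i => ?_
    rcases i with i | i
    · simp [S.closed₀]
    · simp [← S.image₀]
  exact LinearMap.congr_fun h x

theorem d₁_inl (hd : ∀ x, d₁ (d₀ x) = 0) (j : M₀) : d₁ (S.B₁ (Sum.inl j)) = 0 := by
  rw [S.image₀, hd]

theorem repr_d₁_inl (hd : ∀ x, d₁ (d₀ x) = 0) (x : C₁) (j : M₁) :
    S.B₂.repr (d₁ x) (Sum.inl j) = S.B₁.repr x (Sum.inr (Sum.inr j)) := by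
  have h : (S.B₂.coord (Sum.inl j)) ∘ₗ d₁ = S.B₁.coord (Sum.inr (Sum.inr j)) := by
    classical
    refine S.B₁.ext fun i => ?_
    rcases i with i | i | i
    · simp [S.d₁_inl hd]
    · simp [S.closed₁]
    · simp [← S.image₁, Finsupp.single_apply]
  exact LinearMap.congr_fun h x

theorem repr_d₁_inr (hd : ∀ x, d₁ (d₀ x) = 0) (x : C₁) (j : N₂) :
    S.B₂.repr (d₁ x) (Sum.inr j) = 0 := by
  have h : (S.B₂.coord (Sum.inr j)) ∘ₗ d₁ = 0 := by
    refine S.B₁.ext fun i => ?_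
    rcases i with i | i | i
    · simp [S.d₁_inl hd]
    · simp [S.closed₁]
    · simp [← S.image₁]
  exact LinearMap.congr_fun h x

end Repr

/-- The change of basis is block triangular in each degree, with identity blocks on cohomology. The
block of `b₀` reappears on `d b₀`, and that of `b₁` on `d b₁`, so both cancel in the alternating
product. -/
theorem exists_ratio [Fintype N₀] [Fintype N₁] [Fintype N₂] [Fintype M₀] [Fintype M₁]
    [DecidableEq N₀] [DecidableEq N₁] [DecidableEq N₂] [DecidableEq M₀] [DecidableEq M₁]
    (hd : ∀ x, d₁ (d₀ x) = 0) (A B : CochainBasis d₀ d₁ N₀ N₁ N₂ M₀ M₁)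
    (h₀ : ∀ i, B.B₀ (Sum.inl i) = A.B₀ (Sum.inl i))
    (h₁ : ∀ i, ∃ y, B.B₁ (Sum.inr (Sum.inl i)) = A.B₁ (Sum.inr (Sum.inl i)) + d₀ y)
    (h₂ : ∀ i, ∃ y, B.B₂ (Sum.inr i) = A.B₂ (Sum.inr i) + d₁ y) :
    ∃ α β : ℝ, basisRatio B.B₀ A.B₀ = α ∧ basisRatio B.B₁ A.B₁ = α * β ∧
      basisRatio B.B₂ A.B₂ = β := by
  let α : Matrix M₀ M₀ ℝ := Matrix.of fun i j => A.B₀.repr (B.B₀ (Sum.inr j)) (Sum.inr i)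
  let β : Matrix M₁ M₁ ℝ :=
    Matrix.of fun i j => A.B₁.repr (B.B₁ (Sum.inr (Sum.inr j))) (Sum.inr (Sum.inr i))
  refine ⟨|α.det|, |β.det|, ?_, ?_, ?_⟩
  · rw [basisRatio_self_index]
    have h : A.B₀.toMatrix B.B₀ = Matrix.fromBlocks 1
        (Matrix.of fun i j => A.B₀.repr (B.B₀ (Sum.inr j)) (Sum.inl i)) 0 α := by
      ext (i | i) (j | j) <;> simp [Basis.toMatrix_apply, h₀, α, Matrix.one_apply,
        Finsupp.single_apply, eq_comm]
    rw [h, Matrix.det_fromBlocks_zero₂₁, Matrix.det_one, one_mul]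
  · rw [basisRatio_self_index]
    have h : A.B₁.toMatrix B.B₁ = Matrix.fromBlocks α
        (Matrix.of fun i j => A.B₁.repr (B.B₁ (Sum.inr j)) (Sum.inl i)) 0
        (Matrix.fromBlocks 1 (Matrix.of fun i j =>
          A.B₁.repr (B.B₁ (Sum.inr (Sum.inr j))) (Sum.inr (Sum.inl i))) 0 β) := by
      ext (i | i | i) (j | j | j)
      · simp [Basis.toMatrix_apply, B.image₀, A.repr_d₀_inl, α]
      · simp [Basis.toMatrix_apply]
      · simp [Basis.toMatrix_apply]
      · simp [Basis.toMatrix_apply, B.image₀, A.repr_d₀_inr]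
      · obtain ⟨y, hy⟩ := h₁ j
        simp [Basis.toMatrix_apply, hy, A.repr_d₀_inr, Matrix.one_apply, Finsupp.single_apply,
          eq_comm]
      · simp [Basis.toMatrix_apply]
      · simp [Basis.toMatrix_apply, B.image₀, A.repr_d₀_inr]
      · obtain ⟨y, hy⟩ := h₁ j
        simp [Basis.toMatrix_apply, hy, A.repr_d₀_inr]
      · simp [Basis.toMatrix_apply, β]
    rw [h, Matrix.det_fromBlocks_zero₂₁, Matrix.det_fromBlocks_zero₂₁, Matrix.det_one, one_mul,
      abs_mul]
  · rw [basisRatio_self_index]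
    have h : A.B₂.toMatrix B.B₂ = Matrix.fromBlocks β
        (Matrix.of fun i j => A.B₂.repr (B.B₂ (Sum.inr j)) (Sum.inl i)) 0 1 := by
      ext (i | i) (j | j)
      · simp [Basis.toMatrix_apply, B.image₁, A.repr_d₁_inl hd, β]
      · simp [Basis.toMatrix_apply]
      · simp [Basis.toMatrix_apply, B.image₁, A.repr_d₁_inr hd]
      · obtain ⟨y, hy⟩ := h₂ j
        simp [Basis.toMatrix_apply, hy, A.repr_d₁_inr hd, Matrix.one_apply, Finsupp.single_apply,
          eq_comm]
    rw [h, Matrix.det_fromBlocks_zero₂₁, Matrix.det_one, mul_one]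

section Torsion

variable {κ₀ κ₁ κ₂ : Type} [Fintype κ₀] [DecidableEq κ₀] [Fintype κ₁]
    [DecidableEq κ₁] [Fintype κ₂] [DecidableEq κ₂]

theorem torsion_reindex (S : CochainBasis d₀ d₁ N₀ N₁ N₂ M₀ M₁) (e₀ : M₀ ≃ M₀') (e₁ : M₁ ≃ M₁')
    (L₀ : Basis κ₀ ℝ C₀) (L₁ : Basis κ₁ ℝ C₁) (L₂ : Basis κ₂ ℝ C₂) :
    (S.reindex e₀ e₁).torsion L₀ L₁ L₂ = S.torsion L₀ L₁ L₂ := by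
  rw [torsion, torsion, reindex, basisRatio_reindex_left, basisRatio_reindex_left,
    basisRatio_reindex_left]

/-- The torsion depends only on the cohomology classes of `h₀`, `h₁`, `h₂`. -/
theorem torsion_eq [Finite N₀] [Finite N₁] [Finite N₂] [Finite M₀] [Finite M₁]
    [Finite M₀'] [Finite M₁'] (hd : ∀ x, d₁ (d₀ x) = 0) (A : CochainBasis d₀ d₁ N₀ N₁ N₂ M₀ M₁)
    (B : CochainBasis d₀ d₁ N₀ N₁ N₂ M₀' M₁')
    (h₀ : ∀ i, B.B₀ (Sum.inl i) = A.B₀ (Sum.inl i))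
    (h₁ : ∀ i, ∃ y, B.B₁ (Sum.inr (Sum.inl i)) = A.B₁ (Sum.inr (Sum.inl i)) + d₀ y)
    (h₂ : ∀ i, ∃ y, B.B₂ (Sum.inr i) = A.B₂ (Sum.inr i) + d₁ y)
    (L₀ : Basis κ₀ ℝ C₀) (L₁ : Basis κ₁ ℝ C₁) (L₂ : Basis κ₂ ℝ C₂) :
    B.torsion L₀ L₁ L₂ = A.torsion L₀ L₁ L₂ := by
  classical
  have := Fintype.ofFinite N₀
  have := Fintype.ofFinite N₁
  have := Fintype.ofFinite N₂
  have := Fintype.ofFinite M₀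
  have := Fintype.ofFinite M₁
  -- Counting in degree zero, then in degree one, shows that the families `b₀` and `b₁` have the
  -- same sizes on both sides.
  have c₀ := Nat.card_congr (B.B₀.indexEquiv A.B₀)
  have c₁ := Nat.card_congr (B.B₁.indexEquiv A.B₁)
  simp only [Nat.card_sum] at c₀ c₁
  obtain ⟨e₀⟩ : Nonempty (M₀' ≃ M₀) := Finite.card_eq.1 (by omega)
  obtain ⟨e₁⟩ : Nonempty (M₁' ≃ M₁) := Finite.card_eq.1 (by omega)
  rw [← B.torsion_reindex e₀ e₁]
  obtain ⟨α, β, r₀, r₁, r₂⟩ := exists_ratio hd A (B.reindex e₀ e₁)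
    (fun i => by simpa [reindex] using h₀ i) (fun i => by simpa [reindex] using h₁ i)
    (fun i => by simpa [reindex] using h₂ i)
  have hα : α ≠ 0 := r₀ ▸ (basisRatio_pos _ _).ne'
  have hβ : β ≠ 0 := r₂ ▸ (basisRatio_pos _ _).ne'
  rw [torsion, torsion, ← basisRatio_mul _ A.B₀ L₀, ← basisRatio_mul _ A.B₁ L₁,
    ← basisRatio_mul _ A.B₂ L₂, r₀, r₁, r₂]
  have := (basisRatio_pos A.B₀ L₀).ne'
  have := (basisRatio_pos A.B₂ L₂).ne'
  field_simp

end Torsion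

end CochainBasis

end CochainBasis
/-! ## Stabilisation and transport of adapted bases -/

section StabilisedBasis

open Module

namespace CochainBasis

variable {C₀ C₁ C₂ D₁ D₂ W W' : Type} [AddCommGroup C₀] [Module ℝ C₀] [AddCommGroup C₁]
  [Module ℝ C₁] [AddCommGroup C₂] [Module ℝ C₂] [AddCommGroup D₁] [Module ℝ D₁] [AddCommGroup D₂]
  [Module ℝ D₂] [AddCommGroup W] [Module ℝ W] [AddCommGroup W'] [Module ℝ W']
  {d₀ : C₀ →ₗ[ℝ] C₁} {d₁ : C₁ →ₗ[ℝ] C₂} {e₀ : C₀ →ₗ[ℝ] D₁} {e₁ : D₁ →ₗ[ℝ] D₂}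
  {N₀ N₁ N₂ M₀ M₁ M₀' M₁' κ κ' κ₀ κ₁ κ₂ μ₁ μ₂ : Type}
  [Fintype κ] [DecidableEq κ] [Fintype κ'] [DecidableEq κ'] [Fintype κ₀] [DecidableEq κ₀]
  [Fintype κ₁] [DecidableEq κ₁] [Fintype κ₂] [DecidableEq κ₂] [Fintype μ₁] [DecidableEq μ₁]
  [Fintype μ₂] [DecidableEq μ₂]

/-- Add the acyclic complex `W → W` in degrees one and two. -/
noncomputable def stab (S : CochainBasis d₀ d₁ N₀ N₁ N₂ M₀ M₁) (w : Basis κ ℝ W) :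
    CochainBasis (LinearMap.inl ℝ C₁ W ∘ₗ d₀) (d₁.prodMap (LinearMap.id : W →ₗ[ℝ] W))
      N₀ N₁ N₂ M₀ (M₁ ⊕ κ) where
  B₀ := S.B₀
  B₁ := (S.B₁.prod w).reindex ((Equiv.sumAssoc _ _ _).trans
    ((Equiv.refl _).sumCongr (Equiv.sumAssoc _ _ _)))
  B₂ := (S.B₂.prod w).reindex ((Equiv.sumAssoc _ _ _).trans
    (((Equiv.refl _).sumCongr (Equiv.sumComm _ _)).trans (Equiv.sumAssoc _ _ _).symm))
  closed₀ i := by simp [S.closed₀]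
  closed₁ i := by simp [S.closed₁]
  image₀ j := by simp [S.image₀]
  image₁ j := by rcases j with j | j <;> simp [S.image₁]

theorem torsion_stab (S : CochainBasis d₀ d₁ N₀ N₁ N₂ M₀ M₁) (w : Basis κ ℝ W)
    (L₀ : Basis κ₀ ℝ C₀) (L₁ : Basis κ₁ ℝ C₁) (L₂ : Basis κ₂ ℝ C₂) :
    (S.stab w).torsion L₀ (L₁.prod w) (L₂.prod w) = S.torsion L₀ L₁ L₂ := by
  rw [torsion, torsion, stab, basisRatio_reindex_left, basisRatio_reindex_left, basisRatio_prod,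
    basisRatio_prod]

/-- Transport along an isomorphism of complexes that is the identity in degree zero. -/
noncomputable def map (S : CochainBasis e₀ e₁ N₀ N₁ N₂ M₀ M₁) (f₁ : D₁ ≃ₗ[ℝ] C₁) (f₂ : D₂ ≃ₗ[ℝ] C₂)
    (h₀ : ∀ x, f₁ (e₀ x) = d₀ x) (h₁ : ∀ y, f₂ (e₁ y) = d₁ (f₁ y)) :
    CochainBasis d₀ d₁ N₀ N₁ N₂ M₀ M₁ where
  B₀ := S.B₀
  B₁ := S.B₁.map f₁
  B₂ := S.B₂.map f₂
  closed₀ i := by rw [← h₀, S.closed₀, map_zero]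
  closed₁ i := by rw [Basis.map_apply, ← h₁, S.closed₁, map_zero]
  image₀ j := by rw [← h₀, Basis.map_apply, S.image₀]
  image₁ j := by rw [Basis.map_apply, Basis.map_apply, ← h₁, S.image₁]

theorem torsion_map (S : CochainBasis e₀ e₁ N₀ N₁ N₂ M₀ M₁) (f₁ : D₁ ≃ₗ[ℝ] C₁) (f₂ : D₂ ≃ₗ[ℝ] C₂)
    (h₀ : ∀ x, f₁ (e₀ x) = d₀ x) (h₁ : ∀ y, f₂ (e₁ y) = d₁ (f₁ y))
    (L₀ : Basis κ₀ ℝ C₀) (L₁ : Basis κ₁ ℝ C₁) (L₂ : Basis κ₂ ℝ C₂) (K₁ : Basis μ₁ ℝ D₁)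
    (K₂ : Basis μ₂ ℝ D₂) (r₁ : basisRatio (K₁.map f₁) L₁ = 1)
    (r₂ : basisRatio (K₂.map f₂) L₂ = 1) :
    (S.map f₁ f₂ h₀ h₁).torsion L₀ L₁ L₂ = S.torsion L₀ K₁ K₂ := by
  rw [torsion, torsion, ← basisRatio_map S.B₁ K₁ f₁, ← basisRatio_map S.B₂ K₂ f₂,
    ← mul_one (basisRatio (S.B₁.map f₁) (K₁.map f₁)), ← r₁, basisRatio_mul,
    ← mul_one (basisRatio (S.B₂.map f₂) (K₂.map f₂)), ← r₂, basisRatio_mul]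
  rfl

/-- The torsions of two complexes with stably isomorphic based cochain complexes agree. -/
theorem torsion_eq_of_stablyEquiv [Finite N₀] [Finite N₁] [Finite N₂] [Finite M₀] [Finite M₁]
    [Finite M₀'] [Finite M₁'] (hd : ∀ x, d₁ (d₀ x) = 0)
    (f₁ : (D₁ × W') ≃ₗ[ℝ] (C₁ × W)) (f₂ : (D₂ × W') ≃ₗ[ℝ] (C₂ × W))
    (hf₀ : ∀ x, f₁ (e₀ x, 0) = (d₀ x, 0))
    (hf₁ : ∀ y, f₂ (e₁ y.1, y.2) = (d₁ (f₁ y).1, (f₁ y).2))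
    (S : CochainBasis e₀ e₁ N₀ N₁ N₂ M₀ M₁) (T : CochainBasis d₀ d₁ N₀ N₁ N₂ M₀' M₁')
    (h₀ : ∀ i, T.B₀ (Sum.inl i) = S.B₀ (Sum.inl i))
    (h₁ : ∀ i, ∃ y, T.B₁ (Sum.inr (Sum.inl i)) = (f₁ (S.B₁ (Sum.inr (Sum.inl i)), 0)).1 + d₀ y)
    (h₂ : ∀ i, ∃ y, T.B₂ (Sum.inr i) = (f₂ (S.B₂ (Sum.inr i), 0)).1 + d₁ y)
    (w : Basis κ ℝ W) (w' : Basis κ' ℝ W')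
    (L₀ : Basis κ₀ ℝ C₀) (L₁ : Basis κ₁ ℝ C₁) (L₂ : Basis κ₂ ℝ C₂) (K₁ : Basis μ₁ ℝ D₁)
    (K₂ : Basis μ₂ ℝ D₂) (r₁ : basisRatio ((K₁.prod w').map f₁) (L₁.prod w) = 1)
    (r₂ : basisRatio ((K₂.prod w').map f₂) (L₂.prod w) = 1) :
    T.torsion L₀ L₁ L₂ = S.torsion L₀ K₁ K₂ := by
  let S' : CochainBasis (LinearMap.inl ℝ C₁ W ∘ₗ d₀) (d₁.prodMap (LinearMap.id : W →ₗ[ℝ] W))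
      N₀ N₁ N₂ M₀ (M₁ ⊕ κ') := (S.stab w').map f₁ f₂ hf₀ hf₁
  have hS : S'.torsion L₀ (L₁.prod w) (L₂.prod w) =
      (S.stab w').torsion L₀ (K₁.prod w') (K₂.prod w') :=
    torsion_map (d₀ := LinearMap.inl ℝ C₁ W ∘ₗ d₀) (d₁ := d₁.prodMap (LinearMap.id : W →ₗ[ℝ] W))
      (S.stab w') f₁ f₂ hf₀ hf₁ L₀ _ _ _ _ r₁ r₂
  rw [← T.torsion_stab w, ← S.torsion_stab w', ← hS]
  refine torsion_eq (fun x => by simp [hd]) S' (T.stab w) h₀ (fun i => ?_) (fun i => ?_) _ _ _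
  · obtain ⟨y, hy⟩ := h₁ i
    refine ⟨y, ?_⟩
    -- The differential is the identity on the added summand, so a cocycle has no component there.
    have hz : (f₁ (S.B₁ (Sum.inr (Sum.inl i)), 0)).2 = 0 := by
      have := hf₁ (S.B₁ (Sum.inr (Sum.inl i)), 0)
      rw [S.closed₁, Prod.mk_zero_zero, map_zero] at this
      exact (congrArg Prod.snd this).symm
    refine Prod.ext ?_ ?_
    · simpa [S', map, stab] using hy
    · simpa [S', map, stab] using hz.symm
  · obtain ⟨y, hy⟩ := h₂ i
    -- In degree two the component in the added summand is a coboundary and can be subtracted.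
    refine ⟨(y, -(f₂ (S.B₂ (Sum.inr i), 0)).2), Prod.ext ?_ ?_⟩
    · simpa [S', map, stab] using hy
    · simp [S', map, stab]

end CochainBasis

end StabilisedBasis

/-! ## Bases modulo a subspace and existence of adapted bases -/

section BasisMod

open Module

variable {V V' N M : Type} [AddCommGroup V] [Module ℝ V] [AddCommGroup V'] [Module ℝ V']
  [Fintype N] [Fintype M]

/-- The family `h` in `K` represents a basis of `K` modulo `I`. -/
def IsBasisMod (h : N → V) (K I : Submodule ℝ V) : Prop :=
  (∀ i, h i ∈ K) ∧ ∀ x ∈ K, ∃! c : N → ℝ, x - ∑ i, c i • h i ∈ I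

namespace IsBasisMod

theorem exists_basis {v : N → V} (h : IsBasisMod v ⊤ ⊥) : ∃ B : Basis N ℝ V, ∀ i, B i = v i := by
  classical
  have hb : Function.Bijective (Fintype.linearCombination ℝ v) := by
    rw [Function.bijective_iff_existsUnique]
    intro x
    obtain ⟨c, hc, hu⟩ := h.2 x trivial
    refine ⟨c, ?_, fun c' hc' => hu c' ?_⟩
    · exact (sub_eq_zero.1 ((Submodule.mem_bot ℝ).1 hc)).symm
    · exact (Submodule.mem_bot ℝ).2 (sub_eq_zero.2 hc'.symm)
  refine ⟨Basis.ofEquivFun (LinearEquiv.ofBijective _ hb).symm, fun i => ?_⟩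
  simp [Fintype.linearCombination_apply_single]

/-- Remove the part along `h`, which is unique modulo `I`, and expand the remainder in the basis `v`
of `I`. -/
theorem sumElim {h : N → V} {v : M → V} {K I : Submodule ℝ V} (hI : I ≤ K)
    (hv : IsBasisMod v I ⊥) (hh : IsBasisMod h K I) : IsBasisMod (Sum.elim v h) K ⊥ := by
  refine ⟨fun i => ?_, fun x hx => ?_⟩
  · rcases i with i | i
    · exact hI (hv.1 i)
    · exact hh.1 i
  obtain ⟨c, hc, hcu⟩ := hh.2 x hx
  obtain ⟨b, hb, hbu⟩ := hv.2 _ hc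
  refine ⟨Sum.elim b c, ?_, fun a ha => ?_⟩
  · simpa [Fintype.sum_sum_type, sub_sub, add_comm] using hb
  · simp only [Fintype.sum_sum_type, Sum.elim_inl, Sum.elim_inr, Submodule.mem_bot] at ha
    have h₁ : x - ∑ i, a (Sum.inr i) • h i = ∑ i, a (Sum.inl i) • v i := by
      rw [sub_eq_zero] at ha
      rw [ha, add_sub_cancel_right]
    have h₂ : (fun i => a (Sum.inr i)) = c :=
      hcu _ (by
        simp only [h₁]
        exact I.sum_mem fun i _ => I.smul_mem _ (hv.1 i))
    have h₃ : (fun i => a (Sum.inl i)) = b := by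
      refine hbu _ ?_
      rw [← h₂]
      exact (Submodule.mem_bot ℝ).2 (sub_eq_zero.2 h₁)
    ext (i | i)
    · exact congrFun h₃ i
    · exact congrFun h₂ i

theorem of_comp {d : V →ₗ[ℝ] V'} {b : M → V}
    (h : IsBasisMod (fun i => d (b i)) (LinearMap.range d) ⊥) :
    IsBasisMod b ⊤ (LinearMap.ker d) := by
  refine ⟨fun _ => trivial, fun x _ => ?_⟩
  simpa using h.2 (d x) ⟨x, rfl⟩

theorem of_finBasis (I : Submodule ℝ V) [Module.Finite ℝ I] :
    IsBasisMod (fun i => (finBasis ℝ I i : V)) I ⊥ := by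
  refine ⟨fun i => (finBasis ℝ I i).2, fun x hx => ?_⟩
  refine ⟨(finBasis ℝ I).repr ⟨x, hx⟩, ?_, fun c hc => ?_⟩
  · have := congrArg Subtype.val ((finBasis ℝ I).sum_repr ⟨x, hx⟩)
    simp only [AddSubmonoidClass.coe_finsetSum, Submodule.coe_smul] at this
    simp only [this, sub_self, Submodule.zero_mem]
  · have h : (⟨x, hx⟩ : I) = ∑ i, c i • finBasis ℝ I i := by
      refine Subtype.ext ?_
      simpa [sub_eq_zero] using hc
    rw [h, Basis.repr_sum_self]

end IsBasisMod

/-! ### Adapted bases and bases of cohomology -/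

namespace CochainBasis

variable {C₀ C₁ C₂ : Type} [AddCommGroup C₀] [Module ℝ C₀] [AddCommGroup C₁] [Module ℝ C₁]
  [AddCommGroup C₂] [Module ℝ C₂] {d₀ : C₀ →ₗ[ℝ] C₁} {d₁ : C₁ →ₗ[ℝ] C₂} {N₀ N₁ N₂ M₀ M₁ : Type}

/-- Representatives of bases of the cohomology extend to an adapted basis. -/
theorem exists_of_isBasisMod [Fintype N₀] [Fintype N₁] [Fintype N₂]
    [Module.Finite ℝ C₁] [Module.Finite ℝ C₂] (hd : ∀ x, d₁ (d₀ x) = 0)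
    {h₀ : N₀ → C₀} {h₁ : N₁ → C₁} {h₂ : N₂ → C₂} (H₀ : IsBasisMod h₀ (LinearMap.ker d₀) ⊥)
    (H₁ : IsBasisMod h₁ (LinearMap.ker d₁) (LinearMap.range d₀))
    (H₂ : IsBasisMod h₂ ⊤ (LinearMap.range d₁)) :
    ∃ (m₀ m₁ : ℕ) (S : CochainBasis d₀ d₁ N₀ N₁ N₂ (Fin m₀) (Fin m₁)),
      (∀ i, S.B₀ (Sum.inl i) = h₀ i) ∧ (∀ i, S.B₁ (Sum.inr (Sum.inl i)) = h₁ i) ∧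
      ∀ i, S.B₂ (Sum.inr i) = h₂ i := by
  have I₀ := IsBasisMod.of_finBasis (LinearMap.range d₀)
  have I₁ := IsBasisMod.of_finBasis (LinearMap.range d₁)
  -- The families `b₀` and `b₁` are arbitrary lifts of bases of the images of the coboundaries.
  choose b₀ hb₀ using fun i => (finBasis ℝ (LinearMap.range d₀) i).2
  choose b₁ hb₁ using fun i => (finBasis ℝ (LinearMap.range d₁) i).2
  simp only [← hb₀] at I₀
  simp only [← hb₁] at I₁
  obtain ⟨B₀, e₀⟩ := (H₀.sumElim le_top I₀.of_comp).exists_basis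
  obtain ⟨B₁, e₁⟩ := ((I₀.sumElim (LinearMap.range_le_ker_iff.2 (LinearMap.ext hd)) H₁).sumElim
    le_top I₁.of_comp).exists_basis
  obtain ⟨B₂, e₂⟩ := (I₁.sumElim le_top H₂).exists_basis
  refine ⟨_, _, ⟨B₀, B₁.reindex (Equiv.sumAssoc _ _ _), B₂, fun i => ?_, fun i => ?_, fun i => ?_,
    fun i => ?_⟩, fun i => ?_, fun i => ?_, fun i => ?_⟩
  · simpa [e₀] using H₀.1 i
  · simpa [e₁] using H₁.1 i
  · simp [e₀, e₁]
  · simp [e₁, e₂]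
  · simp [e₀]
  · simp [e₁]
  · simp [e₂]

variable (S : CochainBasis d₀ d₁ N₀ N₁ N₂ M₀ M₁)

theorem isBasisMod₀ [Fintype N₀] [Finite M₀] :
    IsBasisMod (fun i => S.B₀ (Sum.inl i)) (LinearMap.ker d₀) ⊥ := by
  have := Fintype.ofFinite M₀
  have hx : ∀ x, x = ∑ i, S.B₀.repr x (Sum.inl i) • S.B₀ (Sum.inl i) +
      ∑ i, S.B₀.repr x (Sum.inr i) • S.B₀ (Sum.inr i) := fun x => by
    conv_lhs => rw [← S.B₀.sum_repr x, Fintype.sum_sum_type]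
  refine ⟨S.closed₀, fun x hxK => ⟨fun i => S.B₀.repr x (Sum.inl i), ?_, fun c hc => ?_⟩⟩
  · have h : ∀ i, S.B₀.repr x (Sum.inr i) = 0 := fun i => by
      rw [← S.repr_d₀_inl, LinearMap.mem_ker.1 hxK, map_zero, Finsupp.zero_apply]
    simp only [Submodule.mem_bot]
    rw [sub_eq_zero]
    conv_lhs => rw [hx x]
    simp [h]
  · ext i
    rw [sub_eq_zero.1 ((Submodule.mem_bot ℝ).1 hc)]
    classical
    simp [map_sum, Finsupp.single_apply, Finsupp.finsetSum_apply]

theorem isBasisMod₁ [Fintype N₁] [Finite M₀] [Finite M₁] (hd : ∀ x, d₁ (d₀ x) = 0) :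
    IsBasisMod (fun i => S.B₁ (Sum.inr (Sum.inl i))) (LinearMap.ker d₁) (LinearMap.range d₀) := by
  have := Fintype.ofFinite M₀
  have := Fintype.ofFinite M₁
  refine ⟨S.closed₁, fun x hxK => ⟨fun i => S.B₁.repr x (Sum.inr (Sum.inl i)), ?_, fun c hc => ?_⟩⟩
  · have h : ∀ i, S.B₁.repr x (Sum.inr (Sum.inr i)) = 0 := fun i => by
      rw [← S.repr_d₁_inl hd, LinearMap.mem_ker.1 hxK, map_zero, Finsupp.zero_apply]
    suffices h' : ∑ i, S.B₁.repr x i • S.B₁ i - ∑ i, S.B₁.repr x (Sum.inr (Sum.inl i)) •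
        S.B₁ (Sum.inr (Sum.inl i)) ∈ LinearMap.range d₀ by rwa [S.B₁.sum_repr x] at h'
    rw [Fintype.sum_sum_type, Fintype.sum_sum_type]
    simp only [h, zero_smul, Finset.sum_const_zero, add_zero, add_sub_cancel_right, S.image₀]
    exact Submodule.sum_mem _ fun i _ => Submodule.smul_mem _ _ ⟨_, rfl⟩
  · obtain ⟨y, hy⟩ := hc
    ext i
    have h := S.repr_d₀_inr y (Sum.inl i)
    rw [hy] at h
    classical
    simp only [map_sub, map_sum, map_smul, Basis.repr_self, Finsupp.sub_apply,
      Finsupp.finsetSum_apply, Finsupp.smul_apply, Finsupp.single_apply, Sum.inr.injEq,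
      Sum.inl.injEq, smul_eq_mul, mul_ite, mul_one, mul_zero, Finset.sum_ite_eq',
      Finset.mem_univ, if_true] at h
    linarith

theorem isBasisMod₂ [Fintype N₂] [Finite M₁] (hd : ∀ x, d₁ (d₀ x) = 0) :
    IsBasisMod (fun i => S.B₂ (Sum.inr i)) ⊤ (LinearMap.range d₁) := by
  have := Fintype.ofFinite M₁
  refine ⟨fun _ => trivial, fun x _ => ⟨fun i => S.B₂.repr x (Sum.inr i), ?_, fun c hc => ?_⟩⟩
  · suffices h' : ∑ i, S.B₂.repr x i • S.B₂ i - ∑ i, S.B₂.repr x (Sum.inr i) • S.B₂ (Sum.inr i) ∈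
        LinearMap.range d₁ by rwa [S.B₂.sum_repr x] at h'
    rw [Fintype.sum_sum_type]
    simp only [add_sub_cancel_right, S.image₁]
    exact Submodule.sum_mem _ fun i _ => Submodule.smul_mem _ _ ⟨_, rfl⟩
  · obtain ⟨y, hy⟩ := hc
    ext i
    have h := S.repr_d₁_inr hd y i
    rw [hy] at h
    classical
    simp only [map_sub, map_sum, map_smul, Basis.repr_self, Finsupp.sub_apply,
      Finsupp.finsetSum_apply, Finsupp.smul_apply, Finsupp.single_apply, Sum.inr.injEq,
      smul_eq_mul, mul_ite, mul_one, mul_zero, Finset.sum_ite_eq',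
      Finset.mem_univ, if_true] at h
    linarith

end CochainBasis

end BasisMod
/-! ## Transport of cohomology bases along a stable isomorphism -/

section Transport

open Module

variable {C₀ C₁ C₂ D₁ D₂ W W' : Type} [AddCommGroup C₀] [Module ℝ C₀] [AddCommGroup C₁]
  [Module ℝ C₁] [AddCommGroup C₂] [Module ℝ C₂] [AddCommGroup D₁] [Module ℝ D₁] [AddCommGroup D₂]
  [Module ℝ D₂] [AddCommGroup W] [Module ℝ W] [AddCommGroup W'] [Module ℝ W']
  {d₀ : C₀ →ₗ[ℝ] C₁} {d₁ : C₁ →ₗ[ℝ] C₂} {e₀ : C₀ →ₗ[ℝ] D₁} {e₁ : D₁ →ₗ[ℝ] D₂}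
  {N : Type} [Fintype N] (f₁ : (D₁ × W') ≃ₗ[ℝ] (C₁ × W)) (f₂ : (D₂ × W') ≃ₗ[ℝ] (C₂ × W))

theorem fst_sub_sum (f : (D₁ × W') ≃ₗ[ℝ] (C₁ × W)) (c : N → ℝ) (h : N → D₁) (u : D₁) (w : W') :
    (f (u, w)).1 - ∑ i, c i • (f (h i, 0)).1 = (f (u - ∑ i, c i • h i, w)).1 := by
  have e : (u - ∑ i, c i • h i, w) = (u, w) - ∑ i, c i • ((h i, 0) : D₁ × W') := by
    refine Prod.ext ?_ ?_ <;> simp [Prod.fst_sum, Prod.snd_sum]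
  rw [e, map_sub, map_sum, Prod.fst_sub, Prod.fst_sum]
  simp only [map_smul, Prod.smul_fst]

theorem ker_eq_of_stablyEquiv (hf₀ : ∀ x, f₁ (e₀ x, 0) = (d₀ x, 0)) :
    LinearMap.ker d₀ = LinearMap.ker e₀ := by
  ext x
  have h : f₁ (e₀ x, 0) = 0 ↔ (d₀ x, (0 : W)) = 0 := by rw [hf₀]
  rw [map_eq_zero_iff f₁ f₁.injective] at h
  simpa using h.symm

variable {f₁ f₂}

/-- Cocycles have no component in the acyclic summands on either side, so the stable isomorphism
matches cocycles modulo coboundaries. -/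
theorem IsBasisMod.transport₁ (hf₀ : ∀ x, f₁ (e₀ x, 0) = (d₀ x, 0))
    (hf₁ : ∀ y, f₂ (e₁ y.1, y.2) = (d₁ (f₁ y).1, (f₁ y).2)) {h : N → D₁}
    (H : IsBasisMod h (LinearMap.ker e₁) (LinearMap.range e₀)) :
    IsBasisMod (fun i => (f₁ (h i, 0)).1) (LinearMap.ker d₁) (LinearMap.range d₀) := by
  have hz : ∀ y : D₁, e₁ y = 0 → d₁ (f₁ (y, 0)).1 = 0 ∧ (f₁ (y, 0)).2 = 0 := by
    intro y hy
    have h := hf₁ (y, 0)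
    rw [hy, Prod.mk_zero_zero, map_zero] at h
    exact ⟨(congrArg Prod.fst h).symm, (congrArg Prod.snd h).symm⟩
  refine ⟨fun i => (hz _ (H.1 i)).1, fun z hz' => ?_⟩
  obtain ⟨⟨u, w⟩, hu⟩ := f₁.surjective (z, 0)
  have hk : f₂ (e₁ u, w) = 0 := by
    rw [hf₁ (u, w), hu, LinearMap.mem_ker.1 hz', Prod.mk_zero_zero]
  rw [map_eq_zero_iff f₂ f₂.injective, Prod.mk_eq_zero] at hk
  obtain ⟨hu₁, rfl⟩ := hk
  have hiff : ∀ c : N → ℝ, z - ∑ i, c i • (f₁ (h i, 0)).1 ∈ LinearMap.range d₀ ↔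
      u - ∑ i, c i • h i ∈ LinearMap.range e₀ := by
    intro c
    have hz₁ : z = (f₁ (u, 0)).1 := by rw [hu]
    rw [hz₁, fst_sub_sum]
    have hc : e₁ (u - ∑ i, c i • h i) = 0 :=
      (LinearMap.ker e₁).sub_mem hu₁
        ((LinearMap.ker e₁).sum_mem fun i _ => (LinearMap.ker e₁).smul_mem _ (H.1 i))
    constructor
    · rintro ⟨y, hy⟩
      have h₁ : f₁ (e₀ y, 0) = f₁ (u - ∑ i, c i • h i, 0) := by
        rw [hf₀, hy]
        exact Prod.ext rfl (hz _ hc).2.symm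
      exact ⟨y, congrArg Prod.fst (f₁.injective h₁)⟩
    · rintro ⟨y, hy⟩
      exact ⟨y, by rw [← hy, hf₀]⟩
  simpa only [hiff] using H.2 u hu₁

theorem IsBasisMod.transport₂ (hf₁ : ∀ y, f₂ (e₁ y.1, y.2) = (d₁ (f₁ y).1, (f₁ y).2)) {h : N → D₂}
    (H : IsBasisMod h ⊤ (LinearMap.range e₁)) :
    IsBasisMod (fun i => (f₂ (h i, 0)).1) ⊤ (LinearMap.range d₁) := by
  refine ⟨fun _ => trivial, fun z _ => ?_⟩
  obtain ⟨⟨u, w⟩, hu⟩ := f₂.surjective (z, 0)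
  have hiff : ∀ c : N → ℝ, z - ∑ i, c i • (f₂ (h i, 0)).1 ∈ LinearMap.range d₁ ↔
      u - ∑ i, c i • h i ∈ LinearMap.range e₁ := by
    intro c
    have hz₁ : z = (f₂ (u, w)).1 := by rw [hu]
    rw [hz₁, fst_sub_sum]
    constructor
    · rintro ⟨y, hy⟩
      obtain ⟨⟨y', w'⟩, hy'⟩ := f₁.surjective (y, (f₂ (u - ∑ i, c i • h i, w)).2)
      have h₁ : f₂ (e₁ y', w') = f₂ (u - ∑ i, c i • h i, w) := by
        rw [hf₁ (y', w'), hy', hy]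
      exact ⟨y', congrArg Prod.fst (f₂.injective h₁)⟩
    · rintro ⟨y, hy⟩
      exact ⟨(f₁ (y, w)).1, by rw [← hy, hf₁ (y, w)]⟩
  simpa only [hiff] using H.2 u trivial

/-- Cohomology bases of a complex carry over to a stably isomorphic complex. -/
theorem CochainBasis.exists_of_stablyEquiv {N₀ N₁ N₂ M₀ M₁ : Type} [Fintype N₀] [Fintype N₁]
    [Fintype N₂] [Finite M₀] [Finite M₁] [Module.Finite ℝ C₁] [Module.Finite ℝ C₂]
    (hd : ∀ x, d₁ (d₀ x) = 0) (he : ∀ x, e₁ (e₀ x) = 0)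
    (hf₀ : ∀ x, f₁ (e₀ x, 0) = (d₀ x, 0))
    (hf₁ : ∀ y, f₂ (e₁ y.1, y.2) = (d₁ (f₁ y).1, (f₁ y).2))
    (S : CochainBasis e₀ e₁ N₀ N₁ N₂ M₀ M₁) :
    ∃ (m₀ m₁ : ℕ) (T : CochainBasis d₀ d₁ N₀ N₁ N₂ (Fin m₀) (Fin m₁)),
      (∀ i, T.B₀ (Sum.inl i) = S.B₀ (Sum.inl i)) ∧
      (∀ i, T.B₁ (Sum.inr (Sum.inl i)) = (f₁ (S.B₁ (Sum.inr (Sum.inl i)), 0)).1) ∧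
      ∀ i, T.B₂ (Sum.inr i) = (f₂ (S.B₂ (Sum.inr i), 0)).1 :=
  exists_of_isBasisMod hd (ker_eq_of_stablyEquiv f₁ hf₀ ▸ S.isBasisMod₀)
    ((S.isBasisMod₁ he).transport₁ hf₀ hf₁) ((S.isBasisMod₂ he).transport₂ hf₁)

end Transport
/-! ## Determinants of the maps on cochains -/

section Determinant

open Module

instance : Module.Finite ℝ su2 := inferInstanceAs (FiniteDimensional ℝ su2)

/-- The invariant scalar product on `su(2)`. -/
noncomputable def su2Form : LinearMap.BilinForm ℝ su2 :=
  LinearMap.mk₂ ℝ (fun A B => -(((A : Matrix (Fin 2) (Fin 2) ℂ) * B).trace).re)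
    (fun A B C => by simp [Matrix.add_mul]; ring) (fun c A B => by simp)
    (fun A B C => by simp [Matrix.mul_add]; ring) (fun c A B => by simp)

theorem su2Form_apply (A B : su2) :
    su2Form A B = -(((A : Matrix (Fin 2) (Fin 2) ℂ) * B).trace).re := rfl

open scoped ComplexOrder in
-- For skew-hermitian `A` the form is the trace of `A* A`, which vanishes only at zero.
theorem su2Form_self_ne_zero {A : su2} (h : A ≠ 0) : su2Form A A ≠ 0 := by
  intro h₀
  apply h
  have hA := A.2.1
  have h₁ : ((A : Matrix (Fin 2) (Fin 2) ℂ).conjTranspose * A).trace.re = 0 := by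
    rw [hA, Matrix.neg_mul, Matrix.trace_neg, Complex.neg_re]
    exact h₀
  have h₂ : ((A : Matrix (Fin 2) (Fin 2) ℂ).conjTranspose * A).trace.im = 0 := by
    simp [Matrix.trace, Matrix.mul_apply, Fin.sum_univ_two]
    ring
  exact Subtype.ext (Matrix.trace_conjTranspose_mul_self_eq_zero_iff.1 (Complex.ext h₁ h₂))

theorem su2Form_nondegenerate : su2Form.Nondegenerate := by
  constructor
  · intro A hA
    by_contra h
    exact su2Form_self_ne_zero h (hA A)
  · intro A hA
    by_contra h
    exact su2Form_self_ne_zero h (hA A)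

theorem su2Form_adjointAction (g : SU2) :
    su2Form.comp (adjointAction g) (adjointAction g) = su2Form := by
  ext A B
  have h : ((g⁻¹ : SU2) : Matrix (Fin 2) (Fin 2) ℂ) * (g : Matrix (Fin 2) (Fin 2) ℂ) = 1 :=
    congrArg Subtype.val (inv_mul_cancel g)
  have e : ((adjointAction g A : su2) : Matrix (Fin 2) (Fin 2) ℂ) * (adjointAction g B : su2) =
      (g : Matrix (Fin 2) (Fin 2) ℂ) * ((A : Matrix (Fin 2) (Fin 2) ℂ) * B) * (g⁻¹ : SU2) := by
    change (g : Matrix (Fin 2) (Fin 2) ℂ) * A * (g⁻¹ : SU2) * (g * B * (g⁻¹ : SU2)) = _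
    simp only [Matrix.mul_assoc]
    rw [← Matrix.mul_assoc ((g⁻¹ : SU2) : Matrix (Fin 2) (Fin 2) ℂ)
      (g : Matrix (Fin 2) (Fin 2) ℂ), h, Matrix.one_mul]
  rw [LinearMap.BilinForm.comp_apply, su2Form_apply, su2Form_apply, e, Matrix.trace_mul_comm,
    ← Matrix.mul_assoc, h, Matrix.one_mul]

/-- Comparing Gram determinants of the invariant nondegenerate form gives `det² = 1`. -/
theorem abs_det_adjointAction (g : SU2) : |LinearMap.det (adjointAction g)| = 1 := by
  classical
  let b := finBasis ℝ su2
  have h := congrArg (fun B => (LinearMap.BilinForm.toMatrix b B).det) (su2Form_adjointAction g)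
  have hne := (LinearMap.BilinForm.nondegenerate_iff_det_ne_zero b).1 su2Form_nondegenerate
  simp only [LinearMap.BilinForm.toMatrix_comp b b, Matrix.det_mul, Matrix.det_transpose,
    LinearMap.det_toMatrix] at h
  have h' : LinearMap.det (adjointAction g) ^ 2 = 1 := mul_right_cancel₀ hne (by linarith)
  rw [← sq_abs] at h'
  exact (pow_eq_one_iff_of_nonneg (abs_nonneg _) two_ne_zero).1 h'

variable {Γ ι κ μ : Type} [Group Γ] (ρ : Γ →* SU2)

theorem pullback_apply [Fintype κ] (M : Matrix ι κ (MonoidAlgebra ℤ Γ)) (x : κ → su2) (i : ι) :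
    pullback ρ M x i = ∑ k, ringAction ρ (M i k) (x k) := by
  simp [pullback]

theorem pullback_mul [Fintype κ] [Fintype μ] (M : Matrix ι κ (MonoidAlgebra ℤ Γ))
    (N : Matrix κ μ (MonoidAlgebra ℤ Γ)) : pullback ρ (M * N) = pullback ρ M ∘ₗ pullback ρ N := by
  ext1 x
  ext1 i
  simp only [pullback_apply, LinearMap.comp_apply, Matrix.mul_apply, map_sum, map_mul,
    Module.End.mul_apply, LinearMap.sum_apply]
  exact Finset.sum_comm

theorem pullback_one [Fintype κ] [DecidableEq κ] :
    pullback ρ (1 : Matrix κ κ (MonoidAlgebra ℤ Γ)) = LinearMap.id := by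
  refine LinearMap.ext fun x => funext fun i => ?_
  rw [pullback_apply, Finset.sum_eq_single i]
  · simp
  · intro k _ hk
    simp [Matrix.one_apply_ne hk.symm]
  · simp

theorem pullback_diagonal [Fintype κ] [DecidableEq κ] (a : κ → MonoidAlgebra ℤ Γ) :
    pullback ρ (Matrix.diagonal a) =
      LinearMap.pi fun i => (ringAction ρ (a i)) ∘ₗ LinearMap.proj i := by
  refine LinearMap.ext fun x => funext fun i => ?_
  rw [pullback_apply, Finset.sum_eq_single i]
  · simp
  · intro k _ hk
    simp [Matrix.diagonal_apply_ne _ hk.symm]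
  · simp

/-- The determinant of the action of square matrices on cochains. -/
noncomputable def pullbackDet [Fintype κ] [DecidableEq κ] :
    Matrix κ κ (MonoidAlgebra ℤ Γ) →* ℝ where
  toFun M := LinearMap.det (pullback ρ M)
  map_one' := by rw [pullback_one, LinearMap.det_id]
  map_mul' M N := by rw [pullback_mul, LinearMap.det_comp]

theorem ringAction_single (g : Γ) (n : ℤ) :
    ringAction ρ (MonoidAlgebra.single g n) = n • adjointAction (ρ g) := by
  simp [ringAction, MonoidAlgebra.lift_single]

theorem abs_pullbackDet_diagonal [Fintype κ] [DecidableEq κ] (i : κ) (g : Γ) (u : ℤˣ) :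
    |pullbackDet ρ (Matrix.diagonal (Function.update 1 i (MonoidAlgebra.single g (u : ℤ))))| = 1 := by
  change |LinearMap.det (pullback ρ _)| = 1
  rw [pullback_diagonal, LinearMap.det_pi, Finset.abs_prod]
  refine Finset.prod_eq_one fun k _ => ?_
  by_cases h : k = i
  · subst h
    rw [Function.update_self, ringAction_single]
    rcases Int.units_eq_one_or u with rfl | rfl
    · simpa using abs_det_adjointAction (ρ g)
    · have e : ((-1 : ℤˣ) : ℤ) • adjointAction (ρ g) = (-1 : ℝ) • adjointAction (ρ g) :=
        LinearMap.ext fun A =>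
          (neg_one_zsmul (adjointAction (ρ g) A)).trans (neg_one_smul ℝ _).symm
      rw [e, LinearMap.det_smul, abs_mul, abs_det_adjointAction, abs_pow]
      simp
  · rw [Function.update_of_ne h]
    simp

/-- Conjugation by the diagonal matrix with `-1` at `i` replaces `c` by `-c`, that is, inverts the
transvection. So the modulus of its determinant is its own inverse. -/
theorem abs_pullbackDet_transvection [Fintype κ] [DecidableEq κ] {i j : κ} (h : i ≠ j)
    (c : MonoidAlgebra ℤ Γ) : |pullbackDet ρ (1 + Matrix.single i j c)| = 1 := by
  let D : Matrix κ κ (MonoidAlgebra ℤ Γ) :=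
    Matrix.diagonal (Function.update 1 i (MonoidAlgebra.single (1 : Γ) ((-1 : ℤˣ) : ℤ)))
  have hs : MonoidAlgebra.single (1 : Γ) ((-1 : ℤˣ) : ℤ) = -1 := by
    rw [MonoidAlgebra.one_def, ← MonoidAlgebra.single_neg]
    rfl
  have hD : |pullbackDet ρ D| = 1 := abs_pullbackDet_diagonal ρ i 1 (-1)
  have h₁ : D * (1 + Matrix.single i j c) = (1 + Matrix.single i j (-c)) * D := by
    ext1 k l
    simp only [D, Matrix.diagonal_mul, Matrix.mul_diagonal, hs, Matrix.add_apply, Matrix.single_apply,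
      Matrix.one_apply, Function.update_apply, Pi.one_apply]
    by_cases hk : k = i
    · subst hk
      by_cases hl : l = k
      · subst hl
        simp [h.symm]
      · by_cases hj : j = l
        · subst hj; simp [hl, Ne.symm hl]
        · simp [hl, Ne.symm hl, hj]
    · by_cases hl : l = i
      · subst hl
        simp [hk, Ne.symm hk]
      · simp [hk, hl, Ne.symm hk]
  have h₂ : (1 + Matrix.single i j c) * (1 + Matrix.single i j (-c)) = 1 := by
    rw [add_mul, mul_add, mul_add, one_mul, one_mul, mul_one, Matrix.single_mul_single_of_ne _ _ _ _ h.symm,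
      add_zero, add_assoc, ← Matrix.single_add]
    simp
  have e₁ := congrArg (fun M => |pullbackDet ρ M|) h₁
  have e₂ := congrArg (fun M => |pullbackDet ρ M|) h₂
  simp only [map_mul, abs_mul, hD, one_mul, mul_one, map_one, abs_one] at e₁ e₂
  rw [← e₁, ← sq] at e₂
  exact (pow_eq_one_iff_of_nonneg (abs_nonneg _) two_ne_zero).1 e₂

theorem abs_pullbackDet_of_mem_closure [Fintype κ] [DecidableEq κ]
    {M : Matrix κ κ (MonoidAlgebra ℤ Γ)}
    (h : M ∈ Submonoid.closure {N : Matrix κ κ (MonoidAlgebra ℤ Γ) | IsElementary N}) :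
    |pullbackDet ρ M| = 1 := by
  induction h using Submonoid.closure_induction with
  | mem N hN =>
    rcases hN with ⟨i, j, c, hij, rfl⟩ | ⟨i, g, u, rfl⟩
    · exact abs_pullbackDet_transvection ρ hij c
    · exact abs_pullbackDet_diagonal ρ i g u
  | one => simp
  | mul M N _ _ hM hN => rw [map_mul, abs_mul, hM, hN, one_mul]

/-- A simple isomorphism induces a volume preserving isomorphism of cochain spaces. -/
theorem IsSimpleIso.exists_linearEquiv [Fintype ι] [DecidableEq ι] [Fintype κ] [DecidableEq κ]
    {M : Matrix ι κ (MonoidAlgebra ℤ Γ)} (h : IsSimpleIso M) :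
    ∃ f : (κ → su2) ≃ₗ[ℝ] (ι → su2), (∀ x, f x = pullback ρ M x) ∧
      ∀ l : Basis (Fin 3) ℝ su2,
        basisRatio ((Pi.basis fun _ : κ => l).map f) (Pi.basis fun _ : ι => l) = 1 := by
  obtain ⟨e, he⟩ := h
  have hdet := abs_pullbackDet_of_mem_closure ρ he
  have hunit : IsUnit (LinearMap.det (pullback ρ (M.submatrix id e))) := by
    refine isUnit_iff_ne_zero.2 fun h₀ => ?_
    have : |LinearMap.det (pullback ρ (M.submatrix id e))| = 1 := hdet
    simp [h₀] at this
  -- The map is a renaming of coordinates followed by an automorphism of determinant `±1`.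
  let f₁ : (ι → su2) ≃ₗ[ℝ] (ι → su2) := LinearMap.equivOfIsUnitDet hunit
  let f₀ : (κ → su2) ≃ₗ[ℝ] (ι → su2) := LinearEquiv.funCongrLeft ℝ su2 e
  refine ⟨f₀.trans f₁, fun x => ?_, fun l => ?_⟩
  · ext1 i
    change f₁ (x ∘ e) i = _
    rw [LinearMap.equivOfIsUnitDet_apply, pullback_apply, pullback_apply]
    exact e.sum_comp fun k => ringAction ρ (M i k) (x k)
  · have h₀ : basisRatio ((Pi.basis fun _ : κ => l).map f₀) (Pi.basis fun _ : ι => l) = 1 := by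
      refine basisRatio_of_apply _ _ (Equiv.sigmaCongr e.symm fun _ => Equiv.refl _) ?_
      rintro ⟨k, j⟩
      refine funext fun i => ?_
      change (Pi.basis fun _ : κ => l) ⟨k, j⟩ (e i) = (Pi.basis fun _ : ι => l) ⟨e.symm k, j⟩ i
      simp [Pi.basis_apply, Pi.single_apply, e.eq_symm_apply]
    have h₁ : basisRatio ((Pi.basis fun _ : ι => l).map f₁) (Pi.basis fun _ : ι => l) = 1 := by
      rw [basisRatio_map_self]
      exact (congrArg (fun f => |LinearMap.det f|)
        (LinearMap.ext fun x => LinearMap.equivOfIsUnitDet_apply hunit x)).trans hdet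
    change basisRatio (((Pi.basis fun _ : κ => l).map f₀).map f₁) _ = 1
    rw [← basisRatio_mul _ ((Pi.basis fun _ : ι => l).map f₁), basisRatio_map, h₀, h₁, one_mul]

end Determinant
/-! ## Invariance of the torsion -/

section Invariance

open Module

/-- Splitting functions on a disjoint union into pairs matches the standard bases, so it preserves
volume. -/
theorem IsSimpleIso.exists_prodEquiv {Γ ι κ α β : Type} [Group Γ] [Fintype ι] [DecidableEq ι]
    [Fintype κ] [DecidableEq κ] [Fintype α] [DecidableEq α] [Fintype β] [DecidableEq β]
    (ρ : Γ →* SU2) {F : Matrix (ι ⊕ α) (κ ⊕ β) (MonoidAlgebra ℤ Γ)} (h : IsSimpleIso F) :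
    ∃ f : ((κ → su2) × (β → su2)) ≃ₗ[ℝ] ((ι → su2) × (α → su2)),
      (∀ x y, f (x, y) = (fun i => pullback ρ F (Sum.elim x y) (Sum.inl i),
        fun i => pullback ρ F (Sum.elim x y) (Sum.inr i))) ∧
      ∀ l : Basis (Fin 3) ℝ su2,
        basisRatio (((Pi.basis fun _ : κ => l).prod (Pi.basis fun _ : β => l)).map f)
          ((Pi.basis fun _ : ι => l).prod (Pi.basis fun _ : α => l)) = 1 := by
  have hσ : ∀ {μ ν : Type} [Fintype μ] [DecidableEq μ] [Fintype ν] [DecidableEq ν]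
      (l : Basis (Fin 3) ℝ su2),
      basisRatio ((Pi.basis fun _ : μ ⊕ ν => l).map (LinearEquiv.sumArrowLequivProdArrow μ ν ℝ su2))
        ((Pi.basis fun _ : μ => l).prod (Pi.basis fun _ : ν => l)) = 1 := by
    intro μ ν _ _ _ _ l
    refine basisRatio_of_apply _ _ (Equiv.sumSigmaDistrib fun _ => Fin 3) ?_
    rintro ⟨i | i, j⟩ <;> refine Prod.ext (funext fun k => ?_) (funext fun k => ?_) <;>
      simp [LinearEquiv.sumArrowLequivProdArrow, Pi.basis_apply, Pi.single_apply]
  obtain ⟨f, hf, hr⟩ := h.exists_linearEquiv ρ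
  refine ⟨(LinearEquiv.sumArrowLequivProdArrow κ β ℝ su2).symm.trans
    (f.trans (LinearEquiv.sumArrowLequivProdArrow ι α ℝ su2)), fun x y => ?_, fun l => ?_⟩
  · simp only [← hf]
    rfl
  · let g := f.trans (LinearEquiv.sumArrowLequivProdArrow ι α ℝ su2)
    let σ := LinearEquiv.sumArrowLequivProdArrow κ β ℝ su2
    have h₁ : basisRatio (((Pi.basis fun _ : κ => l).prod (Pi.basis fun _ : β => l)).map
        (σ.symm.trans g)) ((Pi.basis fun _ : κ ⊕ β => l).map g) *
        basisRatio ((Pi.basis fun _ : κ ⊕ β => l).map g)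
          (((Pi.basis fun _ : κ => l).prod (Pi.basis fun _ : β => l)).map (σ.symm.trans g)) = 1 := by
      rw [basisRatio_mul]
      exact basisRatio_of_apply _ _ (Equiv.refl _) fun _ => rfl
    have h₂ : basisRatio ((Pi.basis fun _ : κ ⊕ β => l).map g)
        (((Pi.basis fun _ : κ => l).prod (Pi.basis fun _ : β => l)).map (σ.symm.trans g)) = 1 := by
      rw [← hσ (μ := κ) (ν := β) l, ← basisRatio_map _ _ (σ.symm.trans g)]
      congr 1
      ext1 i
      simp [σ]
    rw [h₂, mul_one] at h₁
    change basisRatio (((Pi.basis fun _ : κ => l).prod (Pi.basis fun _ : β => l)).map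
      (σ.symm.trans g)) _ = 1
    rw [← basisRatio_mul _ ((Pi.basis fun _ : κ ⊕ β => l).map g), h₁, one_mul,
      ← basisRatio_mul _ ((Pi.basis fun _ : ι ⊕ α => l).map
        (LinearEquiv.sumArrowLequivProdArrow ι α ℝ su2)), hσ, mul_one, ← hr l]
    exact basisRatio_map ((Pi.basis fun _ : κ ⊕ β => l).map f) (Pi.basis fun _ : ι ⊕ α => l)
      (LinearEquiv.sumArrowLequivProdArrow ι α ℝ su2)

/-- Identifies the coboundaries of `P` for `ρ ∘ θ` with pullbacks of matrices over the group ring of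
`Γ`, where the chain isomorphism lives. -/
theorem ringAction_foxWord {α Γ Γ' : Type} [DecidableEq α] [Group Γ] [Group Γ'] (ρ : Γ' →* SU2)
    (f : Γ →* Γ') (q : FreeGroup α →* Γ) (x : α) (l : List (α × Bool)) :
    ringAction (ρ.comp f) (foxWord q x l) = ringAction ρ (foxWord (f.comp q) x l) := by
  induction l with
  | nil => simp [foxWord]
  | cons a l ih =>
    obtain ⟨y, b⟩ := a
    cases b <;> by_cases h : y = x <;> simp [foxWord, h, ih, ringAction_single]

namespace Presentation

variable (P : Presentation) {Γ : Type} [Group Γ] (θ : P.Grp →* Γ) (ρ : Γ →* SU2)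

theorem cobdry₀_comp : P.cobdry₀ (ρ.comp θ) = pullback ρ (P.bdry₁ (θ.comp P.proj)) := by
  ext1 x
  refine LinearMap.ext fun y => funext fun i => ?_
  simp [cobdry₀, pullback_apply, bdry₁, ringAction_single]

theorem cobdry₁_comp : P.cobdry₁ (ρ.comp θ) = pullback ρ (P.bdry₂ (θ.comp P.proj)) := by
  refine LinearMap.ext fun y => funext fun i => ?_
  simp [cobdry₁, pullback_apply, bdry₂, ringAction_foxWord]

theorem cobdry₁_cobdry₀ (ρ : P.Grp →* SU2) (x : Unit → su2) :
    P.cobdry₁ ρ (P.cobdry₀ ρ x) = 0 := by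
  have h := pullback_mul ρ (P.bdry₂ P.proj) (P.bdry₁ P.proj)
  rw [P.bdry₂_mul_bdry₁ P.proj P.presents_proj.apply_rel] at h
  refine (LinearMap.congr_fun h x).symm.trans (funext fun i => ?_)
  simp [pullback_apply]

end Presentation

/-- The choices entering the torsion, as an adapted basis of the cochain complex. -/
noncomputable def TorsionChoice.toCochainBasis {P : Presentation} {ρ : P.Grp →* SU2}
    {n₀ n₁ n₂ : ℕ} (T : TorsionChoice P ρ n₀ n₁ n₂) :
    CochainBasis (P.cobdry₀ ρ) (P.cobdry₁ ρ) (Fin n₀) (Fin n₁) (Fin n₂) (Fin T.m₀) (Fin T.m₁) :=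
  ⟨T.B₀, T.B₁, T.B₂, T.closed₀, T.closed₁, T.image₀, T.image₁⟩

namespace SimpleEquivalence

variable {P Q : Presentation} (E : SimpleEquivalence P Q)

theorem pullback_inl {Γ ι κ α β : Type} [Group Γ] [Fintype κ] [Fintype β] (ρ : Γ →* SU2)
    (F : Matrix (ι ⊕ α) (κ ⊕ β) (MonoidAlgebra ℤ Γ)) (x : κ → su2) (i : ι) :
    pullback ρ F (Sum.elim x 0) (Sum.inl i) = pullback ρ F.toBlocks₁₁ x i := by
  simp [pullback_apply, Fintype.sum_sum_type, Matrix.toBlocks₁₁]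

/-- On twisted cochains the matrices of `E` give a volume preserving isomorphism from the stabilised
complex of `Q` to that of `P`. The general results on stably isomorphic cochain complexes then
apply. -/
theorem preservesTorsion : E.PreservesTorsion := by
  intro l ρ n₀ n₁ n₂ S
  obtain ⟨f₁, hf₁, r₁⟩ := E.simple₁.exists_prodEquiv ρ
  obtain ⟨f₂, hf₂, r₂⟩ := E.simple₂.exists_prodEquiv ρ
  have c₁ := (pullback_mul ρ _ _).symm.trans (congrArg (pullback ρ) E.comm₁.symm)
  have c₂ := (pullback_mul ρ _ _).symm.trans (congrArg (pullback ρ) E.comm₂.symm)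
  have hd := P.cobdry₁_cobdry₀ (ρ.comp E.θ.toMonoidHom)
  have g₀ : ∀ x, f₁ (Q.cobdry₀ ρ x, 0) = (P.cobdry₀ (ρ.comp E.θ.toMonoidHom) x, 0) := by
    intro x
    have hx : Sum.elim (Q.cobdry₀ ρ x) 0 = pullback ρ (Q.stabBdry₁ Q.proj E.b) x := by
      ext1 (i | i) <;> simp [Presentation.stabBdry₁, Presentation.cobdry₀, pullback_apply]
    rw [hf₁, hx, P.cobdry₀_comp]
    have h := LinearMap.congr_fun c₁ x
    rw [LinearMap.comp_apply] at h
    rw [h]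
    refine Prod.ext (funext fun i => ?_) (funext fun i => ?_) <;>
      simp [Presentation.stabBdry₁, pullback_apply]
  have g₁ : ∀ y : (Q.gens → su2) × (Fin E.b → su2), f₂ (Q.cobdry₁ ρ y.1, y.2) =
      (P.cobdry₁ (ρ.comp E.θ.toMonoidHom) (f₁ y).1, (f₁ y).2) := by
    rintro ⟨x, y⟩
    have hx : Sum.elim (Q.cobdry₁ ρ x) y =
        pullback ρ (Q.stabBdry₂ Q.proj E.b) (Sum.elim x y) := by
      ext1 (i | i)
      · simp [Presentation.stabBdry₂, Presentation.cobdry₁, pullback_apply]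
      · have := congrFun (LinearMap.congr_fun (pullback_one ρ) y) i
        rw [pullback_apply] at this
        simp [Presentation.stabBdry₂, pullback_apply, this]
    rw [hf₁, hf₂, hx, P.cobdry₁_comp]
    have h := LinearMap.congr_fun c₂ (Sum.elim x y)
    rw [LinearMap.comp_apply] at h
    rw [h, pullback_mul, LinearMap.comp_apply]
    refine Prod.ext (funext fun i => ?_) (funext fun i => ?_)
    · simp [Presentation.stabBdry₂, pullback_apply]
    · have := congrFun (LinearMap.congr_fun (pullback_one ρ)
        fun i => pullback ρ E.F₁ (Sum.elim x y) (Sum.inr i)) i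
      rw [pullback_apply] at this
      simpa [Presentation.stabBdry₂, pullback_apply] using this
  -- On cochains that vanish on the added cells, the isomorphism restricts to the unstabilised chain
  -- maps used in `Matches`.
  have p₁ : ∀ x, (f₁ (x, 0)).1 = pullback ρ E.f₁ x := fun x => by
    rw [hf₁]
    exact funext fun i => pullback_inl ρ E.F₁ x i
  have p₂ : ∀ x, (f₂ (x, 0)).1 = pullback ρ E.f₂ x := fun x => by
    rw [hf₂]
    exact funext fun i => pullback_inl ρ E.F₂ x i
  refine ⟨?_, fun T hT => ?_⟩
  · obtain ⟨m₀, m₁, T, t₀, t₁, t₂⟩ := CochainBasis.exists_of_stablyEquiv hd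
      (Q.cobdry₁_cobdry₀ ρ) g₀ g₁ S.toCochainBasis
    refine ⟨⟨m₀, m₁, T.B₀, T.B₁, T.B₂, T.closed₀, T.closed₁, T.image₀, T.image₁⟩, t₀,
      fun i => ⟨0, ?_⟩, fun i => ⟨0, ?_⟩⟩
    · rw [map_zero, add_zero, ← p₁]
      exact t₁ i
    · rw [map_zero, add_zero, ← p₂]
      exact t₂ i
  · refine CochainBasis.torsion_eq_of_stablyEquiv hd f₁ f₂ g₀ g₁ S.toCochainBasis
      T.toCochainBasis hT.1 (fun i => ?_) (fun i => ?_) _ _ _ _ _ _ _ (r₁ l) (r₂ l)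
    · rw [p₁]
      exact hT.2.1 i
    · rw [p₂]
      exact hT.2.2 i

end SimpleEquivalence

end Invariance

/-! ## Comparison of the presentations of a knot group -/

theorem mainTheorem7 :
    (∀ (C : Type) [Finite C] (D : KnotDiagram C) (outer : D.Region) (X Y : C),
      QEquiv (D.wirtingerPresentation Y) (D.edgePresentation X) ∧
      QEquiv (D.edgePresentation X) (D.regionPresentation outer) ∧
      QEquiv (D.wirtingerPresentation Y) (D.regionPresentation outer) ∧
      ∃ E : SimpleEquivalence (D.wirtingerPresentation Y) (D.regionPresentation outer),
        (∀ e : C × Bool,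
          E.θ ((D.wirtingerPresentation Y).proj (FreeGroup.of (D.arc e))) =
            (D.regionPresentation outer).proj
              (regionGen outer (D.right e) * (regionGen outer (D.left e))⁻¹)) ∧
        E.PreservesTorsion) ∧
    (∀ outer : Bool,
      QEquiv circleWirtinger (circleRegion outer) ∧
      ∃ E : SimpleEquivalence circleWirtinger (circleRegion outer),
        E.θ (circleWirtinger.proj (FreeGroup.of ())) =
          (circleRegion outer).proj (regionGen outer false * (regionGen outer true)⁻¹) ∧
        E.PreservesTorsion) := by
  refine ⟨fun C _ D outer X Y => ?_, fun outer => ?_⟩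
  -- Every choice of omitted crossing leads to the same region presentation, which therefore links
  -- the crossings `Y` and `X`.
  · have hE := fun Z => (D.edge_related_region Z outer (D.regionPresentation outer).proj).qEquiv
    obtain ⟨q, hq, hqe⟩ := D.wirtinger_related_region Y outer (D.regionPresentation outer).proj
      (D.regionPresentation outer).presents_proj.apply_rel
    obtain ⟨E, hEq⟩ := hq.exists_simpleEquivalence
    exact ⟨hq.qEquiv.trans (hE X).symm, hE X, hq.qEquiv, E,
      fun e => (hEq _).trans (hqe e), E.preservesTorsion⟩
  · obtain ⟨q, hq, hqe⟩ := circle_related outer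
    obtain ⟨E, hEq⟩ := hq.exists_simpleEquivalence
    exact ⟨hq.qEquiv, E, (hEq _).trans hqe, E.preservesTorsion⟩
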